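/- Conventions. Partitions are identified with their Young diagrams (English notation: the square $(r,c)$ is in row $r$ and column $c$); rows, columns and entries of tableaux are numbered from $0$. For partitions $\mu\subseteq\lambda$, a semistandard domino tableau $D$ of shape $\lambda/\mu$ is a tiling of the skew diagram $\lambda/\mu$ by dominoes, each carrying an entry in $\mathbf N$, such that entries increase weakly along rows, and strictly down columns when passing from one domino to another. Its weight $\mathrm{wt}\,D$ counts, for each $k$, the dominoes with entry $k$. The column reading of $D$ reads the columns from left to right, each one from bottom to top, a horizontal domino being read only once, with the second (right) of the two columns it meets. A word is Yamanouchi if each right factor contains, for all $i$, at least as many letters $i$ as letters $i+1$; $D$ is Yamanouchi if its column reading is. For a partition $\lambda$, $\mathrm{Can}_\lambda$ is the unique semistandard Young tableau of shape and weight $\lambda$ (all entries of row $r$ are equal to $r$). The map $\pi$. A tableau switching family is a family of partitions $(\lambda^{[i,j]})_{0\le i\le m,\,0\le j\le n}$ in which increasing $i$ or $j$ by $1$ adds one square, and such that $\lambda^{[i+1,j]}=\lambda^{[i,j+1]}$ if and only if $\lambda^{[i+1,j+1]}/\lambda^{[i,j]}$ is a domino. The standardisation of a semistandard (skew, or domino)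 tableau is the chain of partitions in which its squares (respectively dominoes) are added by increasing entries, and from left to right (i.e. by increasing diagonal index $c-r$) among equal entries. If a skew semistandard tableau $A$ and another one $B$ with the same weight have as standardisations the row $i=1$ and the row $i=0$, respectively, of a tableau switching family with $m=1$, then $B$ is said to be obtained from $A$ by an inward jeu de taquin slide; jeu de taquin equivalence $\rhd$ is the equivalence relation generated by these slides. For a semistandard domino tableau $D$ with $n$ dominoes there is a unique symmetric tableau switching family ($\lambda^{[i,j]}=\lambda^{[j,i]}$ for $0\le i,j\le n$) whose diagonal $(\lambda^{[i,i]})_{0\le i\le n}$ is the standardisation of $D$; the self-switching pair $\pi_1(D)=(U,V)$ consists of the skew semistandard tableaux $U$, $V$ with the same weight as $D$ whose standardisations are $(\lambda^{[i,0]})_{0\le i\le n}$ and $(\lambda^{[n,j]})_{0\le j\le n}$. One has $U\rhd V$, and $\pi(D)$ is the semistandard Young tableau with $\pi(D)\rhd U\rhd V$. The Carré–Leclerc correspondence. In a word, match the letters $i+1$ and $i$ as opening and closing parentheses; the operation $e_i$ changes the leftmost unmatched $i+1$ (if any) into $i$. For Young tableaux, $e_i$ is applied to the column reading (columns from left to right,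 each from bottom to top). For a domino tableau $D$, $e_i$ changes the entry of the domino that contributes the leftmost unmatched $i+1$ of the column reading into $i$, and then, as long as the filling is not semistandard, rearranges dominoes with entries $i$, $i+1$ in one of the following ways. (1) In a rectangle of $2$ rows and $3$ columns: two horizontal dominoes in the first two columns with entries $i$ (top) and $i+1$ (bottom), followed by a vertical domino with entry $i$ in the third column, are replaced by a vertical domino with entry $i$ in the first column, followed by two horizontal dominoes with entries $i$ (top) and $i+1$ (bottom). (2) In a rectangle of $3$ rows and $2$ columns: a horizontal domino with entry $i$ in the first row, above two vertical dominoes with entries $i$ and $i+1$ in either order, are replaced by two vertical dominoes with entries $i$ in the first two rows, above a horizontal domino with entry $i+1$. A pair $(Y,T)$ is associated to $D$ as follows: operations $e_{i_1},e_{i_2},\ldots,e_{i_l}$, chosen in any way such that each one is applicable, are successively applied to $D$ until a Yamanouchi domino tableau $Y$ is reached; $T$ is the semistandard Young tableau, whose shape is the partition $\nu=\mathrm{wt}\,Y$, for which successive application of $e_{i_1},\ldots,e_{i_l}$ to $T$ gives $\mathrm{Can}_\nu$. Theorem. Let $D$ be any semistandard domino tableau of skew shape $\lambda/\mu$. Then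 $\pi(D)$ is well defined, i.e., there exists exactly one Young tableau that satisfies its defining condition; there is at least one pair $(Y,T)$ associated to $D$ by the Carré–Leclerc correspondence, and any such pair has $T=\pi(D)$. In particular, if $\mathrm{wt}\,D=\kappa$ is a partition, then $D$ is a Yamanouchi domino tableau if and only if $\pi(D)=\mathrm{Can}_\kappa$. -/

import Mathlib

/-! Conventions: partitions are Young diagrams in English notation, the square `(r, c)` lies in
row `r` and column `c`, and rows, columns and tableau entries are all numbered from `0`. -/

/-- A domino, given by its upper left square `(row, col)` and its orientation. -/
structure Domino where
  row : ℕ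
  col : ℕ
  vertical : Bool
deriving DecidableEq

namespace Domino

/-- The horizontal domino `{(r, c), (r, c + 1)}`. -/
def horiz (r c : ℕ) : Domino := ⟨r, c, false⟩

/-- The vertical domino `{(r, c), (r + 1, c)}`. -/
def vert (r c : ℕ) : Domino := ⟨r, c, true⟩

/-- The bottom row that the domino meets. -/
def lastRow (d : Domino) : ℕ := if d.vertical then d.row + 1 else d.row

/-- The rightmost column that the domino meets. -/
def lastCol (d : Domino) : ℕ := if d.vertical then d.col else d.col + 1

/-- The two squares of a domino. -/
def cells (d : Domino) : Finset (ℕ × ℕ) := {(d.row, d.col), (d.lastRow, d.lastCol)}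

/-- The position of a domino: the larger of the indices `c - r` of the two diagonals it meets. -/
def pos (d : Domino) : ℤ := (d.lastCol : ℤ) - (d.row : ℤ)

end Domino

/-! ### Words, the Yamanouchi condition and the raising position

A word is presented as a finite set `S` of places, with a relation `before` that orders the places
from left to right, and a letter `e x` at each place `x`. -/

section Words

variable {α : Type*}

open scoped Classical in
/-- The number of letters `k` in the factor of the word that starts at `x` and ends at `z`. -/
noncomputable def countBetween (S : Finset α) (before : α → α → Prop) (e : α → ℕ)
    (x z : α) (k : ℕ) : ℕ :=
  (S.filter fun y => (y = x ∨ before x y) ∧ (y = z ∨ before y z) ∧ e y = k).card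

open scoped Classical in
/-- The number of letters `k` in the right factor of the word that starts at `x`. -/
noncomputable def countFrom (S : Finset α) (before : α → α → Prop) (e : α → ℕ)
    (x : α) (k : ℕ) : ℕ :=
  (S.filter fun y => (y = x ∨ before x y) ∧ e y = k).card

/-- A Yamanouchi word: each right factor contains at least as many `i` as `i + 1`. -/
def IsYamanouchiWord (S : Finset α) (before : α → α → Prop) (e : α → ℕ) : Prop :=
  ∀ x ∈ S, ∀ i, countFrom S before e x (i + 1) ≤ countFrom S before e x i

/-- Read each `i + 1` as an opening and each `i` as a closing parenthesis. The place `x` holds an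
unmatched opening parenthesis: each factor that starts at `x` has more `i + 1` than `i`. -/
def IsUnmatched (S : Finset α) (before : α → α → Prop) (e : α → ℕ) (i : ℕ) (x : α) : Prop :=
  x ∈ S ∧ ∀ z ∈ S, z = x ∨ before x z →
    countBetween S before e x z i < countBetween S before e x z (i + 1)

/-- The leftmost unmatched `i + 1`: the letter that the coplactic operation `e_i` changes
into `i`. -/
def IsRaisingPlace (S : Finset α) (before : α → α → Prop) (e : α → ℕ) (i : ℕ) (x : α) : Prop :=
  IsUnmatched S before e i x ∧ ∀ y ∈ S, before y x → ¬ IsUnmatched S before e i y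

end Words

/-! ### Semistandard domino tableaux -/

/-- Semistandard domino tableaux of skew shape `lam / mu`: tilings of the skew diagram by dominoes
that carry one entry each, weakly increasing along rows, and strictly increasing down columns
from one domino to the next. -/
structure DominoTableau (lam mu : YoungDiagram) where
  /-- The dominoes together with their entries. -/
  dominoes : Finset (Domino × ℕ)
  le : mu ≤ lam
  disjoint : ∀ x ∈ dominoes, ∀ y ∈ dominoes, x ≠ y → Disjoint x.1.cells y.1.cells
  cover : (dominoes.biUnion fun x => x.1.cells) = lam.cells \ mu.cells
  row_weak : ∀ x ∈ dominoes, ∀ y ∈ dominoes, ∀ r c : ℕ,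
    (r, c) ∈ x.1.cells → (r, c + 1) ∈ y.1.cells → x.2 ≤ y.2
  col_strict : ∀ x ∈ dominoes, ∀ y ∈ dominoes, x ≠ y → ∀ r c : ℕ,
    (r, c) ∈ x.1.cells → (r + 1, c) ∈ y.1.cells → x.2 < y.2

/-- The column reading order: columns from left to right, each from bottom to top, where a
horizontal domino is read only once, with the second of the two columns that it meets. -/
def dominoBefore (x y : Domino × ℕ) : Prop :=
  x.1.lastCol < y.1.lastCol ∨ (x.1.lastCol = y.1.lastCol ∧ y.1.lastRow < x.1.lastRow)

namespace DominoTableau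

variable {lam mu : YoungDiagram}

/-- The weight: the number of dominoes with entry `k`. -/
def weight (D : DominoTableau lam mu) (k : ℕ) : ℕ :=
  (D.dominoes.filter fun x => x.2 = k).card

/-- Yamanouchi domino tableaux: those whose column reading is a Yamanouchi word. -/
def IsYamanouchi (D : DominoTableau lam mu) : Prop :=
  IsYamanouchiWord D.dominoes dominoBefore Prod.snd

end DominoTableau

/-- The local rearrangements of dominoes with entries `i` and `i + 1` that repair a violation of
semistandardness caused by changing an entry `i + 1` into `i`. In `shiftLeft` the rectangle has
`2` rows and `3` columns, in `shiftUp₁` and `shiftUp₂` it has `3` rows and `2` columns. -/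
inductive Repair (i : ℕ) : Finset (Domino × ℕ) → Finset (Domino × ℕ) → Prop
  | shiftLeft (F : Finset (Domino × ℕ)) (r c : ℕ)
      (h : {(Domino.horiz r c, i), (Domino.horiz (r + 1) c, i + 1),
        (Domino.vert r (c + 2), i)} ⊆ F) :
      Repair i F
        ((F \ {(Domino.horiz r c, i), (Domino.horiz (r + 1) c, i + 1),
            (Domino.vert r (c + 2), i)}) ∪
          {(Domino.vert r c, i), (Domino.horiz r (c + 1), i),
            (Domino.horiz (r + 1) (c + 1), i + 1)})
  | shiftUp₁ (F : Finset (Domino × ℕ)) (r c : ℕ)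
      (h : {(Domino.horiz r c, i), (Domino.vert (r + 1) c, i),
        (Domino.vert (r + 1) (c + 1), i + 1)} ⊆ F) :
      Repair i F
        ((F \ {(Domino.horiz r c, i), (Domino.vert (r + 1) c, i),
            (Domino.vert (r + 1) (c + 1), i + 1)}) ∪
          {(Domino.vert r c, i), (Domino.vert r (c + 1), i), (Domino.horiz (r + 2) c, i + 1)})
  | shiftUp₂ (F : Finset (Domino × ℕ)) (r c : ℕ)
      (h : {(Domino.horiz r c, i), (Domino.vert (r + 1) c, i + 1),
        (Domino.vert (r + 1) (c + 1), i)} ⊆ F) :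
      Repair i F
        ((F \ {(Domino.horiz r c, i), (Domino.vert (r + 1) c, i + 1),
            (Domino.vert (r + 1) (c + 1), i)}) ∪
          {(Domino.vert r c, i), (Domino.vert r (c + 1), i), (Domino.horiz (r + 2) c, i + 1)})

/-- `D'` is obtained from `D` by one step of the Carré-Leclerc algorithm: in the column reading
the leftmost unmatched `i + 1` is changed into `i`, and the resulting filling is rearranged until
it is semistandard again (each rearrangement applies only to a filling that is not). -/
def DominoTableau.Raise {lam mu : YoungDiagram} (i : ℕ) (D D' : DominoTableau lam mu) : Prop :=
  ∃ x : Domino × ℕ, IsRaisingPlace D.dominoes dominoBefore Prod.snd i x ∧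
    Relation.ReflTransGen (Repair i) (insert (x.1, i) (D.dominoes.erase x)) D'.dominoes

/-! ### Young tableaux -/

/-- Semistandard Young tableaux of arbitrary (straight) shape. -/
abbrev YoungTableau := Σ kap : YoungDiagram, SemistandardYoungTableau kap

/-- The canonical tableau, of shape and weight `kap`: all entries in row `r` are `r`. -/
def canonicalTableau (kap : YoungDiagram) : YoungTableau :=
  ⟨kap, SemistandardYoungTableau.highestWeight kap⟩

/-- The column reading order for squares: columns from left to right, each from bottom to top. -/
def squareBefore (s t : ℕ × ℕ) : Prop := s.2 < t.2 ∨ (s.2 = t.2 ∧ t.1 < s.1)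

/-- `T'` is obtained from `T` by the coplactic operation `e_i`: in the column reading the leftmost
unmatched `i + 1` is changed into `i`. -/
def YoungRaise {kap : YoungDiagram} (i : ℕ) (T T' : SemistandardYoungTableau kap) : Prop :=
  ∃ s : ℕ × ℕ, IsRaisingPlace kap.cells squareBefore (fun s => T s.1 s.2) i s ∧
    ∀ r c : ℕ, T' r c = if (r, c) = s then i else T r c

/-- The Carré-Leclerc correspondence. Steps of the algorithm are applied to `D` until a Yamanouchi
domino tableau `Y` is reached; the Young tableau is obtained from the canonical tableau whose shape
is the weight of `Y` by undoing the corresponding steps in the reverse order. -/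
inductive CarreLeclerc {lam mu : YoungDiagram} :
    DominoTableau lam mu → DominoTableau lam mu → YoungTableau → Prop
  | yamanouchi (Y : DominoTableau lam mu) (kap : YoungDiagram) (hY : Y.IsYamanouchi)
      (hw : ∀ k, Y.weight k = kap.rowLen k) : CarreLeclerc Y Y (canonicalTableau kap)
  | step (i : ℕ) (D D' Y : DominoTableau lam mu) (kap : YoungDiagram)
      (T T' : SemistandardYoungTableau kap) (hD : D.Raise i D') (hT : YoungRaise i T T')
      (h : CarreLeclerc D' Y ⟨kap, T'⟩) : CarreLeclerc D Y ⟨kap, T⟩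

/-! ### Tableau switching, jeu de taquin and the projection `π` -/

/-- Semistandard tableaux of skew shape `outer / inner`, with entries set to `0` off the shape. -/
structure SkewTableau where
  outer : YoungDiagram
  inner : YoungDiagram
  le : inner ≤ outer
  entry : ℕ → ℕ → ℕ
  row_weak : ∀ r c : ℕ, (r, c) ∈ outer.cells \ inner.cells → (r, c + 1) ∈ outer.cells \ inner.cells →
    entry r c ≤ entry r (c + 1)
  col_strict : ∀ r c : ℕ, (r, c) ∈ outer.cells \ inner.cells →
    (r + 1, c) ∈ outer.cells \ inner.cells → entry r c < entry (r + 1) c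
  zeros : ∀ r c : ℕ, (r, c) ∉ outer.cells \ inner.cells → entry r c = 0

/-- A Young tableau as a skew tableau, of shape `kap / ∅`. -/
def YoungTableau.toSkew (T : YoungTableau) : SkewTableau where
  outer := T.1
  inner := ⊥
  le := bot_le
  entry := fun r c => T.2 r c
  row_weak := fun r c _ h => T.2.row_weak (Nat.lt_succ_self c) (by simpa using h)
  col_strict := fun r c _ h => T.2.col_strict (Nat.lt_succ_self r) (by simpa using h)
  zeros := fun r c h => T.2.zeros (by simpa using h)

/-- The index `c - r` of the diagonal of a square. -/
def squarePos (s : ℕ × ℕ) : ℤ := (s.2 : ℤ) - (s.1 : ℤ)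

/-- The chain of partitions `c 0, …, c n` is the standardisation of the semistandard tableau `W`,
and `w 0, …, w (n - 1)` are the entries of `W` in weakly increasing order: the squares of `W` are
added by increasing entries, and from left to right among equal entries. -/
def SkewTableau.IsStandardisation (W : SkewTableau) (n : ℕ) (c : ℕ → YoungDiagram)
    (w : ℕ → ℕ) : Prop :=
  c 0 = W.inner ∧ c n = W.outer ∧ ∃ s : ℕ → ℕ × ℕ,
    (∀ k < n, s k ∉ (c k).cells ∧ (c (k + 1)).cells = insert (s k) (c k).cells ∧
      W.entry (s k).1 (s k).2 = w k) ∧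
    ∀ k, k + 1 < n →
      w k < w (k + 1) ∨ (w k = w (k + 1) ∧ squarePos (s k) < squarePos (s (k + 1)))

/-- The chain of partitions `c 0, …, c n` is the standardisation of the semistandard domino
tableau `D`, and `w 0, …, w (n - 1)` are the entries of `D` in weakly increasing order: the dominoes
of `D` are added by increasing entries, and from left to right among equal entries. -/
def DominoTableau.IsStandardisation {lam mu : YoungDiagram} (D : DominoTableau lam mu) (n : ℕ)
    (c : ℕ → YoungDiagram) (w : ℕ → ℕ) : Prop :=
  c 0 = mu ∧ c n = lam ∧ ∃ d : ℕ → Domino,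
    (∀ k < n, Disjoint (d k).cells (c k).cells ∧ (c (k + 1)).cells = (d k).cells ∪ (c k).cells ∧
      (d k, w k) ∈ D.dominoes) ∧
    ∀ k, k + 1 < n →
      w k < w (k + 1) ∨ (w k = w (k + 1) ∧ (d k).pos < (d (k + 1)).pos)

/-- The partition `b` is obtained from the partition `a` by adding one square. -/
def AddsSquare (a b : YoungDiagram) : Prop := a ≤ b ∧ b.card = a.card + 1

/-- `F i j`, for `0 ≤ i ≤ m` and `0 ≤ j ≤ n`, is a tableau switching family of partitions: steps
in either direction add one square, and the two intermediate partitions between `F i j` and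
`F (i + 1) (j + 1)` differ unless these two partitions differ by a domino. -/
structure IsSwitchingFamily (m n : ℕ) (F : ℕ → ℕ → YoungDiagram) : Prop where
  vertical : ∀ i j, i < m → j ≤ n → AddsSquare (F i j) (F (i + 1) j)
  horizontal : ∀ i j, i ≤ m → j < n → AddsSquare (F i j) (F i (j + 1))
  switch : ∀ i j, i < m → j < n →
    (F (i + 1) j = F i (j + 1) ↔ ∃ d : Domino, (F (i + 1) (j + 1)).cells \ (F i j).cells = d.cells)

/-- `B` is obtained from `A` by an inward jeu de taquin slide: the standardisations of `A` and `B`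
are the bottom and top rows of a tableau switching family with two rows, and `A` and `B` have the
same weight. -/
def Slide (A B : SkewTableau) : Prop :=
  ∃ (n : ℕ) (F : ℕ → ℕ → YoungDiagram) (w : ℕ → ℕ), IsSwitchingFamily 1 n F ∧
    A.IsStandardisation n (F 1) w ∧ B.IsStandardisation n (F 0) w

/-- Jeu de taquin equivalence of skew semistandard tableaux. -/
def JeuDeTaquinEquiv : SkewTableau → SkewTableau → Prop := Relation.EqvGen Slide

/-- `(U, V) = π₁(D)`: the standardisation of `D` is the diagonal of a symmetric tableau switching
family, and `U` and `V` are the semistandard tableaux with the weight of `D` whose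
standardisations are the left edge and the bottom edge of that family. -/
def IsSelfSwitchingPair {lam mu : YoungDiagram} (D : DominoTableau lam mu)
    (U V : SkewTableau) : Prop :=
  ∃ (n : ℕ) (F : ℕ → ℕ → YoungDiagram) (w : ℕ → ℕ), IsSwitchingFamily n n F ∧
    (∀ i j, i ≤ n → j ≤ n → F i j = F j i) ∧
    D.IsStandardisation n (fun i => F i i) w ∧
    U.IsStandardisation n (fun i => F i 0) w ∧ V.IsStandardisation n (fun j => F n j) w

/-- `T = π(D)`: the Young tableau `T` is jeu de taquin equivalent to the components `U` and `V`
of `π₁(D)`. -/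
def IsProjection {lam mu : YoungDiagram} (D : DominoTableau lam mu) (T : YoungTableau) : Prop :=
  ∃ U V : SkewTableau, IsSelfSwitchingPair D U V ∧
    JeuDeTaquinEquiv T.toSkew U ∧ JeuDeTaquinEquiv U V

/-!
A tableau is encoded by the chain of partitions formed by its entries less than `p`, and each
partition by the partial sums of its row lengths. In these terms, switching two horizontal strips is
the tropical octahedron recurrence `Octa`, by which the partition at one corner of a quadrilateral
is determined by those at the other three. Hence a jeu de taquin slide relates two chains by a strip
of such quadrilaterals (`CoSlide`), and a symmetric tableau switching family with the
standardisation of `D` on its diagonal can be coarsened to a symmetric solution of the recurrence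
(`IsSymmFamily`) with the chain of `D` on its diagonal (`IsProjection.isOctaProjection`).

The operation `e_i` adds a square to the partition with index `i + 1` of a chain, in the first row
`r` where the `excess`, of the letters `i + 1` in the rows up to `r` over the letters `i` in the
rows above `r`, attains its maximum. For Young tableaux this is `YoungRaise.chain_eq`. The
recurrence turns maxima of the excess along one edge of a pair of adjacent squares into maxima along
the opposite edge (`Octa.bump_up`, `Octa.bump_down`), so raising operations commute with slides
(`eqvGen_bump`). Applied to the rows and then to the columns of a symmetric family, they give a
symmetric family again, in which two squares have been added to one partition of the diagonal. By
`IsSymmFamily.exists_bump_cases` there are three possibilities for these squares. They are precisely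
the three outcomes of a step of the Carré-Leclerc algorithm (`DominoTableau.Raise.chain_eq`): no
repair, repairs `shiftLeft`, or one repair `shiftUp`. That the result of the repairs does not depend
on choices follows by counting the squares and the vertical dominoes in each row (`repairs_unique`).

Therefore raising commutes with the projection (`DominoTableau.Raise.exists_youngRaise`). Moreover,
the recurrence forces the parities that make the changed diagonal the chain of a domino tableau, so
that each domino tableau that is not Yamanouchi can be raised (`DominoTableau.exists_raise`). The
theorem follows by induction over raising steps: the operations on Young tableaux are injective
(`YoungRaise.source_unique`), and for a Yamanouchi domino tableau all excesses are nonpositive,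
which forces the projection to be the canonical tableau whose shape is the weight
(`DominoTableau.IsYamanouchi.projection_eq`).
-/


/-! ### The octahedron recurrence -/

/-- The corners `m` (top left), `a`, `b` and `l` (bottom right) of a square satisfy the tropical
octahedron recurrence. When the four functions are the partial sums of the parts of partitions
that differ by horizontal strips, this says that the two ways around the square are
related by tableau switching. -/
def Octa (m a b l : ℕ → ℤ) : Prop :=
  a 0 + b 0 = m 0 + l 0 ∧
    ∀ r, a (r + 1) + b (r + 1) = max (m (r + 1) + l (r + 1)) (m r + l (r + 2))

theorem Octa.symm {m a b l : ℕ → ℤ} (h : Octa m a b l) : Octa m b a l :=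
  ⟨by have := h.1; omega, fun r => by have := h.2 r; omega⟩

/-- Two adjacent squares can be merged if the strips along their upper edges are added from
left to right. -/
theorem Octa.merge {c0 c1 d0 d1 e0 e1 : ℕ → ℤ} (h : Octa c0 c1 d0 d1) (h' : Octa d0 d1 e0 e1)
    (hcd : ∀ r, c0 (r + 1) - c0 r ≤ d0 (r + 1) - d0 r)
    (hde : ∀ r, d1 (r + 1) - d1 r ≤ e1 (r + 1) - e1 r)
    (hd : ∀ r, d1 (r + 2) - d1 (r + 1) ≤ d0 (r + 1) - d0 r)
    (hlr : ∀ r, c0 (r + 1) - c0 r < d0 (r + 1) - d0 r →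
      e0 (r + 2) - e0 (r + 1) = d0 (r + 2) - d0 (r + 1)) : Octa c0 c1 e0 e1 := by
  refine ⟨by have := h.1; have := h'.1; omega, fun r => ?_⟩
  have h1 := h.2 r
  have h2 := h'.2 r
  have h3 := h'.2 (r + 1)
  have k1 := hcd r
  have k2 := hde (r + 1)
  have k3 := hd r
  have k4 := hlr r
  simp only [add_assoc, Nat.reduceAdd] at *
  omega

/-- `s` is the first place where `f` attains its maximum. -/
def IsFirstMax (f : ℕ → ℤ) (s : ℕ) : Prop := (∀ r, f r ≤ f s) ∧ ∀ r < s, f r < f s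

theorem IsFirstMax.unique {f : ℕ → ℤ} {s t : ℕ} (hs : IsFirstMax f s) (ht : IsFirstMax f t) :
    s = t := by
  rcases lt_trichotomy s t with h | h | h
  · have := ht.2 s h; have := hs.1 t; omega
  · exact h
  · have := hs.2 t h; have := ht.1 s; omega

theorem exists_isFirstMax {f : ℕ → ℤ} {B : ℤ} (hB : ∀ r, f r ≤ B) : ∃ s, IsFirstMax f s := by
  classical
  obtain ⟨M, ⟨r0, hr0⟩, hM⟩ := Int.exists_greatest_of_bdd (P := fun z => ∃ r, f r = z)
    ⟨B, fun z ⟨r, hr⟩ => hr ▸ hB r⟩ ⟨f 0, 0, rfl⟩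
  have hex : ∃ r, f r = M := ⟨r0, hr0⟩
  refine ⟨Nat.find hex, fun r => ?_, fun r hr => ?_⟩
  · rw [Nat.find_spec hex]; exact hM _ ⟨r, rfl⟩
  · rw [Nat.find_spec hex]
    exact lt_of_le_of_ne (hM _ ⟨r, rfl⟩) (Nat.find_min hex hr)

/-- The function `f`, increased by `1` beyond `s`: in terms of partial sums, a square is added in
row `s`. -/
def bump (s : ℕ) (f : ℕ → ℤ) (r : ℕ) : ℤ := f r + if s < r then 1 else 0

/-- For three successive partitions in the chain of a tableau, presented by partial sums: the excess
of letters of the second kind in the rows `≤ r` over letters of the first kind in the rows `< r`. -/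
def excess (m a l : ℕ → ℤ) (r : ℕ) : ℤ := l (r + 1) - a (r + 1) - a r + m r

/-- Transport of a raising operation across a pair of adjacent squares, with upper edge
`m', a', l'` and lower edge `m, a, l`, from the lower to the upper edge.
The row of the added square stays the same or decreases by one, and the last clause tells which
alternative holds. -/
theorem Octa.bump_up {m' a' l' m a l : ℕ → ℤ} (h : Octa m' a' m a) (h' : Octa a' l' a l) {s : ℕ}
    (hs : IsFirstMax (excess m a l) s) :
    ∃ s', IsFirstMax (excess m' a' l') s' ∧ excess m' a' l' s' = excess m a l s ∧
      Octa m' (bump s' a') m (bump s a) ∧ Octa (bump s' a') l' (bump s a) l ∧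
      ((s' = s ∧ (∀ q, q + 1 = s → m' q + a (q + 2) < m' (q + 1) + a (q + 1)) ∧
          l (s + 2) + a' s ≤ l (s + 1) + a' (s + 1)) ∨
        (s = s' + 1 ∧ m' (s' + 1) + a (s' + 1) ≤ m' s' + a (s' + 2) ∧
          l (s' + 1) + a' (s' + 1) < l (s' + 2) + a' s')) := by
  set u : ℕ → ℤ := fun r => l (r + 1) - a (r + 1) - a' r + m' r with hu
  set v : ℕ → ℤ := fun r => l (r + 2) - a (r + 1) - a' (r + 1) + m' r with hv
  have hup : ∀ r, excess m' a' l' r = max (u r) (v r) := fun r => by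
    have := h'.2 r; simp only [excess, hu, hv]; omega
  have hlo0 : excess m a l 0 = u 0 := by
    have := h.1; simp only [excess, hu]; omega
  have hlo : ∀ r, excess m a l (r + 1) = max (u (r + 1)) (v r) := fun r => by
    have := h.2 r; simp only [excess, hu, hv, add_assoc, Nat.reduceAdd]; omega
  obtain ⟨hs1, hs2⟩ := hs
  set M := excess m a l s with hM
  have huM : ∀ r, u r ≤ M := fun r => by
    cases r with
    | zero => have := hs1 0; omega
    | succ r => have := hs1 (r + 1); have := hlo r; omega
  have hvM : ∀ r, v r ≤ M := fun r => by have := hs1 (r + 1); have := hlo r; omega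
  have huM' : ∀ r < s, u r < M := fun r hr => by
    cases r with
    | zero => have := hs2 0 hr; omega
    | succ r => have := hs2 (r + 1) hr; have := hlo r; omega
  have hvM' : ∀ r, r + 1 < s → v r < M := fun r hr => by
    have := hs2 (r + 1) hr; have := hlo r; omega
  by_cases hc : ∃ r, r + 1 = s ∧ v r = M
  · -- the maximum is first attained on a descending edge, and the square moves up by one row
    obtain ⟨r, rfl, hr⟩ := hc
    have hr' : excess m' a' l' r = M := by have := hup r; have := huM r; omega
    refine ⟨r, ⟨fun q => ?_, fun q hq => ?_⟩, hr', ⟨?_, fun q => ?_⟩, ⟨?_, fun q => ?_⟩,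
      Or.inr ⟨rfl, ?_, ?_⟩⟩
    · have := hup q; have := huM q; have := hvM q; omega
    · have := hup q; have := huM' q (by omega); have := hvM' q (by omega); omega
    · have := h.1; simp only [bump]; omega
    · have h1 := h.2 q
      have h2 := huM (q + 1)
      simp only [bump]
      by_cases hq : q = r
      · subst hq; simp only [hu, hv, add_assoc, Nat.reduceAdd] at *; split_ifs <;> omega
      · split_ifs <;> omega
    · have := h'.1; simp only [bump]; omega
    · have h1 := h'.2 q
      simp only [bump]
      by_cases hq : q = r
      · subst hq
        have := huM' q (by omega)
        simp only [hu, hv, add_assoc, Nat.reduceAdd] at *; split_ifs <;> omega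
      · split_ifs <;> omega
    · have := huM (r + 1)
      simp only [hu, hv, add_assoc, Nat.reduceAdd] at *; omega
    · have := huM' r (by omega)
      simp only [hu, hv, add_assoc, Nat.reduceAdd] at *; omega
  · have hvs : ∀ r, r + 1 ≤ s → v r < M := fun r hr => by
      rcases Nat.lt_or_ge (r + 1) s with h1 | h1
      · exact hvM' r h1
      · exact lt_of_le_of_ne (hvM r) fun h2 => hc ⟨r, by omega, h2⟩
    have hus : u s = M := by
      cases s with
      | zero => omega
      | succ s => have := hlo s; have := hvs s le_rfl; omega
    have hr' : excess m' a' l' s = M := by have := hup s; have := hvM s; omega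
    refine ⟨s, ⟨fun q => ?_, fun q hq => ?_⟩, hr', ⟨?_, fun q => ?_⟩, ⟨?_, fun q => ?_⟩,
      Or.inl ⟨rfl, ?_, ?_⟩⟩
    · have := hup q; have := huM q; have := hvM q; omega
    · have := hup q; have := huM' q (by omega); have := hvs q (by omega); omega
    · have := h.1; simp only [bump]; omega
    · have h1 := h.2 q
      simp only [bump]
      by_cases hq : q + 1 = s
      · subst hq
        have := hvs q le_rfl
        simp only [hu, hv, add_assoc, Nat.reduceAdd] at *; split_ifs <;> omega
      · split_ifs <;> omega
    · have := h'.1; simp only [bump]; omega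
    · have h1 := h'.2 q
      simp only [bump]
      by_cases hq : q = s
      · subst hq
        have := hvM q
        simp only [hu, hv, add_assoc, Nat.reduceAdd] at *; split_ifs <;> omega
      · split_ifs <;> omega
    · rintro q rfl
      have := hvs q le_rfl
      simp only [hu, hv, add_assoc, Nat.reduceAdd] at *; omega
    · have := hvM s
      simp only [hu, hv, add_assoc, Nat.reduceAdd] at *; omega

/-- Transport of a raising operation across a pair of adjacent squares, from the upper to the lower
edge. -/
theorem Octa.bump_down {m' a' l' m a l : ℕ → ℤ} (h : Octa m' a' m a) (h' : Octa a' l' a l) {s' : ℕ}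
    (hs : IsFirstMax (excess m' a' l') s') :
    ∃ s, IsFirstMax (excess m a l) s ∧ excess m' a' l' s' = excess m a l s ∧
      Octa m' (bump s' a') m (bump s a) ∧ Octa (bump s' a') l' (bump s a) l := by
  -- the excesses along the two edges have the same upper bounds
  have key : ∃ s, IsFirstMax (excess m a l) s := by
    refine exists_isFirstMax (B := excess m' a' l' s') fun r => ?_
    cases r with
    | zero =>
      have h1 := hs.1 0; have h2 := h.1; have h3 := h'.2 0
      simp only [excess] at *; omega
    | succ r =>
      have h1 := hs.1 r; have h2 := h.2 r; have h3 := h'.2 r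
      have h4 := hs.1 (r + 1); have h5 := h'.2 (r + 1)
      simp only [excess, add_assoc, Nat.reduceAdd] at *; omega
  obtain ⟨s, hs1⟩ := key
  obtain ⟨t, ht, he, h1, h2, -⟩ := h.bump_up h' hs1
  obtain rfl := hs.unique ht
  exact ⟨s, hs1, he, h1, h2⟩

/-! ### Chains of partitions and their raising operations -/

/-- The excess function of a chain that governs the operation `e_i`. -/
def chainExcess (A : ℕ → ℕ → ℤ) (i : ℕ) : ℕ → ℤ := excess (A i) (A (i + 1)) (A (i + 2))

/-- Adding a square in row `s` to the partition with index `i + 1` of a chain. -/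
def chainBump (A : ℕ → ℕ → ℤ) (i s : ℕ) : ℕ → ℕ → ℤ :=
  Function.update A (i + 1) (bump s (A (i + 1)))

theorem chainBump_self (A : ℕ → ℕ → ℤ) (i s : ℕ) :
    chainBump A i s (i + 1) = bump s (A (i + 1)) := by
  simp [chainBump]

theorem chainBump_ne (A : ℕ → ℕ → ℤ) {i s p : ℕ} (h : p ≠ i + 1) : chainBump A i s p = A p := by
  simp [chainBump, h]

/-- The chains `A` (below) and `B` (above) are opposite edges of a strip of squares. -/
def CoSlide (A B : ℕ → ℕ → ℤ) : Prop := ∀ p, Octa (B p) (B (p + 1)) (A p) (A (p + 1))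

theorem CoSlide.chainBump_of {A B : ℕ → ℕ → ℤ} (h : CoSlide A B) {i s t : ℕ}
    (h1 : Octa (B i) (bump t (B (i + 1))) (A i) (bump s (A (i + 1))))
    (h2 : Octa (bump t (B (i + 1))) (B (i + 2)) (bump s (A (i + 1))) (A (i + 2))) :
    CoSlide (chainBump A i s) (chainBump B i t) := by
  intro p
  by_cases hp : p = i
  · subst hp
    rw [chainBump_self, chainBump_self, chainBump_ne _ (by omega), chainBump_ne _ (by omega)]
    exact h1
  · by_cases hp' : p = i + 1
    · subst hp'
      rw [chainBump_self, chainBump_self, chainBump_ne _ (by omega), chainBump_ne _ (by omega)]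
      exact h2
    · rw [chainBump_ne _ hp', chainBump_ne _ hp', chainBump_ne _ (by omega),
        chainBump_ne _ (by omega)]
      exact h p

theorem CoSlide.bump_up {A B : ℕ → ℕ → ℤ} (h : CoSlide A B) {i s : ℕ}
    (hs : IsFirstMax (chainExcess A i) s) :
    ∃ t, IsFirstMax (chainExcess B i) t ∧ chainExcess B i t = chainExcess A i s ∧
      CoSlide (chainBump A i s) (chainBump B i t) := by
  obtain ⟨t, ht, he, h1, h2, -⟩ := (h i).bump_up (h (i + 1)) hs
  exact ⟨t, ht, he, h.chainBump_of h1 h2⟩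

theorem CoSlide.bump_down {A B : ℕ → ℕ → ℤ} (h : CoSlide A B) {i t : ℕ}
    (ht : IsFirstMax (chainExcess B i) t) :
    ∃ s, IsFirstMax (chainExcess A i) s ∧ chainExcess B i t = chainExcess A i s ∧
      CoSlide (chainBump A i s) (chainBump B i t) := by
  obtain ⟨s, hs, he, h1, h2⟩ := (h i).bump_down (h (i + 1)) ht
  exact ⟨s, hs, he, h.chainBump_of h1 h2⟩

/-- Raising operations commute with all slides. -/
theorem eqvGen_bump {A B : ℕ → ℕ → ℤ} (h : Relation.EqvGen CoSlide A B) (i : ℕ) :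
    (∀ s, IsFirstMax (chainExcess A i) s → ∃ t, IsFirstMax (chainExcess B i) t ∧
      chainExcess A i s = chainExcess B i t ∧
      Relation.EqvGen CoSlide (chainBump A i s) (chainBump B i t)) ∧
    ∀ t, IsFirstMax (chainExcess B i) t → ∃ s, IsFirstMax (chainExcess A i) s ∧
      chainExcess A i s = chainExcess B i t ∧
      Relation.EqvGen CoSlide (chainBump A i s) (chainBump B i t) := by
  induction h with
  | rel A B h =>
    refine ⟨fun s hs => ?_, fun t ht => ?_⟩
    · obtain ⟨t, ht, he, h1⟩ := h.bump_up hs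
      exact ⟨t, ht, he.symm, .rel _ _ h1⟩
    · obtain ⟨s, hs, he, h1⟩ := h.bump_down ht
      exact ⟨s, hs, he.symm, .rel _ _ h1⟩
  | refl A => exact ⟨fun s hs => ⟨s, hs, rfl, .refl _⟩, fun s hs => ⟨s, hs, rfl, .refl _⟩⟩
  | symm A B _ ih =>
    refine ⟨fun s hs => ?_, fun t ht => ?_⟩
    · obtain ⟨t, ht, he, h1⟩ := ih.2 s hs
      exact ⟨t, ht, he.symm, .symm _ _ h1⟩
    · obtain ⟨s, hs, he, h1⟩ := ih.1 t ht
      exact ⟨s, hs, he.symm, .symm _ _ h1⟩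
  | trans A B C _ _ ih1 ih2 =>
    refine ⟨fun s hs => ?_, fun t ht => ?_⟩
    · obtain ⟨t, ht, he, h1⟩ := ih1.1 s hs
      obtain ⟨u, hu, he', h2⟩ := ih2.1 t ht
      exact ⟨u, hu, he.trans he', .trans _ _ _ h1 h2⟩
    · obtain ⟨s, hs, he, h1⟩ := ih2.2 t ht
      obtain ⟨u, hu, he', h2⟩ := ih1.2 s hs
      exact ⟨u, hu, he'.trans he, .trans _ _ _ h2 h1⟩

/-- A raising operation, applied to one of the rows of a family, extends to all rows. -/
theorem rowBump_family {g : ℕ → ℕ → ℕ → ℤ} (hg : ∀ p, CoSlide (g (p + 1)) (g p)) {i q s : ℕ}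
    (hs : IsFirstMax (chainExcess (g q) i) s) :
    ∃ σ : ℕ → ℕ, (∀ p, IsFirstMax (chainExcess (g p) i) (σ p) ∧
        chainExcess (g p) i (σ p) = chainExcess (g q) i s) ∧
      ∀ p, CoSlide (chainBump (g (p + 1)) i (σ (p + 1))) (chainBump (g p) i (σ p)) := by
  have hall : ∀ p, ∃ t, IsFirstMax (chainExcess (g p) i) t ∧
      chainExcess (g p) i t = chainExcess (g q) i s := by
    have hup : ∀ k ≤ q, ∃ t, IsFirstMax (chainExcess (g (q - k)) i) t ∧
        chainExcess (g (q - k)) i t = chainExcess (g q) i s := by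
      intro k hk
      induction k with
      | zero => exact ⟨s, hs, rfl⟩
      | succ k ih =>
        obtain ⟨t, ht, he⟩ := ih (by omega)
        have h := hg (q - (k + 1))
        rw [show q - (k + 1) + 1 = q - k by omega] at h
        obtain ⟨u, hu, he', -⟩ := h.bump_up ht
        exact ⟨u, hu, he'.trans he⟩
    intro p
    induction p with
    | zero => simpa using hup q le_rfl
    | succ p ih =>
      obtain ⟨t, ht, he⟩ := ih
      obtain ⟨u, hu, he', -⟩ := (hg p).bump_down ht
      exact ⟨u, hu, he'.symm.trans he⟩
  choose σ hσ hσ' using hall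
  refine ⟨σ, fun p => ⟨hσ p, hσ' p⟩, fun p => ?_⟩
  obtain ⟨t, ht, -, h⟩ := (hg p).bump_up (hσ (p + 1))
  rwa [ht.unique (hσ p)] at h

/-- A symmetric family of partitions, presented by partial sums, all of whose squares satisfy the
octahedron recurrence. -/
structure IsSymmFamily (g : ℕ → ℕ → ℕ → ℤ) : Prop where
  symm : ∀ p q, g p q = g q p
  octa : ∀ p, CoSlide (g (p + 1)) (g p)

/-- A raising operation can be applied to the rows and then to the columns of a symmetric family.
The result is a symmetric family, whose diagonal changes in one place. -/
theorem IsSymmFamily.exists_bump {g : ℕ → ℕ → ℕ → ℤ} (hg : IsSymmFamily g) {i r : ℕ}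
    (hr : IsFirstMax (chainExcess (g (i + 1)) i) r) :
    ∃ (f : ℕ → ℕ → ℕ → ℤ) (s t u v : ℕ), IsSymmFamily f ∧
      (∀ p, p ≠ i + 1 → f p p = g p p) ∧
      IsFirstMax (chainExcess (g i) i) s ∧ f i (i + 1) = bump s (g i (i + 1)) ∧
      IsFirstMax (chainExcess (g (i + 2)) i) t ∧
      f (i + 1) (i + 2) = bump t (g (i + 1) (i + 2)) ∧
      f (i + 1) (i + 1) = bump u (bump r (g (i + 1) (i + 1))) ∧
      IsFirstMax (excess (bump s (g i (i + 1))) (bump r (g (i + 1) (i + 1)))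
        (bump t (g (i + 1) (i + 2)))) u ∧
      excess (bump s (g i (i + 1))) (bump r (g (i + 1) (i + 1))) (bump t (g (i + 1) (i + 2))) u =
        chainExcess (g (i + 1)) i r ∧
      IsFirstMax (chainExcess (g 0) i) v ∧
      chainExcess (g 0) i v = chainExcess (g (i + 1)) i r ∧ f 0 = chainBump (g 0) i v := by
  obtain ⟨σ, hσ, hrow⟩ := rowBump_family hg.octa hr
  set k : ℕ → ℕ → ℕ → ℤ := fun q p => chainBump (g p) i (σ p) q with hk
  have hk1 : ∀ p, k (i + 1) p = bump (σ p) (g p (i + 1)) := fun p => chainBump_self _ _ _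
  have hk2 : ∀ q p, q ≠ i + 1 → k q p = g q p := fun q p h => by
    rw [hg.symm q p]; exact chainBump_ne _ h
  have hkC : ∀ q, CoSlide (k (q + 1)) (k q) := fun q p => (hrow p q).symm
  have hke : ∀ q, q ≠ i + 1 → chainExcess (k q) i = chainExcess (g q) i := fun q h => by
    simp only [chainExcess, hk2 q _ h]
  have hσi : IsFirstMax (chainExcess (k i) i) (σ i) := by rw [hke i (by omega)]; exact (hσ i).1
  obtain ⟨τ, hτ, hcol⟩ := rowBump_family hkC hσi
  have hτσ : ∀ q, q ≠ i + 1 → τ q = σ q := fun q h =>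
    (hτ q).1.unique (by rw [hke q h]; exact (hσ q).1)
  have hr' : σ (i + 1) = r := (hσ (i + 1)).1.unique hr
  set f : ℕ → ℕ → ℕ → ℤ := fun q => chainBump (k q) i (τ q) with hf
  have hf1 : ∀ q, f q (i + 1) = bump (τ q) (k q (i + 1)) := fun q => chainBump_self _ _ _
  have hf2 : ∀ q p, p ≠ i + 1 → f q p = k q p := fun q p h => chainBump_ne _ h
  have hf3 : ∀ q, q ≠ i + 1 → f q (i + 1) = bump (σ q) (g q (i + 1)) := fun q h => by
    rw [hf1, hτσ q h, hk2 q _ h]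
  have hf4 : ∀ p, p ≠ i + 1 → f (i + 1) p = bump (σ p) (g p (i + 1)) := fun p h => by
    rw [hf2 _ p h, hk1]
  have hexc : chainExcess (k (i + 1)) i = excess (bump (σ i) (g i (i + 1)))
      (bump r (g (i + 1) (i + 1))) (bump (σ (i + 2)) (g (i + 1) (i + 2))) := by
    simp only [chainExcess, hk1, hr', hg.symm (i + 2) (i + 1)]
  refine ⟨f, σ i, σ (i + 2), τ (i + 1), σ 0, ⟨fun p q => ?_, hcol⟩, fun p hp => ?_, (hσ i).1,
    hf3 i (by omega), (hσ _).1, ?_, ?_, ?_, ?_, (hσ 0).1, (hσ 0).2, ?_⟩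
  · by_cases hp : p = i + 1 <;> by_cases hq : q = i + 1
    · rw [hp, hq]
    · rw [hp, hf4 q hq, hf3 q hq]
    · rw [hq, hf4 p hp, hf3 p hp]
    · rw [hf2 _ _ hq, hf2 _ _ hp, hk2 _ _ hp, hk2 _ _ hq, hg.symm]
  · rw [hf2 _ _ hp, hk2 _ _ hp]
  · rw [hf4 (i + 2) (by omega), hg.symm (i + 2)]
  · rw [hf1, hk1, hr']
  · rw [← hexc]; exact (hτ _).1
  · rw [← hexc, (hτ _).2, hke i (by omega), (hσ i).2]
  · funext p
    by_cases hp : p = i + 1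
    · rw [hp, hf3 0 (by omega), chainBump_self]
    · rw [hf2 _ _ hp, hk2 _ _ (by omega), chainBump_ne _ hp]

/-- The possible changes of the diagonal of a symmetric family by a raising operation. The functions
`m`, `k` and `l` are the successive diagonal entries, and `r` is the row of the first square that is
added to `k`. -/
theorem IsSymmFamily.exists_bump_cases {g : ℕ → ℕ → ℕ → ℤ} (hg : IsSymmFamily g) {i r : ℕ}
    (hr : IsFirstMax (chainExcess (g (i + 1)) i) r) {m k l : ℕ → ℤ} (hm : g i i = m)
    (hk : g (i + 1) (i + 1) = k) (hl : g (i + 2) (i + 2) = l) :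
    ∃ (f : ℕ → ℕ → ℕ → ℤ) (u v : ℕ), IsSymmFamily f ∧
      (∀ p, p ≠ i + 1 → f p p = g p p) ∧
      f (i + 1) (i + 1) = bump u (bump r (g (i + 1) (i + 1))) ∧
      IsFirstMax (chainExcess (g 0) i) v ∧
      chainExcess (g 0) i v = chainExcess (g (i + 1)) i r ∧ f 0 = chainBump (g 0) i v ∧
      ((u = r ∧ l (r + 2) + k r ≤ l (r + 1) + k (r + 1) ∧
          ∀ q, q + 1 = r → m q + k (q + 2) < m (q + 1) + k (q + 1)) ∨
        (u = r + 1 ∧ l (r + 1) + k (r + 1) < l (r + 2) + k r ∧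
          ∀ q, q + 1 = r → m q + k (q + 2) < m (q + 1) + k (q + 1)) ∨
        (u = r ∧ l (r + 1) + k (r + 1) < l (r + 2) + k r ∧
          ∃ q, q + 1 = r ∧ m (q + 1) + k (q + 1) ≤ m q + k (q + 2))) := by
  obtain ⟨f, s, t, u, v, hf, hd, hs, hfs, ht, hft, hfu, hu, huM, hv, hvM, hf0⟩ := hg.exists_bump hr
  refine ⟨f, u, v, hf, hd, hfu, hv, hvM, hf0, ?_⟩
  obtain ⟨s', hs', -, -, -, h1⟩ := (hg.octa i i).bump_up (hg.octa i (i + 1)) hr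
  obtain rfl := hs'.unique hs
  obtain ⟨r', hr', -, -, -, h2⟩ := (hg.octa (i + 1) i).bump_up (hg.octa (i + 1) (i + 1)) ht
  obtain rfl : r = r' := hr.unique hr'
  have hsq : Octa (f i i) (f i (i + 1)) (f i (i + 1)) (f (i + 1) (i + 1)) := by
    have := hf.octa i i; rwa [hf.symm (i + 1) i] at this
  have hsq0 : Octa (g i i) (g i (i + 1)) (g i (i + 1)) (g (i + 1) (i + 1)) := by
    have := hg.octa i i; rwa [hg.symm (i + 1) i] at this
  rw [hd i (by omega), hfs, hfu] at hsq
  rw [hm, hk] at h1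
  rw [show i + 1 + 1 = i + 2 from rfl, hl, hk] at h2
  rw [hm, hk] at hsq hsq0
  rw [hk] at hu huM
  set α := g i (i + 1)
  set β := g (i + 1) (i + 2)
  have hE : ∀ q, chainExcess (g (i + 1)) i q = excess α k β q := fun q => by
    simp only [chainExcess, hg.symm (i + 1) i, hk]; rfl
  have hEr := hr.1
  have hEr2 := hr.2
  simp only [hE] at hEr hEr2 huM
  have hu1 := hu.1
  have hu2 := hu.2
  have hEu : ∀ q, excess (bump s' α) (bump r k) (bump t β) q = excess α k β q +
      (if t < q + 1 then 1 else 0) - (if r < q + 1 then 1 else 0) - (if r < q then 1 else 0) +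
      (if s' < q then 1 else 0) := fun q => by simp only [excess, bump]; ring
  simp only [hEu] at hu1 hu2 huM
  have hEu' := hEr u
  have hur : r ≤ u := by
    by_contra h
    have := hEr2 u (by omega)
    rcases h1 with ⟨rfl, h1, -⟩ | ⟨h0, h1, -⟩ <;> rcases h2 with ⟨rfl, -, h2⟩ | ⟨rfl, -, h2⟩ <;>
      split_ifs at huM <;> omega
  rcases h1 with ⟨rfl, h1, -⟩ | ⟨h0, h1, -⟩ <;> rcases h2 with ⟨rfl, -, h2⟩ | ⟨rfl, -, h2⟩
  · refine Or.inl ⟨?_, h2, h1⟩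
    by_contra h
    have := hu2 s' (by omega)
    simp only [lt_irrefl, if_false, Nat.lt_succ_self, if_true] at this
    split_ifs at huM <;> omega
  · refine Or.inr (Or.inl ⟨?_, h2, h1⟩)
    have hne : u ≠ s' := by
      rintro rfl
      simp at huM
    have p1 := hsq.2 s'
    have p2 := hsq0.2 s'
    simp only [bump] at p1
    by_contra h
    rw [if_pos (by omega), if_neg (by omega), if_pos (by omega), if_neg (by omega)] at p1
    omega
  · exfalso
    have := hu1 r
    simp only [lt_irrefl, if_false, Nat.lt_succ_self, if_true] at this
    rw [if_pos (by omega)] at this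
    split_ifs at huM <;> omega
  · refine Or.inr (Or.inr ⟨?_, h2, s', h0.symm, h1⟩)
    by_contra h
    have := hu2 r (by omega)
    simp only [lt_irrefl, if_false, Nat.lt_succ_self, if_true] at this
    rw [if_pos (by omega)] at this
    split_ifs at huM <;> omega

/-! ### Raising places and suffix sums of words -/

section Reading

variable {α : Type*} {S : Finset α} {before : α → α → Prop} {e : α → ℕ}

/-- The places of the finite set `S` are totally ordered by `before`. -/
structure IsReadingOrder (S : Finset α) (before : α → α → Prop) : Prop where
  irrefl : ∀ x ∈ S, ¬ before x x
  trans : ∀ x ∈ S, ∀ y ∈ S, ∀ z ∈ S, before x y → before y z → before x z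
  total : ∀ x ∈ S, ∀ y ∈ S, x = y ∨ before x y ∨ before y x

open scoped Classical in
/-- The number of places to the left of `x`. -/
noncomputable def placeRank (S : Finset α) (before : α → α → Prop) (x : α) : ℕ :=
  (S.filter fun y => before y x).card

theorem IsReadingOrder.placeRank_lt (h : IsReadingOrder S before) {x y : α} (hx : x ∈ S)
    (hy : y ∈ S) (hxy : before x y) : placeRank S before x < placeRank S before y := by
  classical
  apply Finset.card_lt_card
  rw [Finset.ssubset_iff_of_subset]
  · exact ⟨x, by simp [hx, hxy], by simp [h.irrefl x hx]⟩
  · intro z hz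
    simp only [Finset.mem_filter] at hz ⊢
    exact ⟨hz.1, h.trans z hz.1 x hx y hy hz.2 hxy⟩

theorem IsReadingOrder.before_iff (h : IsReadingOrder S before) {x y : α} (hx : x ∈ S)
    (hy : y ∈ S) : before x y ↔ placeRank S before x < placeRank S before y := by
  refine ⟨h.placeRank_lt hx hy, fun hlt => ?_⟩
  rcases h.total x hx y hy with rfl | h1 | h1
  · omega
  · exact h1
  · have := h.placeRank_lt hy hx h1; omega

theorem IsReadingOrder.eq_or_before_iff (h : IsReadingOrder S before) {x y : α} (hx : x ∈ S)
    (hy : y ∈ S) : (y = x ∨ before x y) ↔ placeRank S before x ≤ placeRank S before y := by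
  constructor
  · rintro (rfl | h1)
    · exact le_rfl
    · exact (h.placeRank_lt hx hy h1).le
  · intro hle
    rcases h.total x hx y hy with rfl | h1 | h1
    · exact Or.inl rfl
    · exact Or.inr h1
    · have := h.placeRank_lt hy hx h1; omega

/-- The excess of letters `i + 1` over letters `i` in the right factor that starts at `x`. -/
noncomputable def suffixExcess (S : Finset α) (before : α → α → Prop) (e : α → ℕ) (i : ℕ)
    (x : α) : ℤ :=
  (countFrom S before e x (i + 1) : ℤ) - countFrom S before e x i

theorem IsReadingOrder.countFrom_le_countFrom (h : IsReadingOrder S before) {x y : α} (hx : x ∈ S)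
    (hy : y ∈ S) (hxy : y = x ∨ before x y) (k : ℕ) :
    countFrom S before e y k ≤ countFrom S before e x k := by
  classical
  apply Finset.card_le_card
  intro z hz
  simp only [Finset.mem_filter] at hz ⊢
  refine ⟨hz.1, ?_, hz.2.2⟩
  have h1 := hz.2.1
  rw [h.eq_or_before_iff hy hz.1] at h1
  rw [h.eq_or_before_iff hx hy] at hxy
  rw [h.eq_or_before_iff hx hz.1]
  omega

/-- A right factor with positive excess can be shortened, without decreasing the excess, so that it
starts with a letter `i + 1`. -/
theorem IsReadingOrder.exists_letter (h : IsReadingOrder S before) {i : ℕ} {x : α} (hx : x ∈ S)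
    (hpos : 0 < suffixExcess S before e i x) :
    ∃ y ∈ S, e y = i + 1 ∧ (y = x ∨ before x y) ∧
      suffixExcess S before e i x ≤ suffixExcess S before e i y := by
  classical
  have hne : (S.filter fun y => (y = x ∨ before x y) ∧ e y = i + 1).Nonempty := by
    rw [← Finset.card_pos]
    have : (0 : ℤ) < countFrom S before e x (i + 1) := by unfold suffixExcess at hpos; omega
    exact_mod_cast this
  obtain ⟨y, hy, hmin⟩ := Finset.exists_min_image _ (placeRank S before) hne
  simp only [Finset.mem_filter] at hy hmin
  refine ⟨y, hy.1, hy.2.2, hy.2.1, ?_⟩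
  have h1 := h.countFrom_le_countFrom (e := e) hx hy.1 hy.2.1 i
  have h2 : countFrom S before e x (i + 1) ≤ countFrom S before e y (i + 1) := by
    apply Finset.card_le_card
    intro z hz
    simp only [Finset.mem_filter] at hz ⊢
    exact ⟨hz.1, (h.eq_or_before_iff hy.1 hz.1).2 (hmin z hz), hz.2.2⟩
  unfold suffixExcess
  omega

theorem IsReadingOrder.isYamanouchiWord_iff (h : IsReadingOrder S before) :
    IsYamanouchiWord S before e ↔
      ∀ i, ∀ x ∈ S, e x = i + 1 → suffixExcess S before e i x ≤ 0 := by
  constructor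
  · intro hY i x hx _
    have := hY x hx i
    unfold suffixExcess; omega
  · intro hall x hx i
    by_contra hlt
    obtain ⟨y, hy, hey, -, hle⟩ := h.exists_letter (e := e) (i := i) hx
      (by unfold suffixExcess; omega)
    have := hall i y hy hey
    unfold suffixExcess at *; omega

theorem IsReadingOrder.countBetween_add (h : IsReadingOrder S before) {x y z : α} (hx : x ∈ S)
    (hy : y ∈ S) (hxy : before x y)
    (hzy : ∀ w ∈ S, (w = z ∨ before w z) ↔ before w y) (k : ℕ) :
    countBetween S before e x z k + countFrom S before e y k = countFrom S before e x k := by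
  classical
  unfold countBetween countFrom
  rw [← Finset.card_union_of_disjoint]
  · congr 1
    ext w
    simp only [Finset.mem_union, Finset.mem_filter]
    by_cases hw : w ∈ S
    · rw [hzy w hw, h.eq_or_before_iff hx hw, h.eq_or_before_iff hy hw, h.before_iff hw hy]
      rw [h.before_iff hx hy] at hxy
      constructor
      · rintro (h1 | h1)
        · exact ⟨h1.1, h1.2.1, h1.2.2.2⟩
        · exact ⟨h1.1, by omega, h1.2.2⟩
      · rintro ⟨h1, h2, h3⟩
        by_cases h4 : placeRank S before w < placeRank S before y
        · exact Or.inl ⟨h1, h2, h4, h3⟩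
        · exact Or.inr ⟨h1, by omega, h3⟩
    · simp [hw]
  · rw [Finset.disjoint_filter]
    rintro w hw ⟨-, h1, -⟩ ⟨h2, -⟩
    rw [hzy w hw, h.before_iff hw hy] at h1
    rw [h.eq_or_before_iff hy hw] at h2
    omega

/-- The leftmost unmatched letter `i + 1` is the start of the shortest right factor whose excess is
maximal. -/
theorem IsReadingOrder.isRaisingPlace_of (h : IsReadingOrder S before) {i : ℕ} {x : α} (hx : x ∈ S)
    (hpos : 0 < suffixExcess S before e i x)
    (hmax : ∀ y ∈ S, e y = i + 1 → suffixExcess S before e i y ≤ suffixExcess S before e i x)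
    (hlast : ∀ y ∈ S, e y = i + 1 → before x y →
      suffixExcess S before e i y < suffixExcess S before e i x) :
    IsRaisingPlace S before e i x := by
  classical
  refine ⟨⟨hx, fun z hz hxz => ?_⟩, fun y hy hyx hun => ?_⟩
  · by_cases hex : (S.filter fun w => before z w).Nonempty
    · obtain ⟨y, hy, hmin⟩ := Finset.exists_min_image _ (placeRank S before) hex
      simp only [Finset.mem_filter] at hy hmin
      have hxy : before x y := by
        rw [h.eq_or_before_iff hx hz] at hxz
        have := hy.2
        rw [h.before_iff hz hy.1] at this
        rw [h.before_iff hx hy.1]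
        omega
      have hzy : ∀ w ∈ S, (w = z ∨ before w z) ↔ before w y := by
        intro w hw
        rw [eq_comm, h.eq_or_before_iff hw hz, h.before_iff hw hy.1]
        have h1 := hy.2
        rw [h.before_iff hz hy.1] at h1
        refine ⟨fun h2 => by omega, fun h2 => ?_⟩
        by_contra h3
        have := hmin w ⟨hw, (h.before_iff hz hw).2 (by omega)⟩
        omega
      have h1 := h.countBetween_add (e := e) hx hy.1 hxy hzy i
      have h2 := h.countBetween_add (e := e) hx hy.1 hxy hzy (i + 1)
      have h3 : suffixExcess S before e i y < suffixExcess S before e i x := by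
        by_cases hp : 0 < suffixExcess S before e i y
        · obtain ⟨y', hy', he', hyy', hle⟩ := h.exists_letter hy.1 hp
          refine hle.trans_lt (hlast y' hy' he' ?_)
          rw [h.eq_or_before_iff hy.1 hy'] at hyy'
          rw [h.before_iff hx hy.1] at hxy
          rw [h.before_iff hx hy']
          omega
        · omega
      unfold suffixExcess at h3
      omega
    · have hb : ∀ k, countBetween S before e x z k = countFrom S before e x k := by
        intro k
        unfold countBetween countFrom
        congr 1
        apply Finset.filter_congr
        intro w hw
        have : w = z ∨ before w z := by
          rcases h.total w hw z hz with h1 | h1 | h1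
          · exact Or.inl h1
          · exact Or.inr h1
          · exact absurd ⟨w, by simp [hw, h1]⟩ hex
        simp [this]
      rw [hb, hb]
      unfold suffixExcess at hpos
      omega
  · -- the letters from `y` up to the predecessor of `x` have no positive excess
    have hne : (S.filter fun w => before w x).Nonempty := ⟨y, by simp [hy, hyx]⟩
    obtain ⟨z, hz, hmaxz⟩ := Finset.exists_max_image _ (placeRank S before) hne
    simp only [Finset.mem_filter] at hz hmaxz
    have hzx : ∀ w ∈ S, (w = z ∨ before w z) ↔ before w x := by
      intro w hw
      rw [eq_comm, h.eq_or_before_iff hw hz.1, h.before_iff hw hx]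
      have h1 := hz.2
      rw [h.before_iff hz.1 hx] at h1
      refine ⟨fun h2 => by omega, fun h2 => hmaxz w ⟨hw, (h.before_iff hw hx).2 h2⟩⟩
    have h1 := h.countBetween_add (e := e) hy hx hyx hzx i
    have h2 := h.countBetween_add (e := e) hy hx hyx hzx (i + 1)
    have hyz : z = y ∨ before y z := by
      rw [h.eq_or_before_iff hy hz.1]
      exact hmaxz y ⟨hy, hyx⟩
    have h3 := hun.2 z hz.1 hyz
    have hxp := hpos
    unfold suffixExcess at hxp
    obtain ⟨y', hy', he', -, hle⟩ := h.exists_letter (e := e) (i := i) hy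
      (by unfold suffixExcess; omega)
    have := hle.trans (hmax y' hy' he')
    unfold suffixExcess at this
    omega

theorem IsReadingOrder.isRaisingPlace_unique (h : IsReadingOrder S before) {i : ℕ} {x y : α}
    (hx : IsRaisingPlace S before e i x) (hy : IsRaisingPlace S before e i y) : x = y := by
  rcases h.total x hx.1.1 y hy.1.1 with h1 | h1 | h1
  · exact h1
  · exact absurd hx.1 (hy.2 x hx.1.1 h1)
  · exact absurd hy.1 (hx.2 y hy.1.1 h1)

theorem IsReadingOrder.suffixExcess_pos_of_isUnmatched (h : IsReadingOrder S before) {i : ℕ} {x : α}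
    (hx : IsUnmatched S before e i x) : e x = i + 1 ∧ 0 < suffixExcess S before e i x := by
  classical
  constructor
  · by_contra hne
    have h1 := hx.2 x hx.1 (Or.inl rfl)
    have h2 : countBetween S before e x x (i + 1) = 0 := by
      unfold countBetween
      rw [Finset.card_eq_zero, Finset.filter_eq_empty_iff]
      rintro w hw ⟨h3, h4, h5⟩
      rcases h3 with rfl | h3
      · exact hne h5
      · rcases h4 with rfl | h4
        · exact hne h5
        · exact h.irrefl x hx.1 (h.trans _ hx.1 _ hw _ hx.1 h3 h4)
    omega
  · obtain ⟨z, hz, hmax⟩ := Finset.exists_max_image S (placeRank S before) ⟨x, hx.1⟩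
    have h1 := hx.2 z hz ((h.eq_or_before_iff hx.1 hz).2 (hmax x hx.1))
    have hb : ∀ k, countBetween S before e x z k = countFrom S before e x k := by
      intro k
      unfold countBetween countFrom
      congr 1
      apply Finset.filter_congr
      intro w hw
      have : w = z ∨ before w z := by
        rw [eq_comm, h.eq_or_before_iff hw hz]; exact hmax w hw
      simp [this]
    rw [hb, hb] at h1
    unfold suffixExcess
    omega

/-! ### Words read off from tableaux -/

open scoped Classical in
/-- The excess of letters `i + 1` whose top row is at most `r` over letters `i` whose bottom row is
less than `r`. -/
noncomputable def rowExcess (S : Finset α) (e : α → ℕ) (i : ℕ) (top bot : α → ℕ) (r : ℕ) : ℤ :=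
  ((S.filter fun y => e y = i + 1 ∧ top y ≤ r).card : ℤ) -
    (S.filter fun y => e y = i ∧ bot y < r).card

open scoped Classical in
/-- A relation between the column reading of the letters `i`, `i + 1` of a tableau and their reading
by rows, with letters `i + 1` placed by their top rows and letters `i` by their bottom rows. Let `a`
be the number of letters `i` in the row above that of a letter `x`, let `b` be the number of letters
`i + 1` in the row of `x`, and let `z` and `j` be the numbers of those that are read before `x`. The
condition `bound` says that `z ≤ j` or `b - j ≤ a - z`, so that the right factor that starts at `x`
has at most the excess of one of the two rows; by `strict`, only the leftmost letter of the row can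
attain the excess of its row if this exceeds the excess of the row above. -/
structure IsRowCompatible (S : Finset α) (before : α → α → Prop) (e : α → ℕ) (i : ℕ)
    (top bot : α → ℕ) : Prop extends IsReadingOrder S before where
  top_anti : ∀ x ∈ S, ∀ y ∈ S, e x = i + 1 → e y = i + 1 → before x y → top y ≤ top x
  before_of_le : ∀ x ∈ S, ∀ y ∈ S, e x = i + 1 → e y = i → top x ≤ bot y → before y x
  before_of_lt : ∀ x ∈ S, ∀ y ∈ S, e x = i + 1 → e y = i → bot y + 1 < top x → before x y
  bound : ∀ x ∈ S, e x = i + 1 →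
    (S.filter fun y => e y = i ∧ bot y + 1 = top x ∧ before y x).card ≤
      (S.filter fun y => e y = i + 1 ∧ top y = top x ∧ before y x).card ∨
    (S.filter fun y => e y = i + 1 ∧ top y = top x).card +
        (S.filter fun y => e y = i ∧ bot y + 1 = top x ∧ before y x).card ≤
      (S.filter fun y => e y = i ∧ bot y + 1 = top x).card +
        (S.filter fun y => e y = i + 1 ∧ top y = top x ∧ before y x).card
  strict : ∀ x ∈ S, e x = i + 1 →
    (S.filter fun y => e y = i ∧ bot y + 1 = top x).card <
      (S.filter fun y => e y = i + 1 ∧ top y = top x).card →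
    0 < (S.filter fun y => e y = i + 1 ∧ top y = top x ∧ before y x).card →
    (S.filter fun y => e y = i ∧ bot y + 1 = top x ∧ before y x).card ≠
      (S.filter fun y => e y = i + 1 ∧ top y = top x ∧ before y x).card

variable {i : ℕ} {top bot : α → ℕ}

open scoped Classical in
theorem IsRowCompatible.suffixExcess_eq (h : IsRowCompatible S before e i top bot) {x : α}
    (hx : x ∈ S) (hex : e x = i + 1) :
    suffixExcess S before e i x = rowExcess S e i top bot (top x) -
      (S.filter fun y => e y = i + 1 ∧ top y = top x ∧ before y x).card +
      (S.filter fun y => e y = i ∧ bot y + 1 = top x ∧ before y x).card := by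
  have h1 : (S.filter fun y => e y = i + 1 ∧ top y ≤ top x).card =
      countFrom S before e x (i + 1) +
        (S.filter fun y => e y = i + 1 ∧ top y = top x ∧ before y x).card := by
    unfold countFrom
    rw [← Finset.card_union_of_disjoint]
    · congr 1
      ext w
      simp only [Finset.mem_union, Finset.mem_filter]
      constructor
      · rintro ⟨hw, h1, h2⟩
        rcases h.total x hx w hw with h3 | h3 | h3
        · exact Or.inl ⟨hw, Or.inl h3.symm, h1⟩
        · exact Or.inl ⟨hw, Or.inr h3, h1⟩
        · have := h.top_anti w hw x hx h1 hex h3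
          exact Or.inr ⟨hw, h1, by omega, h3⟩
      · rintro (⟨hw, h1 | h1, h2⟩ | ⟨hw, h1, h2, h3⟩)
        · exact ⟨hw, h2, by rw [h1]⟩
        · exact ⟨hw, h2, h.top_anti x hx w hw hex h2 h1⟩
        · exact ⟨hw, h1, h2.le⟩
    · rw [Finset.disjoint_filter]
      rintro w hw ⟨h1, -⟩ ⟨-, -, h2⟩
      rw [h.eq_or_before_iff hx hw] at h1
      rw [h.before_iff hw hx] at h2
      omega
  have h2 : (S.filter fun y => e y = i ∧ bot y < top x).card =
      countFrom S before e x i +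
        (S.filter fun y => e y = i ∧ bot y + 1 = top x ∧ before y x).card := by
    unfold countFrom
    rw [← Finset.card_union_of_disjoint]
    · congr 1
      ext w
      simp only [Finset.mem_union, Finset.mem_filter]
      constructor
      · rintro ⟨hw, h1, h2⟩
        rcases h.total x hx w hw with h3 | h3 | h3
        · exact Or.inl ⟨hw, Or.inl h3.symm, h1⟩
        · exact Or.inl ⟨hw, Or.inr h3, h1⟩
        · refine Or.inr ⟨hw, h1, ?_, h3⟩
          by_contra h4
          have h5 := h.before_of_lt x hx w hw hex h1 (by omega)
          exact h.irrefl x hx (h.trans x hx w hw x hx h5 h3)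
      · rintro (⟨hw, h1, h2⟩ | ⟨hw, h1, h2, h3⟩)
        · refine ⟨hw, h2, ?_⟩
          by_contra h4
          have h5 := h.before_of_le x hx w hw hex h2 (by omega)
          rw [h.eq_or_before_iff hx hw] at h1
          rw [h.before_iff hw hx] at h5
          omega
        · exact ⟨hw, h1, by omega⟩
    · rw [Finset.disjoint_filter]
      rintro w hw ⟨h1, -⟩ ⟨-, -, h2⟩
      rw [h.eq_or_before_iff hx hw] at h1
      rw [h.before_iff hw hx] at h2
      omega
  unfold suffixExcess rowExcess
  omega

open scoped Classical in
theorem rowExcess_succ (S : Finset α) (e : α → ℕ) (i : ℕ) (top bot : α → ℕ) (r : ℕ) :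
    rowExcess S e i top bot (r + 1) = rowExcess S e i top bot r +
      (S.filter fun y => e y = i + 1 ∧ top y = r + 1).card -
      (S.filter fun y => e y = i ∧ bot y + 1 = r + 1).card := by
  have h1 : (S.filter fun y => e y = i + 1 ∧ top y ≤ r + 1).card =
      (S.filter fun y => e y = i + 1 ∧ top y ≤ r).card +
      (S.filter fun y => e y = i + 1 ∧ top y = r + 1).card := by
    rw [← Finset.card_union_of_disjoint (by
      rw [Finset.disjoint_filter]; rintro w _ ⟨-, h1⟩ ⟨-, h2⟩; omega), ← Finset.filter_or]
    congr 1; apply Finset.filter_congr; intro w _; omega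
  have h2 : (S.filter fun y => e y = i ∧ bot y < r + 1).card =
      (S.filter fun y => e y = i ∧ bot y < r).card +
      (S.filter fun y => e y = i ∧ bot y + 1 = r + 1).card := by
    rw [← Finset.card_union_of_disjoint (by
      rw [Finset.disjoint_filter]; rintro w _ ⟨-, h1⟩ ⟨-, h2⟩; omega), ← Finset.filter_or]
    congr 1; apply Finset.filter_congr; intro w _; omega
  unfold rowExcess
  omega

open scoped Classical in
theorem rowExcess_zero (S : Finset α) (e : α → ℕ) (i : ℕ) (top bot : α → ℕ) :
    rowExcess S e i top bot 0 = (S.filter fun y => e y = i + 1 ∧ top y = 0).card ∧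
      (S.filter fun y => e y = i ∧ bot y + 1 = 0).card = 0 := by
  unfold rowExcess
  simp

open scoped Classical in
theorem rowExcess_le_card (S : Finset α) (e : α → ℕ) (i : ℕ) (top bot : α → ℕ) (r : ℕ) :
    rowExcess S e i top bot r ≤ S.card := by
  unfold rowExcess
  have := Finset.card_filter_le S fun y => e y = i + 1 ∧ top y ≤ r
  omega

open scoped Classical in
/-- Every right factor that starts with a letter `i + 1` has at most the excess of some row. -/
theorem IsRowCompatible.suffixExcess_le (h : IsRowCompatible S before e i top bot) {x : α}
    (hx : x ∈ S) (hex : e x = i + 1) :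
    suffixExcess S before e i x ≤ rowExcess S e i top bot (top x) ∨
      ∃ r, r + 1 = top x ∧ suffixExcess S before e i x ≤ rowExcess S e i top bot r := by
  have h1 := h.suffixExcess_eq hx hex
  rcases h.bound x hx hex with h2 | h2
  · left; omega
  · cases hr : top x with
    | zero =>
      left
      rw [hr] at h1 h2
      have h3 := rowExcess_zero S e i top bot
      have h4 : (S.filter fun y => e y = i ∧ bot y + 1 = 0 ∧ before y x).card = 0 := by simp
      omega
    | succ r =>
      right
      refine ⟨r, rfl, ?_⟩
      rw [hr] at h1 h2
      have := rowExcess_succ S e i top bot r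
      omega

open scoped Classical in
/-- If a row has more letters `i + 1` than the previous row has letters `i`, then the leftmost of
those letters `i + 1` starts a right factor with at least the excess of the row. -/
theorem IsRowCompatible.exists_leftmost (h : IsRowCompatible S before e i top bot) {r : ℕ}
    (hr : (S.filter fun y => e y = i ∧ bot y + 1 = r).card <
      (S.filter fun y => e y = i + 1 ∧ top y = r).card) :
    ∃ x ∈ S, e x = i + 1 ∧ top x = r ∧ (∀ y ∈ S, e y = i + 1 → top y = r → ¬ before y x) ∧
      rowExcess S e i top bot r ≤ suffixExcess S before e i x := by
  have hne : (S.filter fun y => e y = i + 1 ∧ top y = r).Nonempty := by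
    rw [← Finset.card_pos]; omega
  obtain ⟨x, hx, hmin⟩ := Finset.exists_min_image _ (placeRank S before) hne
  simp only [Finset.mem_filter] at hx hmin
  obtain ⟨hx, hex, rfl⟩ := hx
  have hno : ∀ y ∈ S, e y = i + 1 → top y = top x → ¬ before y x := by
    intro y hy h1 h2 h3
    rw [h.before_iff hy hx] at h3
    have := hmin y ⟨hy, h1, h2⟩
    omega
  refine ⟨x, hx, hex, rfl, hno, ?_⟩
  have h1 := h.suffixExcess_eq hx hex
  have h2 : (S.filter fun y => e y = i + 1 ∧ top y = top x ∧ before y x).card = 0 := by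
    rw [Finset.card_eq_zero, Finset.filter_eq_empty_iff]
    rintro y hy ⟨h3, h4, h5⟩
    exact hno y hy h3 h4 h5
  omega

open scoped Classical in
theorem card_lt_of_isFirstMax_rowExcess {s : ℕ}
    (hs : IsFirstMax (rowExcess S e i top bot) s) (hpos : 0 < rowExcess S e i top bot s) :
    (S.filter fun y => e y = i ∧ bot y + 1 = s).card <
      (S.filter fun y => e y = i + 1 ∧ top y = s).card := by
  cases s with
  | zero => have := rowExcess_zero S e i top bot; omega
  | succ s =>
    have h1 := rowExcess_succ S e i top bot s
    have h2 := hs.2 s (by omega)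
    omega

open scoped Classical in
/-- The raising place of the reading, in terms of the rows. -/
theorem IsRowCompatible.exists_isRaisingPlace (h : IsRowCompatible S before e i top bot) {s : ℕ}
    (hs : IsFirstMax (rowExcess S e i top bot) s) (hpos : 0 < rowExcess S e i top bot s) :
    ∃ x, IsRaisingPlace S before e i x ∧ e x = i + 1 ∧ top x = s ∧
      ∀ y ∈ S, e y = i + 1 → top y = s → ¬ before y x := by
  have hlt := card_lt_of_isFirstMax_rowExcess hs hpos
  obtain ⟨x, hx, hex, hxs, hno, hle⟩ := h.exists_leftmost hlt
  have hmax : ∀ y ∈ S, e y = i + 1 → suffixExcess S before e i y ≤ suffixExcess S before e i x := by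
    intro y hy hey
    rcases h.suffixExcess_le hy hey with h1 | ⟨r, -, h1⟩
    · have := hs.1 (top y); omega
    · have := hs.1 r; omega
  refine ⟨x, h.isRaisingPlace_of hx (by omega) hmax fun y hy hey hxy => ?_, hex, hxs, hno⟩
  have h1 := h.suffixExcess_eq hy hey
  have h2 := h.top_anti x hx y hy hex hey hxy
  rcases Nat.lt_or_ge (top y) s with h3 | h3
  · rcases h.suffixExcess_le hy hey with h4 | ⟨r, hr, h4⟩
    · have := hs.2 (top y) h3; omega
    · have := hs.2 r (by omega); omega
  · have hys : top y = s := by omega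
    rcases h.bound y hy hey with h4 | h4
    · have h5 := h.strict y hy hey (by rwa [hys]) (by
        rw [Finset.card_pos]
        exact ⟨x, by simp [hx, hex, hxs, hys, hxy]⟩)
      rw [hys] at h1 h4 h5
      omega
    · cases s with
      | zero =>
        have h5 := rowExcess_zero S e i top bot
        rw [hys] at h4
        have h6 : (S.filter fun w => e w = i ∧ bot w + 1 = 0 ∧ before w y).card = 0 := by simp
        have h7 : 0 < (S.filter fun w => e w = i + 1 ∧ top w = 0 ∧ before w y).card := by
          rw [Finset.card_pos]
          exact ⟨x, by simp [hx, hex, hxs, hxy]⟩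
        rw [hys] at h1
        omega
      | succ s =>
        have h5 := rowExcess_succ S e i top bot s
        have h6 := hs.2 s (by omega)
        rw [hys] at h1 h4
        omega

theorem IsRowCompatible.isFirstMax_of_isRaisingPlace (h : IsRowCompatible S before e i top bot)
    {x : α} (hx : IsRaisingPlace S before e i x) :
    e x = i + 1 ∧ IsFirstMax (rowExcess S e i top bot) (top x) ∧
      0 < rowExcess S e i top bot (top x) ∧
      ∀ y ∈ S, e y = i + 1 → top y = top x → ¬ before y x := by
  obtain ⟨s, hs⟩ := exists_isFirstMax (rowExcess_le_card S e i top bot)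
  have hpos : 0 < rowExcess S e i top bot s := by
    obtain ⟨h1, h2⟩ := h.suffixExcess_pos_of_isUnmatched hx.1
    rcases h.suffixExcess_le hx.1.1 h1 with h3 | ⟨r, -, h3⟩
    · have := hs.1 (top x); omega
    · have := hs.1 r; omega
  obtain ⟨y, hy, hey, hys, hno⟩ := h.exists_isRaisingPlace hs hpos
  obtain rfl := h.isRaisingPlace_unique hy hx
  exact ⟨hey, hys ▸ hs, hys ▸ hpos, hys ▸ hno⟩

theorem IsRowCompatible.rowExcess_nonpos (h : IsRowCompatible S before e i top bot)
    (hY : IsYamanouchiWord S before e) (r : ℕ) : rowExcess S e i top bot r ≤ 0 := by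
  obtain ⟨s, hs⟩ := exists_isFirstMax (rowExcess_le_card S e i top bot)
  refine (hs.1 r).trans ?_
  by_contra hpos
  obtain ⟨x, hx, hex, -⟩ := h.exists_isRaisingPlace hs (by omega)
  have h1 := (h.suffixExcess_pos_of_isUnmatched hx.1).2
  have h2 := (h.isYamanouchiWord_iff (e := e)).1 hY i x hx.1.1 hex
  omega

/-- A word that is not Yamanouchi has a raising place. -/
theorem exists_isRaisingPlace_of_not_isYamanouchiWord
    (h : ∀ i, IsRowCompatible S before e i top bot) (hY : ¬ IsYamanouchiWord S before e) :
    ∃ i x, IsRaisingPlace S before e i x := by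
  rw [((h 0).toIsReadingOrder).isYamanouchiWord_iff] at hY
  push Not at hY
  obtain ⟨i, x, hx, hex, hpos⟩ := hY
  obtain ⟨s, hs⟩ := exists_isFirstMax (rowExcess_le_card S e i top bot)
  have hpos : 0 < rowExcess S e i top bot s := by
    rcases (h i).suffixExcess_le hx hex with h3 | ⟨r, -, h3⟩
    · have := hs.1 (top x); omega
    · have := hs.1 r; omega
  obtain ⟨y, hy, -⟩ := (h i).exists_isRaisingPlace hs hpos
  exact ⟨i, y, hy⟩

end Reading

/-! ### Chains of Young diagrams -/

/-- The number of squares in the rows above row `r`. -/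
def psum (Y : YoungDiagram) (r : ℕ) : ℤ := ∑ j ∈ Finset.range r, (Y.rowLen j : ℤ)

theorem psum_zero (Y : YoungDiagram) : psum Y 0 = 0 := by simp [psum]

theorem psum_succ (Y : YoungDiagram) (r : ℕ) : psum Y (r + 1) = psum Y r + Y.rowLen r := by
  simp [psum, Finset.sum_range_succ]

theorem YoungDiagram.ext_rowLen {a b : YoungDiagram} (h : ∀ r, a.rowLen r = b.rowLen r) :
    a = b := by
  ext ⟨r, c⟩
  simp [YoungDiagram.mem_iff_lt_rowLen, h]

theorem YoungDiagram.le_iff_rowLen {a b : YoungDiagram} :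
    a ≤ b ↔ ∀ r, a.rowLen r ≤ b.rowLen r := by
  constructor
  · intro h r
    by_contra hlt
    have h1 : (r, b.rowLen r) ∈ a := by rw [YoungDiagram.mem_iff_lt_rowLen]; omega
    have h2 : (r, b.rowLen r) ∈ b := h h1
    rw [YoungDiagram.mem_iff_lt_rowLen] at h2
    omega
  · rintro h ⟨r, c⟩ hc
    have h1 : (r, c) ∈ a := hc
    show (r, c) ∈ b
    rw [YoungDiagram.mem_iff_lt_rowLen] at *
    exact h1.trans_le (h r)

/-- The partition `b` is obtained from `a` by adding a square in row `ρ`. -/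
def AddsRow (ρ : ℕ) (a b : YoungDiagram) : Prop :=
  ∀ j, b.rowLen j = a.rowLen j + if j = ρ then 1 else 0

theorem AddsRow.eq_of {ρ ρ' : ℕ} {a b : YoungDiagram} (h : AddsRow ρ a b) (h' : AddsRow ρ' a b) :
    ρ = ρ' := by
  have h1 := h ρ
  have h2 := h' ρ
  rw [if_pos rfl] at h1
  by_contra hne
  rw [if_neg hne] at h2
  omega

theorem AddsRow.psum_eq {ρ : ℕ} {a b : YoungDiagram} (h : AddsRow ρ a b) :
    psum b = bump ρ (psum a) := by
  funext r
  induction r with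
  | zero => simp [bump, psum_zero]
  | succ r ih =>
    rw [psum_succ, ih, h r]
    simp only [bump, psum_succ]
    push_cast
    split_ifs <;> omega

theorem addsRow_iff_cells {ρ : ℕ} {a b : YoungDiagram} :
    AddsRow ρ a b ↔ b.cells = insert (ρ, a.rowLen ρ) a.cells := by
  constructor
  · intro h
    ext ⟨r, c⟩
    simp only [Finset.mem_insert, YoungDiagram.mem_cells, YoungDiagram.mem_iff_lt_rowLen, h r,
      Prod.mk.injEq]
    by_cases hr : r = ρ
    · subst hr; simp; omega
    · simp [hr]
  · intro h j
    have hmem : ∀ c, c < b.rowLen j ↔ (j = ρ ∧ c = a.rowLen ρ) ∨ c < a.rowLen j := by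
      intro c
      rw [← YoungDiagram.mem_iff_lt_rowLen, ← YoungDiagram.mem_cells, h]
      simp [YoungDiagram.mem_iff_lt_rowLen]
    have h1 := hmem (a.rowLen j)
    have h2 := hmem (a.rowLen j + 1)
    have h3 := hmem (b.rowLen j)
    split_ifs with hj
    · subst hj; omega
    · omega

theorem AddsRow.card_eq {ρ : ℕ} {a b : YoungDiagram} (h : AddsRow ρ a b) :
    b.card = a.card + 1 := by
  rw [addsRow_iff_cells] at h
  show b.cells.card = a.cells.card + 1
  rw [h, Finset.card_insert_of_notMem]
  simp [YoungDiagram.mem_iff_lt_rowLen]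

theorem addsSquare_iff {a b : YoungDiagram} : AddsSquare a b ↔ ∃ ρ, AddsRow ρ a b := by
  constructor
  · rintro ⟨hle, hcard⟩
    have hsub : a.cells ⊆ b.cells := YoungDiagram.cells_subset_iff.2 hle
    have h1 : (b.cells \ a.cells).card = 1 := by
      rw [Finset.card_sdiff_of_subset hsub]
      have : b.cells.card = a.cells.card + 1 := hcard
      omega
    obtain ⟨⟨ρ, c⟩, hs⟩ := Finset.card_eq_one.1 h1
    refine ⟨ρ, addsRow_iff_cells.2 ?_⟩
    have hb : b.cells = insert (ρ, c) a.cells := by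
      rw [← Finset.sdiff_union_of_subset hsub, hs]; rfl
    have hm : ∀ c', c' < b.rowLen ρ ↔ c' = c ∨ c' < a.rowLen ρ := by
      intro c'
      rw [← YoungDiagram.mem_iff_lt_rowLen, ← YoungDiagram.mem_cells, hb]
      simp [YoungDiagram.mem_iff_lt_rowLen]
    have hc : (ρ, c) ∉ a := by
      have : (ρ, c) ∈ b.cells \ a.cells := by rw [hs]; simp
      simpa using (Finset.mem_sdiff.1 this).2
    rw [YoungDiagram.mem_iff_lt_rowLen] at hc
    have h2 := hm c
    have h3 := hm (a.rowLen ρ)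
    have : c = a.rowLen ρ := by omega
    rw [← this, hb]
  · rintro ⟨ρ, h⟩
    exact ⟨YoungDiagram.le_iff_rowLen.2 fun r => by rw [h r]; omega, h.card_eq⟩

/-- The criterion for two squares, added to `a` in the rows `x` and `y`, to form a domino. -/
theorem exists_domino_iff {a b d : YoungDiagram} {x y : ℕ} (h : AddsRow x a b)
    (h' : AddsRow y b d) :
    (∃ e : Domino, d.cells \ a.cells = e.cells) ↔
      y = x ∨ (y = x + 1 ∧ a.rowLen (x + 1) = a.rowLen x) := by
  have hd : d.cells \ a.cells = {(x, a.rowLen x), (y, b.rowLen y)} := by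
    rw [addsRow_iff_cells.1 h', addsRow_iff_cells.1 h]
    ext ⟨r, c⟩
    simp only [Finset.mem_sdiff, Finset.mem_insert, Finset.mem_singleton, YoungDiagram.mem_cells,
      YoungDiagram.mem_iff_lt_rowLen, Prod.mk.injEq]
    have := h y
    constructor
    · tauto
    · rintro (⟨rfl, rfl⟩ | ⟨rfl, rfl⟩)
      · simp
      · refine ⟨Or.inl ⟨rfl, rfl⟩, ?_⟩
        omega
  have hby := h y
  have hanti := b.rowLen_anti
  constructor
  · rintro ⟨e, he⟩
    rw [hd] at he
    have h1 : (x, a.rowLen x) ∈ e.cells := he ▸ by simp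
    have h2 : (y, b.rowLen y) ∈ e.cells := he ▸ by simp
    by_cases hxy : y = x
    · exact Or.inl hxy
    · right
      rw [if_neg hxy] at hby
      rcases e with ⟨r, c, v⟩
      have h3 := hanti y x
      have h4 := h x
      rw [if_pos rfl] at h4
      cases v
      · simp [Domino.cells, Domino.lastRow, Domino.lastCol] at h1 h2
        omega
      · simp [Domino.cells, Domino.lastRow, Domino.lastCol] at h1 h2
        have : y = x + 1 ∨ x = y + 1 := by omega
        rcases this with rfl | rfl
        · omega
        · omega
  · rintro (rfl | ⟨rfl, h1⟩)
    · refine ⟨Domino.horiz y (a.rowLen y), ?_⟩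
      rw [hd, hby, if_pos rfl]
      simp [Domino.cells, Domino.horiz, Domino.lastRow, Domino.lastCol]
    · refine ⟨Domino.vert x (a.rowLen x), ?_⟩
      rw [hd, hby, if_neg (by omega), h1]
      simp [Domino.cells, Domino.vert, Domino.lastRow, Domino.lastCol]

/-- A square can be added to a row that is shorter than the row above it. -/
theorem exists_addsRow {a : YoungDiagram} {y : ℕ} (h : ∀ q, q + 1 = y → a.rowLen y < a.rowLen q) :
    ∃ e, AddsRow y a e := by
  refine ⟨⟨insert (y, a.rowLen y) a.cells, ?_⟩, addsRow_iff_cells.2 rfl⟩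
  rintro ⟨r, c⟩ ⟨r', c'⟩ hle hm
  obtain ⟨h1, h2⟩ : r' ≤ r ∧ c' ≤ c := hle
  simp only [Finset.coe_insert, Set.mem_insert_iff, Finset.mem_coe, Prod.mk.injEq,
    YoungDiagram.mem_cells] at hm ⊢
  rcases hm with ⟨rfl, rfl⟩ | hm
  · by_cases hr : r' = r
    · subst hr
      rw [YoungDiagram.mem_iff_lt_rowLen]; omega
    · right
      rw [YoungDiagram.mem_iff_lt_rowLen]
      have h3 := h (r - 1) (by omega)
      have h4 := a.rowLen_anti r' (r - 1) (by omega)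
      omega
  · exact Or.inr (a.up_left_mem h1 h2 hm)

/-- The local rule of tableau switching: two steps of a chain can be completed to a square. -/
theorem exists_switch {a b d : YoungDiagram} (h : AddsSquare a b) (h' : AddsSquare b d) :
    ∃ e, AddsSquare a e ∧ AddsSquare e d ∧
      (b = e ↔ ∃ x : Domino, d.cells \ a.cells = x.cells) := by
  obtain ⟨x, hx⟩ := addsSquare_iff.1 h
  obtain ⟨y, hy⟩ := addsSquare_iff.1 h'
  rw [exists_domino_iff hx hy]
  by_cases hd : y = x ∨ (y = x + 1 ∧ a.rowLen (x + 1) = a.rowLen x)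
  · exact ⟨b, h, h', by simp [hd]⟩
  · have hlt : ∀ q, q + 1 = y → a.rowLen y < a.rowLen q := by
      rintro q rfl
      have h1 := d.rowLen_anti q (q + 1) (by omega)
      rw [hy, hy, hx, hx] at h1
      rw [if_pos rfl, if_neg (by omega : q ≠ q + 1)] at h1
      have h3 := a.rowLen_anti q (q + 1) (by omega)
      by_cases hq : q = x
      · subst hq; omega
      · rw [if_neg hq] at h1
        omega
    obtain ⟨e, he⟩ := exists_addsRow hlt
    refine ⟨e, addsSquare_iff.2 ⟨y, he⟩, addsSquare_iff.2 ⟨x, fun j => ?_⟩, ?_⟩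
    · rw [hy, hx, he]; omega
    · simp only [hd, iff_false]
      rintro rfl
      exact hd (Or.inl (he.eq_of hx))

/-- A square of a tableau switching family, with the rows in which squares are added along its left,
upper, lower and right edges. -/
structure IsSwitchSquare (a b e d : YoungDiagram) (x ρ σ y : ℕ) : Prop where
  left : AddsRow x a b
  upper : AddsRow ρ a e
  lower : AddsRow σ b d
  right : AddsRow y e d
  rule : (ρ ≠ x ∧ y = x ∧ σ = ρ) ∨
    (ρ = x ∧ y = σ ∧ (σ = x ∨ (σ = x + 1 ∧ a.rowLen (x + 1) = a.rowLen x)))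

theorem exists_isSwitchSquare {a b e d : YoungDiagram} (h1 : AddsSquare a b) (h2 : AddsSquare a e)
    (h3 : AddsSquare b d) (h4 : AddsSquare e d)
    (h5 : b = e ↔ ∃ x : Domino, d.cells \ a.cells = x.cells) :
    ∃ x ρ σ y, IsSwitchSquare a b e d x ρ σ y := by
  obtain ⟨x, hx⟩ := addsSquare_iff.1 h1
  obtain ⟨ρ, hρ⟩ := addsSquare_iff.1 h2
  obtain ⟨σ, hσ⟩ := addsSquare_iff.1 h3
  obtain ⟨y, hy⟩ := addsSquare_iff.1 h4
  refine ⟨x, ρ, σ, y, hx, hρ, hσ, hy, ?_⟩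
  by_cases hρx : ρ = x
  · right
    subst hρx
    have hbe : b = e := YoungDiagram.ext_rowLen fun r => by rw [hx, hρ]
    subst hbe
    exact ⟨rfl, hy.eq_of hσ, (exists_domino_iff hx hσ).1 (h5.1 rfl)⟩
  · left
    have k : ∀ j, (if j = x then 1 else 0) + (if j = σ then 1 else 0) =
        (if j = ρ then 1 else 0) + if j = y then 1 else 0 := fun j => by
      have e1 := hσ j; have e2 := hy j; rw [hx] at e1; rw [hρ] at e2; omega
    have k1 := k x
    have k2 := k ρ
    rw [if_pos rfl, if_neg (Ne.symm hρx)] at k1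
    rw [if_pos rfl, if_neg hρx] at k2
    refine ⟨hρx, ?_, ?_⟩
    · by_contra hne; rw [if_neg (Ne.symm hne)] at k1; omega
    · by_contra hne; rw [if_neg (Ne.symm hne)] at k2; omega

/-- A square of a tableau switching family satisfies the octahedron recurrence. -/
theorem IsSwitchSquare.octa {a b e d : YoungDiagram} {x ρ σ y : ℕ}
    (h : IsSwitchSquare a b e d x ρ σ y) : Octa (psum a) (psum b) (psum e) (psum d) := by
  have hb := h.left.psum_eq
  have he := h.upper.psum_eq
  have hd : psum d = bump σ (bump x (psum a)) := by rw [h.lower.psum_eq, hb]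
  rw [hb, he, hd]
  have rd : ∀ j, d.rowLen j = a.rowLen j + (if j = x then 1 else 0) + if j = σ then 1 else 0 :=
    fun j => by rw [h.lower j, h.left j]
  refine ⟨by simp [bump], fun r => ?_⟩
  have hr1 := psum_succ a r
  have hr2 : psum a (r + 2) = psum a (r + 1) + a.rowLen (r + 1) := psum_succ a (r + 1)
  have ha := a.rowLen_anti r (r + 1) (by omega)
  have hbr := b.rowLen_anti r (r + 1) (by omega)
  have her := e.rowLen_anti r (r + 1) (by omega)
  have hdr := d.rowLen_anti r (r + 1) (by omega)
  rw [h.left, h.left] at hbr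
  rw [h.upper, h.upper] at her
  rw [rd, rd] at hdr
  simp only [bump]
  rcases h.rule with ⟨h1, rfl, rfl⟩ | ⟨rfl, rfl, h1 | ⟨rfl, h1⟩⟩
  · split_ifs at hbr her hdr ⊢ <;> omega
  · subst h1
    split_ifs at hbr her hdr ⊢ <;> omega
  · have h2 : r = ρ → a.rowLen (r + 1) = a.rowLen r := by rintro rfl; exact h1
    split_ifs at hbr her hdr ⊢ <;> omega

/-- Tableau switching preserves the direction of the consecutive steps of a chain. -/
theorem IsSwitchSquare.le_iff {c0 c1 d0 d1 e0 e1 : YoungDiagram} {x ρ σ y ρ' σ' z : ℕ}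
    (h : IsSwitchSquare c0 c1 d0 d1 x ρ σ y) (h' : IsSwitchSquare d0 d1 e0 e1 y ρ' σ' z) :
    ρ' ≤ ρ ↔ σ' ≤ σ := by
  have ha := c0.rowLen_anti ρ (ρ + 1) (by omega)
  have he := e1.rowLen_anti ρ (ρ + 1) (by omega)
  have r1 := h'.lower ρ
  have r2 := h'.lower (ρ + 1)
  have r3 := h'.left ρ
  have r4 := h'.left (ρ + 1)
  have r5 := h.upper ρ
  have r6 := h.upper (ρ + 1)
  rcases h.rule with ⟨h1, rfl, rfl⟩ | ⟨rfl, rfl, h1 | ⟨rfl, h1⟩⟩ <;>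
    rcases h'.rule with ⟨h2, rfl, rfl⟩ | ⟨rfl, rfl, h3 | ⟨rfl, h3⟩⟩ <;> try omega
  · subst h1
    split_ifs at * <;> omega
  · subst h3
    split_ifs at * <;> omega

/-- The steps from `c a` to `c b` of a chain add one square each, from left to right. -/
def IsAscending (c : ℕ → YoungDiagram) (a b : ℕ) : Prop :=
  ∃ ρ : ℕ → ℕ, (∀ j, a ≤ j → j < b → AddsRow (ρ j) (c j) (c (j + 1))) ∧
    ∀ j, a ≤ j → j + 1 < b → ρ (j + 1) ≤ ρ j

theorem IsAscending.mono {c : ℕ → YoungDiagram} {a b a' b' : ℕ} (h : IsAscending c a b)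
    (ha : a ≤ a') (hb : b' ≤ b) : IsAscending c a' b' := by
  obtain ⟨ρ, h1, h2⟩ := h
  exact ⟨ρ, fun j _ _ => h1 j (by omega) (by omega), fun j _ _ => h2 j (by omega) (by omega)⟩

theorem IsAscending.rowLen_le {c : ℕ → YoungDiagram} {a b : ℕ} (h : IsAscending c a b)
    (hab : a ≤ b) (r : ℕ) : (c a).rowLen r ≤ (c b).rowLen r := by
  obtain ⟨ρ, h1, -⟩ := h
  induction b, hab using Nat.le_induction with
  | base => exact le_rfl
  | succ b hab ih =>
    have := h1 b hab (by omega) r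
    have := ih fun j hj hj' => h1 j hj (by omega)
    omega

/-- Once a chain that ascends has added a square in row `r`, it adds no more squares below. -/
theorem IsAscending.rowLen_eq {c : ℕ → YoungDiagram} {a b : ℕ} (h : IsAscending c a (b + 1))
    (hab : a ≤ b) {r : ℕ} (hr : (c a).rowLen r < (c b).rowLen r) :
    (c (b + 1)).rowLen (r + 1) = (c b).rowLen (r + 1) := by
  obtain ⟨ρ, h1, h2⟩ := h
  have h3 : ∀ k, a ≤ k → k ≤ b → ρ k ≤ r ∨ (c k).rowLen r = (c a).rowLen r := by
    intro k hk
    induction k, hk using Nat.le_induction with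
    | base => exact fun _ => Or.inr rfl
    | succ k hk ih =>
      intro hkb
      have h4 := h2 k hk (by omega)
      rcases ih (by omega) with h5 | h5
      · exact Or.inl (by omega)
      · rw [h1 k hk (by omega)]
        split_ifs with h6
        · exact Or.inl (by omega)
        · exact Or.inr (by omega)
  have h4 := h3 b hab le_rfl
  rw [h1 b hab (by omega), if_neg (by omega), add_zero]

/-- A chain that ascends adds a horizontal strip. -/
theorem IsAscending.strip {c : ℕ → YoungDiagram} {a b : ℕ} (h : IsAscending c a b) (hab : a ≤ b)
    (r : ℕ) : (c b).rowLen (r + 1) ≤ (c a).rowLen r := by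
  induction b, hab using Nat.le_induction with
  | base => exact (c a).rowLen_anti _ _ (by omega)
  | succ b hab ih =>
    have h1 := ih (h.mono le_rfl (by omega))
    by_cases hr : (c a).rowLen r < (c b).rowLen r
    · rw [h.rowLen_eq hab hr]; exact h1
    · have h2 := (h.mono le_rfl (by omega : b ≤ b + 1)).rowLen_le hab r
      obtain ⟨ρ, h3, -⟩ := h
      have h4 := h3 b hab (by omega) r
      have h5 := h3 b hab (by omega) (r + 1)
      have h6 := (c (b + 1)).rowLen_anti r (r + 1) (by omega)
      have h7 := (c b).rowLen_anti r (r + 1) (by omega)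
      split_ifs at h4 h5 <;> omega

/-- A row of squares can be merged to a single square if its upper edge ascends. -/
theorem octa_of_isAscending {c d : ℕ → YoungDiagram} {a b : ℕ} (hab : a ≤ b)
    (hc : IsAscending c a b) (hd : ∀ j, a ≤ j → j < b → ∀ r, (d j).rowLen r ≤ (d (j + 1)).rowLen r)
    (hcd : ∀ j, a ≤ j → j ≤ b → ∀ r, (d j).rowLen (r + 1) ≤ (c j).rowLen r)
    (hsq : ∀ j, a ≤ j → j < b →
      Octa (psum (c j)) (psum (d j)) (psum (c (j + 1))) (psum (d (j + 1)))) :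
    Octa (psum (c a)) (psum (d a)) (psum (c b)) (psum (d b)) := by
  induction b, hab using Nat.le_induction with
  | base =>
    refine ⟨add_comm _ _, fun r => ?_⟩
    have h1 := psum_succ (c a) r
    have h2 : psum (d a) (r + 2) = psum (d a) (r + 1) + (d a).rowLen (r + 1) := psum_succ (d a) _
    have h3 := hcd a le_rfl le_rfl r
    omega
  | succ b hab ih =>
    refine (ih (hc.mono le_rfl (by omega)) (fun j _ _ => hd j (by omega) (by omega))
      (fun j _ _ => hcd j (by omega) (by omega)) (fun j _ _ => hsq j (by omega) (by omega))).merge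
      (hsq b hab (by omega)) (fun r => ?_) (fun r => ?_) (fun r => ?_) (fun r h => ?_)
    · have := (hc.mono le_rfl (by omega : b ≤ b + 1)).rowLen_le hab r
      rw [psum_succ, psum_succ]; omega
    · have := hd b hab (by omega) r
      rw [psum_succ, psum_succ]; omega
    · have h1 : psum (d b) (r + 2) = psum (d b) (r + 1) + (d b).rowLen (r + 1) := psum_succ _ _
      have := hcd b hab (by omega) r
      rw [h1, psum_succ (c b)]; omega
    · have h1 : psum (c b) (r + 2) = psum (c b) (r + 1) + (c b).rowLen (r + 1) := psum_succ _ _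
      have h2 : psum (c (b + 1)) (r + 2) = psum (c (b + 1)) (r + 1) + (c (b + 1)).rowLen (r + 1) :=
        psum_succ _ _
      rw [psum_succ, psum_succ] at h
      have := hc.rowLen_eq hab (r := r) (by omega)
      rw [h1, h2]; omega

/-! ### Tableau switching families -/

theorem IsSwitchingFamily.exists_isSwitchSquare {m n : ℕ} {F : ℕ → ℕ → YoungDiagram}
    (hF : IsSwitchingFamily m n F) {i j : ℕ} (hi : i < m) (hj : j < n) :
    ∃ x ρ σ y, IsSwitchSquare (F i j) (F (i + 1) j) (F i (j + 1)) (F (i + 1) (j + 1)) x ρ σ y :=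
  _root_.exists_isSwitchSquare (hF.vertical i j hi hj.le) (hF.horizontal i j hi.le hj)
    (hF.horizontal (i + 1) j hi hj) (hF.vertical i (j + 1) hi hj) (hF.switch i j hi hj)

theorem isAscending_iff {c : ℕ → YoungDiagram} {a b : ℕ} :
    IsAscending c a b ↔ (∀ j, a ≤ j → j < b → AddsSquare (c j) (c (j + 1))) ∧
      ∀ j, a ≤ j → j + 1 < b → ∀ ρ ρ', AddsRow ρ (c j) (c (j + 1)) →
        AddsRow ρ' (c (j + 1)) (c (j + 2)) → ρ' ≤ ρ := by
  constructor
  · rintro ⟨ρ, h1, h2⟩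
    refine ⟨fun j hj hj' => addsSquare_iff.2 ⟨_, h1 j hj hj'⟩, fun j hj hj' x y hx hy => ?_⟩
    rw [hx.eq_of (h1 j hj (by omega)), hy.eq_of (h1 (j + 1) (by omega) hj')]
    exact h2 j hj hj'
  · rintro ⟨h1, h2⟩
    have h3 : ∀ j, ∃ ρ, a ≤ j → j < b → AddsRow ρ (c j) (c (j + 1)) := fun j => by
      by_cases hj : a ≤ j ∧ j < b
      · obtain ⟨ρ, hρ⟩ := addsSquare_iff.1 (h1 j hj.1 hj.2)
        exact ⟨ρ, fun _ _ => hρ⟩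
      · exact ⟨0, fun h h' => absurd ⟨h, h'⟩ hj⟩
    choose ρ hρ using h3
    exact ⟨ρ, hρ, fun j hj hj' => h2 j hj hj' _ _ (hρ j hj (by omega)) (hρ (j + 1) (by omega) hj')⟩

/-- Whether the rows of a switching family ascend does not depend on the row. -/
theorem IsSwitchingFamily.isAscending_succ_iff {m n : ℕ} {F : ℕ → ℕ → YoungDiagram}
    (hF : IsSwitchingFamily m n F) {i a b : ℕ} (hi : i < m) (hb : b ≤ n) :
    IsAscending (F i) a b ↔ IsAscending (F (i + 1)) a b := by
  rw [isAscending_iff, isAscending_iff]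
  constructor
  · rintro ⟨-, h⟩
    refine ⟨fun j _ hj => hF.horizontal _ _ hi (by omega), fun j hj hj' ρ ρ' hρ hρ' => ?_⟩
    obtain ⟨x, s, t, y, hs⟩ := hF.exists_isSwitchSquare hi (by omega : j < n)
    obtain ⟨x', s', t', y', hs'⟩ := hF.exists_isSwitchSquare hi (by omega : j + 1 < n)
    obtain rfl := hs.right.eq_of hs'.left
    rw [hρ.eq_of hs.lower, hρ'.eq_of hs'.lower]
    exact (hs.le_iff hs').1 (h j hj hj' _ _ hs.upper hs'.upper)
  · rintro ⟨-, h⟩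
    refine ⟨fun j _ hj => hF.horizontal _ _ hi.le (by omega), fun j hj hj' ρ ρ' hρ hρ' => ?_⟩
    obtain ⟨x, s, t, y, hs⟩ := hF.exists_isSwitchSquare hi (by omega : j < n)
    obtain ⟨x', s', t', y', hs'⟩ := hF.exists_isSwitchSquare hi (by omega : j + 1 < n)
    obtain rfl := hs.right.eq_of hs'.left
    rw [hρ.eq_of hs.upper, hρ'.eq_of hs'.upper]
    exact (hs.le_iff hs').2 (h j hj hj' _ _ hs.lower hs'.lower)

theorem IsSwitchingFamily.isAscending_iff {m n : ℕ} {F : ℕ → ℕ → YoungDiagram}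
    (hF : IsSwitchingFamily m n F) {i i' a b : ℕ} (hi : i ≤ m) (hi' : i' ≤ m) (hb : b ≤ n) :
    IsAscending (F i) a b ↔ IsAscending (F i') a b := by
  have key : ∀ k ≤ m, (IsAscending (F k) a b ↔ IsAscending (F 0) a b) := by
    intro k hk
    induction k with
    | zero => rfl
    | succ k ih => exact (hF.isAscending_succ_iff (by omega) hb).symm.trans (ih (by omega))
  rw [key i hi, key i' hi']

/-- The strip of squares between two consecutive rows that ascend. -/
theorem IsSwitchingFamily.octa_succ {m n : ℕ} {F : ℕ → ℕ → YoungDiagram}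
    (hF : IsSwitchingFamily m n F) {i a b : ℕ} (hi : i < m) (hab : a ≤ b) (hb : b ≤ n)
    (h : IsAscending (F i) a b) :
    Octa (psum (F i a)) (psum (F (i + 1) a)) (psum (F i b)) (psum (F (i + 1) b)) := by
  refine octa_of_isAscending hab h (fun j _ hj r => ?_) (fun j _ hj r => ?_) fun j _ hj => ?_
  · obtain ⟨ρ, hρ⟩ := addsSquare_iff.1 (hF.horizontal (i + 1) j hi (by omega))
    rw [hρ]; omega
  · obtain ⟨ρ, hρ⟩ := addsSquare_iff.1 (hF.vertical i j hi (by omega))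
    have h1 := hρ r
    have h2 := hρ (r + 1)
    have h3 := (F i j).rowLen_anti r (r + 1) (by omega)
    have h4 := (F (i + 1) j).rowLen_anti r (r + 1) (by omega)
    split_ifs at h1 h2 <;> omega
  · obtain ⟨x, ρ, σ, y, hs⟩ := hF.exists_isSwitchSquare hi (by omega : j < n)
    exact hs.octa

/-- A block of a switching family whose rows and columns ascend satisfies the octahedron
recurrence. -/
theorem IsSwitchingFamily.octa {m n : ℕ} {F : ℕ → ℕ → YoungDiagram}
    (hF : IsSwitchingFamily m n F) {a b a' b' : ℕ} (hab : a ≤ b) (hb : b ≤ n) (hab' : a' ≤ b')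
    (hb' : b' ≤ m) (h : IsAscending (F 0) a b) (h' : IsAscending (fun i => F i a) a' b') :
    Octa (psum (F a' a)) (psum (F b' a)) (psum (F a' b)) (psum (F b' b)) := by
  refine Octa.symm (octa_of_isAscending (c := fun i => F i a) (d := fun i => F i b) hab' h'
    (fun i _ hi r => ?_) (fun i _ hi r => ?_) fun i _ hi => ?_)
  · obtain ⟨ρ, hρ⟩ := addsSquare_iff.1 (hF.vertical i b (by omega) hb)
    have := hρ r
    omega
  · exact IsAscending.strip ((hF.isAscending_iff (by omega) (by omega) hb).1 h) hab r
  · exact (hF.octa_succ (by omega) hab hb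
      ((hF.isAscending_iff (by omega) (by omega) hb).1 h)).symm

/-! ### Skew tableaux and their standardisations -/

/-- The number of indices below `n` at which the sequence `w` is less than `p`. -/
def countBelow (n : ℕ) (w : ℕ → ℕ) (p : ℕ) : ℕ := ((Finset.range n).filter fun k => w k < p).card

theorem countBelow_le (n : ℕ) (w : ℕ → ℕ) (p : ℕ) : countBelow n w p ≤ n := by
  unfold countBelow
  simpa using Finset.card_filter_le (Finset.range n) fun k => w k < p

theorem countBelow_mono (n : ℕ) (w : ℕ → ℕ) {p q : ℕ} (h : p ≤ q) :
    countBelow n w p ≤ countBelow n w q := by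
  apply Finset.card_le_card
  intro k hk
  simp only [Finset.mem_filter] at hk ⊢
  exact ⟨hk.1, by omega⟩

theorem le_of_weakly_increasing {n : ℕ} {w : ℕ → ℕ} (h : ∀ k, k + 1 < n → w k ≤ w (k + 1)) {k l : ℕ}
    (hkl : k ≤ l) (hl : l < n) : w k ≤ w l := by
  induction l, hkl using Nat.le_induction with
  | base => exact le_rfl
  | succ l hkl ih => exact (ih (by omega)).trans (h l hl)

theorem lt_iff_lt_countBelow {n : ℕ} {w : ℕ → ℕ} (h : ∀ k, k + 1 < n → w k ≤ w (k + 1)) {k : ℕ}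
    (hk : k < n) (p : ℕ) : w k < p ↔ k < countBelow n w p := by
  constructor
  · intro hw
    have : Finset.range (k + 1) ⊆ (Finset.range n).filter fun k => w k < p := by
      intro l hl
      simp only [Finset.mem_filter, Finset.mem_range] at hl ⊢
      exact ⟨by omega, (le_of_weakly_increasing h (by omega) hk).trans_lt hw⟩
    simpa [countBelow] using Finset.card_le_card this
  · intro hlt
    by_contra hw
    have : ((Finset.range n).filter fun k => w k < p) ⊆ Finset.range k := by
      intro l hl
      simp only [Finset.mem_filter, Finset.mem_range] at hl ⊢
      by_contra hkl
      have := le_of_weakly_increasing h (by omega : k ≤ l) hl.1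
      omega
    have := Finset.card_le_card this
    rw [Finset.card_range] at this
    unfold countBelow at hlt
    omega

/-- The chain `c 0, …, c n` is the standardisation of some semistandard tableau with the weakly
increasing sequence of entries `w 0, …, w (n - 1)`. -/
def IsStandardChain (n : ℕ) (c : ℕ → YoungDiagram) (w : ℕ → ℕ) : Prop :=
  (∀ k < n, AddsSquare (c k) (c (k + 1))) ∧
    ∀ k, k + 1 < n → w k < w (k + 1) ∨ (w k = w (k + 1) ∧ IsAscending c k (k + 2))

theorem IsStandardChain.le_succ {n : ℕ} {c : ℕ → YoungDiagram} {w : ℕ → ℕ}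
    (h : IsStandardChain n c w) (k : ℕ) (hk : k + 1 < n) : w k ≤ w (k + 1) := by
  rcases h.2 k hk with h1 | h1 <;> omega

theorem IsStandardChain.isAscending {n : ℕ} {c : ℕ → YoungDiagram} {w : ℕ → ℕ}
    (h : IsStandardChain n c w) (p : ℕ) :
    IsAscending c (countBelow n w p) (countBelow n w (p + 1)) := by
  have hle := countBelow_le n w (p + 1)
  rw [isAscending_iff]
  refine ⟨fun j _ hj => h.1 j (by omega), fun j hj hj' ρ ρ' hρ hρ' => ?_⟩
  have h1 := (lt_iff_lt_countBelow h.le_succ (by omega : j < n) p).not.2 (by omega)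
  have h2 := (lt_iff_lt_countBelow h.le_succ (by omega : j + 1 < n) (p + 1)).2 hj'
  rcases h.2 j (by omega) with h3 | ⟨-, h3⟩
  · omega
  · exact (isAscending_iff.1 h3).2 j le_rfl (by omega) ρ ρ' hρ hρ'

theorem IsSwitchingFamily.isStandardChain_iff {m n : ℕ} {F : ℕ → ℕ → YoungDiagram}
    (hF : IsSwitchingFamily m n F) {i i' : ℕ} (hi : i ≤ m) (hi' : i' ≤ m) (w : ℕ → ℕ) :
    IsStandardChain n (F i) w ↔ IsStandardChain n (F i') w := by
  have key : ∀ {i i' : ℕ}, i ≤ m → i' ≤ m → IsStandardChain n (F i) w →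
      IsStandardChain n (F i') w := fun {i i'} hi hi' h =>
    ⟨fun k hk => hF.horizontal _ _ hi' hk, fun k hk => by
      rw [hF.isAscending_iff hi' hi (by omega)]; exact h.2 k hk⟩
  exact ⟨key hi hi', key hi' hi⟩

theorem squarePos_lt_iff {ρ : ℕ} {a b : YoungDiagram} (h : AddsRow ρ a b) (ρ' : ℕ) :
    squarePos (ρ, a.rowLen ρ) < squarePos (ρ', b.rowLen ρ') ↔ ρ' ≤ ρ := by
  have h1 := h ρ
  rw [if_pos rfl] at h1
  unfold squarePos
  simp only []
  constructor
  · intro hlt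
    by_contra hgt
    have := b.rowLen_anti ρ ρ' (by omega)
    omega
  · intro hle
    have := b.rowLen_anti ρ' ρ hle
    omega

/-- A square of a chain is added in a definite step. -/
theorem chain_mem_iff {n : ℕ} {c : ℕ → YoungDiagram} {s : ℕ → ℕ × ℕ}
    (hs : ∀ k < n, (c (k + 1)).cells = insert (s k) (c k).cells) {k : ℕ} (hk : k ≤ n) (x : ℕ × ℕ) :
    x ∈ c k ↔ x ∈ c 0 ∨ ∃ l < k, x = s l := by
  induction k with
  | zero => simp
  | succ k ih =>
    rw [← YoungDiagram.mem_cells, hs k (by omega), Finset.mem_insert, YoungDiagram.mem_cells,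
      ih (by omega)]
    constructor
    · rintro (rfl | h | ⟨l, hl, rfl⟩)
      · exact Or.inr ⟨k, by omega, rfl⟩
      · exact Or.inl h
      · exact Or.inr ⟨l, by omega, rfl⟩
    · rintro (h | ⟨l, hl, rfl⟩)
      · exact Or.inr (Or.inl h)
      · rcases Nat.lt_succ_iff_lt_or_eq.1 hl with h1 | rfl
        · exact Or.inr (Or.inr ⟨l, h1, rfl⟩)
        · exact Or.inl rfl

namespace SkewTableau

theorem entry_le (W : SkewTableau) {r c r' c' : ℕ} (hr : r ≤ r') (hc : c ≤ c')
    (h : (r, c) ∉ W.inner) (h' : (r', c') ∈ W.outer) : W.entry r c ≤ W.entry r' c' := by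
  have hmem : ∀ a b, r ≤ a → c ≤ b → a ≤ r' → b ≤ c' →
      (a, b) ∈ W.outer.cells \ W.inner.cells := fun a b h1 h2 h3 h4 => by
    rw [Finset.mem_sdiff, YoungDiagram.mem_cells, YoungDiagram.mem_cells]
    exact ⟨W.outer.up_left_mem h3 h4 h', fun h5 => h (W.inner.up_left_mem h1 h2 h5)⟩
  have h1 : W.entry r c ≤ W.entry r c' := by
    induction c', hc using Nat.le_induction with
    | base => exact le_rfl
    | succ k hk ih =>
      refine (ih (W.outer.up_left_mem le_rfl (by omega) h') fun a b h1 h2 h3 h4 =>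
        hmem a b h1 h2 h3 (by omega)).trans ?_
      exact W.row_weak r k (hmem _ _ le_rfl hk hr (by omega)) (hmem _ _ le_rfl (by omega) hr le_rfl)
  have h2 : W.entry r c' ≤ W.entry r' c' := by
    clear h1
    induction r', hr using Nat.le_induction with
    | base => exact le_rfl
    | succ k hk ih =>
      refine (ih (W.outer.up_left_mem (by omega) le_rfl h') fun a b h1 h2 h3 h4 =>
        hmem a b h1 h2 (by omega) h4).trans ?_
      exact (W.col_strict k c' (hmem _ _ hk hc (by omega) le_rfl)
        (hmem _ _ (by omega) hc le_rfl le_rfl)).le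
  exact h1.trans h2

/-- The partition formed by the inner shape and the entries less than `p`. -/
def below (W : SkewTableau) (p : ℕ) : YoungDiagram where
  cells := W.outer.cells.filter fun s => s ∈ W.inner ∨ W.entry s.1 s.2 < p
  isLowerSet := by
    rintro ⟨r, c⟩ ⟨r', c'⟩ ⟨hr, hc⟩ h
    simp only [Finset.coe_filter, Set.mem_ofPred_eq, YoungDiagram.mem_cells] at h ⊢
    refine ⟨W.outer.up_left_mem hr hc h.1, ?_⟩
    by_cases hin : (r', c') ∈ W.inner
    · exact Or.inl hin
    · right
      rcases h.2 with h1 | h1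
      · exact absurd (W.inner.up_left_mem hr hc h1) hin
      · exact (W.entry_le hr hc hin h.1).trans_lt h1

theorem mem_below (W : SkewTableau) (p : ℕ) (s : ℕ × ℕ) :
    s ∈ W.below p ↔ s ∈ W.outer ∧ (s ∈ W.inner ∨ W.entry s.1 s.2 < p) := by
  rw [← YoungDiagram.mem_cells]
  simp [below]

/-- The number of entries `k`. -/
def weight (W : SkewTableau) (k : ℕ) : ℕ :=
  ((W.outer.cells \ W.inner.cells).filter fun s => W.entry s.1 s.2 = k).card

theorem IsStandardisation.isStandardChain {W : SkewTableau} {n : ℕ} {c : ℕ → YoungDiagram}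
    {w : ℕ → ℕ} (h : W.IsStandardisation n c w) : IsStandardChain n c w := by
  obtain ⟨-, -, s, h1, h2⟩ := h
  have hrow : ∀ k < n, ∃ ρ, AddsRow ρ (c k) (c (k + 1)) ∧ s k = (ρ, (c k).rowLen ρ) := by
    intro k hk
    obtain ⟨h3, h4, -⟩ := h1 k hk
    have hA : AddsSquare (c k) (c (k + 1)) := by
      refine ⟨YoungDiagram.cells_subset_iff.1 ?_, ?_⟩
      · rw [h4]; exact Finset.subset_insert _ _
      · show (c (k + 1)).cells.card = _
        rw [h4, Finset.card_insert_of_notMem h3]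
    obtain ⟨ρ, hρ⟩ := addsSquare_iff.1 hA
    refine ⟨ρ, hρ, ?_⟩
    have h5 : s k ∈ (c (k + 1)).cells := by rw [h4]; exact Finset.mem_insert_self _ _
    rw [addsRow_iff_cells.1 hρ, Finset.mem_insert] at h5
    exact h5.resolve_right h3
  refine ⟨fun k hk => ?_, fun k hk => ?_⟩
  · obtain ⟨ρ, hρ, -⟩ := hrow k hk
    exact addsSquare_iff.2 ⟨ρ, hρ⟩
  · rcases h2 k hk with h3 | ⟨h3, h4⟩
    · exact Or.inl h3
    · refine Or.inr ⟨h3, isAscending_iff.2 ⟨fun j hj hj' => ?_, fun j hj hj' ρ ρ' hρ hρ' => ?_⟩⟩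
      · obtain ⟨ρ, hρ, -⟩ := hrow j (by omega)
        exact addsSquare_iff.2 ⟨ρ, hρ⟩
      · obtain rfl : j = k := by omega
        obtain ⟨x, hx, hx'⟩ := hrow j (by omega)
        obtain ⟨y, hy, hy'⟩ := hrow (j + 1) (by omega)
        rw [hx', hy', squarePos_lt_iff hx] at h4
        rw [hρ.eq_of hx, hρ'.eq_of hy]
        exact h4

theorem IsStandardisation.below_eq {W : SkewTableau} {n : ℕ} {c : ℕ → YoungDiagram}
    {w : ℕ → ℕ} (h : W.IsStandardisation n c w) (p : ℕ) : W.below p = c (countBelow n w p) := by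
  have hle := h.isStandardChain.le_succ
  obtain ⟨h0, hn, s, h1, -⟩ := h
  have hmem := fun k (hk : k ≤ n) => chain_mem_iff (fun k hk => (h1 k hk).2.1) hk
  have hnin : ∀ l < n, s l ∉ W.inner := fun l hl hin =>
    (h1 l hl).1 ((hmem l hl.le _).2 (Or.inl (h0 ▸ hin)))
  refine YoungDiagram.ext ?_
  ext x
  rw [YoungDiagram.mem_cells, YoungDiagram.mem_cells, mem_below, hmem _ (countBelow_le n w p), ← hn,
    hmem n le_rfl, h0]
  constructor
  · rintro ⟨h3 | ⟨l, hl, rfl⟩, h4⟩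
    · exact Or.inl h3
    · rcases h4 with h4 | h4
      · exact Or.inl h4
      · rw [(h1 l hl).2.2, lt_iff_lt_countBelow hle hl] at h4
        exact Or.inr ⟨l, h4, rfl⟩
  · rintro (h3 | ⟨l, hl, rfl⟩)
    · exact ⟨Or.inl h3, Or.inl h3⟩
    · have hln : l < n := hl.trans_le (countBelow_le n w p)
      refine ⟨Or.inr ⟨l, hln, rfl⟩, Or.inr ?_⟩
      rw [(h1 l hln).2.2, lt_iff_lt_countBelow hle hln]
      exact hl

theorem IsStandardisation.weight_eq {W : SkewTableau} {n : ℕ} {c : ℕ → YoungDiagram}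
    {w : ℕ → ℕ} (h : W.IsStandardisation n c w) (k : ℕ) :
    W.weight k = ((Finset.range n).filter fun l => w l = k).card := by
  obtain ⟨h0, hn, s, h1, -⟩ := h
  have hmem := fun k (hk : k ≤ n) => chain_mem_iff (fun k hk => (h1 k hk).2.1) hk
  have hinj : ∀ l < n, ∀ l' < l, s l' ≠ s l := fun l hl l' hl' he =>
    (h1 l hl).1 ((hmem l hl.le _).2 (Or.inr ⟨l', hl', he.symm⟩))
  symm
  refine Finset.card_bij (fun l _ => s l) ?_ ?_ ?_
  · intro l hl
    simp only [Finset.mem_filter, Finset.mem_range] at hl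
    simp only [Finset.mem_filter, Finset.mem_sdiff, YoungDiagram.mem_cells]
    refine ⟨⟨?_, fun hin => ?_⟩, by rw [(h1 l hl.1).2.2, hl.2]⟩
    · rw [← hn, hmem n le_rfl]; exact Or.inr ⟨l, hl.1, rfl⟩
    · exact (h1 l hl.1).1 ((hmem l hl.1.le _).2 (Or.inl (h0 ▸ hin)))
  · intro l hl l' hl' he
    simp only [Finset.mem_filter, Finset.mem_range] at hl hl'
    rcases lt_trichotomy l l' with h2 | h2 | h2
    · exact absurd he (hinj l' hl'.1 l h2)
    · exact h2
    · exact absurd he.symm (hinj l hl.1 l' h2)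
  · intro x hx
    simp only [Finset.mem_filter, Finset.mem_sdiff, YoungDiagram.mem_cells] at hx
    obtain ⟨⟨h2, h3⟩, h4⟩ := hx
    rw [← hn, hmem n le_rfl, h0] at h2
    obtain ⟨l, hl, rfl⟩ := h2.resolve_left h3
    exact ⟨l, by simp [hl, ← h4, (h1 l hl).2.2], rfl⟩

end SkewTableau

/-- Every chain of the right form is a standardisation. -/
theorem IsStandardChain.exists_skewTableau {n : ℕ} {c : ℕ → YoungDiagram} {w : ℕ → ℕ}
    (h : IsStandardChain n c w) : ∃ W : SkewTableau, W.IsStandardisation n c w := by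
  classical
  have hrow : ∀ k, ∃ ρ, k < n → AddsRow ρ (c k) (c (k + 1)) := fun k => by
    by_cases hk : k < n
    · obtain ⟨ρ, hρ⟩ := addsSquare_iff.1 (h.1 k hk)
      exact ⟨ρ, fun _ => hρ⟩
    · exact ⟨0, fun h => absurd h hk⟩
  choose ρ hρ using hrow
  set s : ℕ → ℕ × ℕ := fun k => (ρ k, (c k).rowLen (ρ k)) with hs
  have hcell : ∀ k < n, (c (k + 1)).cells = insert (s k) (c k).cells := fun k hk =>
    addsRow_iff_cells.1 (hρ k hk)
  have hmem := fun k (hk : k ≤ n) => chain_mem_iff hcell hk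
  have hnot : ∀ k, s k ∉ c k := fun k => by
    rw [hs, YoungDiagram.mem_iff_lt_rowLen]; exact lt_irrefl _
  have hinj : ∀ l < n, ∀ l' < n, s l' = s l → l' = l := by
    have : ∀ l < n, ∀ l' < l, s l' ≠ s l := fun l hl l' hl' he =>
      hnot l ((hmem l hl.le _).2 (Or.inr ⟨l', hl', he.symm⟩))
    intro l hl l' hl' he
    rcases lt_trichotomy l l' with h2 | h2 | h2
    · exact absurd he.symm (this l' hl' l h2)
    · exact h2.symm
    · exact absurd he (this l hl l' h2)
  have hskew : ∀ x, x ∈ (c n).cells \ (c 0).cells ↔ ∃ l < n, x = s l := by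
    intro x
    rw [Finset.mem_sdiff, YoungDiagram.mem_cells, YoungDiagram.mem_cells, hmem n le_rfl]
    constructor
    · rintro ⟨h1, h2⟩; exact h1.resolve_left h2
    · rintro ⟨l, hl, rfl⟩
      exact ⟨Or.inr ⟨l, hl, rfl⟩, fun h0 => hnot l ((hmem l hl.le _).2 (Or.inl h0))⟩
  set ent : ℕ → ℕ → ℕ := fun r q => if hx : ∃ l < n, (r, q) = s l then w hx.choose else 0 with hent
  have hval : ∀ l < n, ent (s l).1 (s l).2 = w l := by
    intro l hl
    have hx : ∃ l' < n, ((s l).1, (s l).2) = s l' := ⟨l, hl, rfl⟩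
    simp only [hent]
    rw [dif_pos hx]
    obtain ⟨h1, h2⟩ := hx.choose_spec
    rw [hinj l hl _ h1 h2.symm]
  have hle := h.le_succ
  -- a square is added later than its neighbours to the left and above
  have hord : ∀ l < n, ∀ l' < n, (s l).1 ≤ (s l').1 → (s l).2 ≤ (s l').2 → l ≤ l' := by
    intro l hl l' hl' h1 h2
    by_contra hlt
    have h3 : s l' ∈ c l := (hmem l hl.le _).2 (Or.inr ⟨l', by omega, rfl⟩)
    exact hnot l ((c l).up_left_mem h1 h2 h3)
  have hc0 : c 0 ≤ c n := YoungDiagram.cells_subset_iff.1 fun x hx => by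
    rw [YoungDiagram.mem_cells, hmem n le_rfl]; exact Or.inl hx
  refine ⟨⟨c n, c 0, hc0, ent, ?_, ?_, ?_⟩, rfl, rfl, s, fun k hk => ⟨?_, hcell k hk, hval k hk⟩,
    fun k hk => ?_⟩
  · intro r q h1 h2
    obtain ⟨l, hl, he⟩ := (hskew _).1 h1
    obtain ⟨l', hl', he'⟩ := (hskew _).1 h2
    have e1 := hval l hl
    have e2 := hval l' hl'
    rw [← he] at e1
    rw [← he'] at e2
    simp only [] at e1 e2
    rw [e1, e2]
    refine le_of_weakly_increasing hle (hord l hl l' hl' ?_ ?_) hl' <;> rw [← he, ← he']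
    simp
  · intro r q h1 h2
    obtain ⟨l, hl, he⟩ := (hskew _).1 h1
    obtain ⟨l', hl', he'⟩ := (hskew _).1 h2
    have e1 := hval l hl
    have e2 := hval l' hl'
    rw [← he] at e1
    rw [← he'] at e2
    simp only [] at e1 e2
    rw [e1, e2]
    have hll : l ≤ l' := by
      refine hord l hl l' hl' ?_ ?_ <;> rw [← he, ← he']
      simp
    refine lt_of_le_of_ne (le_of_weakly_increasing hle hll hl') fun hw => ?_
    -- equal entries are added from left to right, hence not downwards
    obtain ⟨τ, h3, h4⟩ := h.isAscending (w l)
    have hb := (lt_iff_lt_countBelow hle hl (w l)).not.1 (lt_irrefl _)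
    have hb' := (lt_iff_lt_countBelow hle hl' (w l + 1)).1 (by omega)
    have h5 : ∀ k, l ≤ k → k ≤ l' → τ k ≤ τ l := by
      intro k hk
      induction k, hk using Nat.le_induction with
      | base => exact fun _ => le_rfl
      | succ k hk ih => exact fun hk' => (h4 k (by omega) (by omega)).trans (ih (by omega))
    have h6 := h5 l' hll le_rfl
    rw [(h3 l (by omega) (by omega)).eq_of (hρ l hl),
      (h3 l' (by omega) (by omega)).eq_of (hρ l' hl')] at h6
    have e3 : r = ρ l := congrArg Prod.fst he
    have e4 : r + 1 = ρ l' := congrArg Prod.fst he'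
    omega
  · intro r q h1
    simp only [hent]
    rw [dif_neg]
    rwa [← hskew]
  · rw [YoungDiagram.mem_cells]; exact hnot k
  · rcases h.2 k hk with h1 | ⟨h1, h2⟩
    · exact Or.inl h1
    · exact Or.inr ⟨h1, (squarePos_lt_iff (hρ k (by omega)) _).2
        ((isAscending_iff.1 h2).2 k le_rfl (by omega) _ _ (hρ k (by omega)) (hρ (k + 1) hk))⟩

/-! ### Jeu de taquin -/

/-- The chain of partial sums of a skew tableau. -/
def SkewTableau.chain (W : SkewTableau) (p : ℕ) : ℕ → ℤ := psum (W.below p)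

theorem Slide.coSlide {A B : SkewTableau} (h : Slide A B) :
    CoSlide A.chain B.chain ∧ ∀ k, A.weight k = B.weight k := by
  obtain ⟨n, F, w, hF, hA, hB⟩ := h
  refine ⟨fun p => ?_, fun k => by rw [hA.weight_eq, hB.weight_eq]⟩
  simp only [SkewTableau.chain, hA.below_eq, hB.below_eq]
  exact (hF.octa_succ (i := 0) (by omega) (countBelow_mono n w (by omega)) (countBelow_le n w _)
    (hB.isStandardChain.isAscending p)).symm

theorem JeuDeTaquinEquiv.eqvGen {A B : SkewTableau} (h : JeuDeTaquinEquiv A B) :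
    Relation.EqvGen CoSlide A.chain B.chain ∧ ∀ k, A.weight k = B.weight k := by
  induction h with
  | rel A B h => exact ⟨.rel _ _ h.coSlide.1, h.coSlide.2⟩
  | refl A => exact ⟨.refl _, fun _ => rfl⟩
  | symm A B _ ih => exact ⟨.symm _ _ ih.1, fun k => (ih.2 k).symm⟩
  | trans A B C _ _ ih ih' => exact ⟨.trans _ _ _ ih.1 ih'.1, fun k => (ih.2 k).trans (ih'.2 k)⟩

open scoped Classical in
/-- The fourth corner of the square of a switching family with left edge `a, b` and lower edge
`b, d`. -/
noncomputable def switchCorner (a b d : YoungDiagram) : YoungDiagram :=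
  if h : AddsSquare a b ∧ AddsSquare b d then (exists_switch h.1 h.2).choose else ⊥

theorem switchCorner_spec {a b d : YoungDiagram} (h : AddsSquare a b) (h' : AddsSquare b d) :
    AddsSquare a (switchCorner a b d) ∧ AddsSquare (switchCorner a b d) d ∧
      (b = switchCorner a b d ↔ ∃ x : Domino, d.cells \ a.cells = x.cells) := by
  unfold switchCorner
  rw [dif_pos ⟨h, h'⟩]
  exact (exists_switch h h').choose_spec

theorem exists_addsSquare_of_ne_bot {Y : YoungDiagram} (h : Y ≠ ⊥) : ∃ e, AddsSquare e Y := by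
  have hne : Y.cells.Nonempty := by
    rw [Finset.nonempty_iff_ne_empty]
    intro he
    exact h (YoungDiagram.ext (he.trans YoungDiagram.cells_bot.symm))
  obtain ⟨⟨r, c⟩, hx, hmax⟩ := Finset.exists_max_image Y.cells (fun x => x.1 + x.2) hne
  refine ⟨⟨Y.cells.erase (r, c), ?_⟩, ?_, ?_⟩
  · rintro ⟨r1, c1⟩ ⟨r2, c2⟩ ⟨h1, h2⟩ hm
    simp only [Finset.coe_erase, Set.mem_sdiff, Finset.mem_coe, Set.mem_singleton_iff,
      YoungDiagram.mem_cells] at hm ⊢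
    refine ⟨Y.up_left_mem h1 h2 hm.1, fun he => hm.2 ?_⟩
    have := hmax _ hm.1
    simp only [Prod.mk.injEq] at this he h1 h2 ⊢
    omega
  · rw [← YoungDiagram.cells_subset_iff]
    exact Finset.erase_subset _ _
  · show Y.cells.card = (Y.cells.erase (r, c)).card + 1
    rw [Finset.card_erase_add_one hx]

theorem IsSwitchingFamily.slide {n : ℕ} {F : ℕ → ℕ → YoungDiagram} (hF : IsSwitchingFamily 1 n F)
    {A : SkewTableau} {w : ℕ → ℕ} (hA : A.IsStandardisation n (F 1) w) :
    ∃ B : SkewTableau, B.IsStandardisation n (F 0) w ∧ Slide A B := by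
  obtain ⟨B, hB⟩ := ((hF.isStandardChain_iff (i := 1) (i' := 0) le_rfl (by omega) w).1
    hA.isStandardChain).exists_skewTableau
  exact ⟨B, hB, n, F, w, hF, hA, hB⟩

/-- Every skew tableau with a standardisation can be rectified. -/
theorem exists_rectification (k n : ℕ) : ∀ {W : SkewTableau} {c : ℕ → YoungDiagram} {w : ℕ → ℕ},
    W.IsStandardisation n c w → W.inner.card = k →
    ∃ T : YoungTableau, JeuDeTaquinEquiv T.toSkew W := by
  induction k with
  | zero =>
    intro W c w hW hk
    have hin : W.inner = ⊥ := YoungDiagram.ext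
      ((Finset.card_eq_zero.1 hk).trans YoungDiagram.cells_bot.symm)
    obtain ⟨S, hS⟩ : ∃ S : SemistandardYoungTableau W.outer, ∀ r q, S r q = W.entry r q := by
      refine ⟨⟨W.entry, ?_, ?_, ?_⟩, fun _ _ => rfl⟩
      · intro r c1 c2 hlt hm
        exact W.entry_le le_rfl hlt.le (by rw [hin]; simp) hm
      · intro r1 r2 q hlt hm
        refine lt_of_lt_of_le (W.col_strict r1 q ?_ ?_)
          (W.entry_le hlt le_rfl (by rw [hin]; simp) hm)
        · simpa [hin] using W.outer.up_left_mem hlt.le le_rfl hm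
        · simpa [hin] using W.outer.up_left_mem hlt le_rfl hm
      · intro r q hm
        exact W.zeros r q (by simp [hm])
    have hTW : YoungTableau.toSkew ⟨W.outer, S⟩ = W := by
      rcases W with ⟨outer, inner, le, entry, h1, h2, h3⟩
      obtain rfl : inner = ⊥ := hin
      simp only [YoungTableau.toSkew, SkewTableau.mk.injEq, true_and]
      exact funext fun r => funext fun q => hS r q
    refine ⟨⟨W.outer, S⟩, ?_⟩
    rw [hTW]
    exact .refl _
  | succ k ih =>
    intro W c w hW hk
    have hne : W.inner ≠ ⊥ := by
      rintro he
      rw [he] at hk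
      simp [YoungDiagram.card] at hk
    obtain ⟨e, he⟩ := exists_addsSquare_of_ne_bot hne
    rw [← hW.1] at he
    have hc := hW.isStandardChain.1
    let d : ℕ → YoungDiagram := fun j => Nat.rec e (fun j a => switchCorner a (c j) (c (j + 1))) j
    have hd : ∀ j, j ≤ n → AddsSquare (d j) (c j) := by
      intro j
      induction j with
      | zero => exact fun _ => he
      | succ j ihj => exact fun hj => (switchCorner_spec (ihj (by omega)) (hc j (by omega))).2.1
    have hsp := fun j (hj : j < n) => switchCorner_spec (hd j hj.le) (hc j hj)
    let F : ℕ → ℕ → YoungDiagram := fun i j => if i = 0 then d j else c j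
    have hF : IsSwitchingFamily 1 n F := by
      refine ⟨fun i j hi hj => ?_, fun i j hi hj => ?_, fun i j hi hj => ?_⟩
      · obtain rfl : i = 0 := by omega
        exact hd j hj
      · interval_cases i
        · exact (hsp j hj).1
        · exact hc j hj
      · obtain rfl : i = 0 := by omega
        exact (hsp j hj).2.2
    obtain ⟨B, hB, hs⟩ := hF.slide (A := W) (w := w) hW
    have hin : B.inner.card = k := by
      rw [← hB.1]
      have := he.2
      rw [hW.1, hk] at this
      show e.card = k
      omega
    obtain ⟨T, hT⟩ := ih hB hin
    exact ⟨T, .trans _ _ _ hT (.symm _ _ (.rel _ _ hs))⟩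

/-- All rows of a switching family are standardisations of equivalent tableaux. -/
theorem IsSwitchingFamily.exists_equiv {m n : ℕ} {F : ℕ → ℕ → YoungDiagram}
    (hF : IsSwitchingFamily m n F) {U : SkewTableau} {w : ℕ → ℕ}
    (hU : U.IsStandardisation n (F 0) w) {i : ℕ} (hi : i ≤ m) :
    ∃ V : SkewTableau, V.IsStandardisation n (F i) w ∧ JeuDeTaquinEquiv U V := by
  induction i with
  | zero => exact ⟨U, hU, .refl _⟩
  | succ i ih =>
    obtain ⟨V, hV, hUV⟩ := ih (by omega)
    obtain ⟨V', hV'⟩ := ((hF.isStandardChain_iff (by omega) hi w).1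
      hV.isStandardChain).exists_skewTableau
    refine ⟨V', hV', .trans _ _ _ hUV (.symm _ _
      (.rel _ _ ⟨n, fun a j => F (i + a) j, w, ?_, hV', hV⟩))⟩
    exact ⟨fun a j ha hj => hF.vertical (i + a) j (by omega) hj,
      fun a j ha hj => hF.horizontal (i + a) j (by omega) hj,
      fun a j ha hj => hF.switch (i + a) j (by omega) hj⟩

/-! ### Horizontal strips of dominoes -/

/-- The number of columns that meet both row `r - 1` and row `r` of the skew shape with row lengths
`b / a`. -/
def overlap (a b : ℕ → ℕ) (r : ℕ) : ℕ := if r = 0 then 0 else b r - a (r - 1)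

/-- The skew shape with row lengths `b / a` can be tiled by dominoes with equal entries: no column
meets more than two squares, and the squares of a row that are alone in their columns are
even in number. -/
structure IsDominoStrip (a b : ℕ → ℕ) : Prop where
  anti_left : ∀ r, a (r + 1) ≤ a r
  anti_right : ∀ r, b (r + 1) ≤ b r
  le : ∀ r, a r ≤ b r
  strip : ∀ r, b (r + 2) ≤ a r
  even : ∀ r, (b r - a r - (b (r + 1) - a r) - overlap a b r) % 2 = 0

/-- The dominoes that tile the skew shape with row lengths `b / a`: the vertical dominoes occupy the
columns that meet two squares, and the other squares of each row are paired from left to right. -/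
def IsTile (a b : ℕ → ℕ) (d : Domino) : Prop :=
  if d.vertical then a d.row ≤ d.col ∧ d.col < b (d.row + 1)
  else a d.row ≤ d.col ∧ b (d.row + 1) ≤ d.col ∧ d.col + 1 < b d.row ∧
    (d.row = 0 ∨ d.col + 1 < a (d.row - 1)) ∧
    (d.col - max (a d.row) (b (d.row + 1))) % 2 = 0

theorem isTile_vert {a b : ℕ → ℕ} {r c : ℕ} :
    IsTile a b (Domino.vert r c) ↔ a r ≤ c ∧ c < b (r + 1) := by
  simp [IsTile, Domino.vert]

theorem isTile_horiz {a b : ℕ → ℕ} {r c : ℕ} :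
    IsTile a b (Domino.horiz r c) ↔ a r ≤ c ∧ b (r + 1) ≤ c ∧ c + 1 < b r ∧
      (r = 0 ∨ c + 1 < a (r - 1)) ∧ (c - max (a r) (b (r + 1))) % 2 = 0 := by
  simp [IsTile, Domino.horiz]

namespace Domino

theorem mem_vert {r c : ℕ} {s : ℕ × ℕ} : s ∈ (vert r c).cells ↔ s = (r, c) ∨ s = (r + 1, c) := by
  simp [cells, vert, lastRow, lastCol]

theorem mem_horiz {r c : ℕ} {s : ℕ × ℕ} : s ∈ (horiz r c).cells ↔ s = (r, c) ∨ s = (r, c + 1) := by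
  simp [cells, horiz, lastRow, lastCol]

theorem eq_vert_or_eq_horiz (d : Domino) : (∃ r c, d = vert r c) ∨ ∃ r c, d = horiz r c := by
  rcases d with ⟨r, c, v⟩
  cases v
  · exact Or.inr ⟨r, c, rfl⟩
  · exact Or.inl ⟨r, c, rfl⟩

theorem vert_inj {r c r' c' : ℕ} : vert r c = vert r' c' ↔ r = r' ∧ c = c' := by
  simp [vert]

theorem horiz_inj {r c r' c' : ℕ} : horiz r c = horiz r' c' ↔ r = r' ∧ c = c' := by
  simp [horiz]

theorem vert_ne_horiz {r c r' c' : ℕ} : vert r c ≠ horiz r' c' := by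
  simp [vert, horiz]

theorem horiz_ne_vert {r c r' c' : ℕ} : horiz r c ≠ vert r' c' := by
  simp [vert, horiz]

end Domino

theorem IsTile.mem {a b : ℕ → ℕ} (h : IsDominoStrip a b) {d : Domino} (hd : IsTile a b d) {r c : ℕ}
    (hm : (r, c) ∈ d.cells) : a r ≤ c ∧ c < b r := by
  rcases d.eq_vert_or_eq_horiz with ⟨q, k, rfl⟩ | ⟨q, k, rfl⟩
  · rw [isTile_vert] at hd
    simp only [Domino.mem_vert, Prod.mk.injEq] at hm
    have := h.anti_left q
    have := h.anti_right q
    rcases hm with ⟨rfl, rfl⟩ | ⟨rfl, rfl⟩ <;> omega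
  · rw [isTile_horiz] at hd
    simp only [Domino.mem_horiz, Prod.mk.injEq] at hm
    rcases hm with ⟨rfl, rfl⟩ | ⟨rfl, rfl⟩ <;> omega

theorem IsTile.unique {a b : ℕ → ℕ} (h : IsDominoStrip a b) {d d' : Domino} (hd : IsTile a b d)
    (hd' : IsTile a b d') {s : ℕ × ℕ} (hm : s ∈ d.cells) (hm' : s ∈ d'.cells) : d = d' := by
  have main : ∀ r c d', IsTile a b (Domino.vert r c) → IsTile a b d' → ∀ s,
      s ∈ (Domino.vert r c).cells → s ∈ d'.cells → Domino.vert r c = d' := by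
    rintro r c d' hd hd' ⟨x, y⟩ hm hm'
    rcases d'.eq_vert_or_eq_horiz with ⟨q, k, rfl⟩ | ⟨q, k, rfl⟩
    · rw [isTile_vert] at hd hd'
      simp only [Domino.mem_vert, Prod.mk.injEq] at hm hm'
      rw [Domino.vert_inj]
      rcases hm with ⟨rfl, rfl⟩ | ⟨rfl, rfl⟩ <;> rcases hm' with ⟨h1, rfl⟩ | ⟨h1, rfl⟩
      · exact ⟨h1, rfl⟩
      · subst h1
        have := h.strip q
        have := h.anti_left q
        simp only [add_assoc, Nat.reduceAdd] at *
        omega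
      · subst h1
        have := h.strip r
        have := h.anti_left r
        simp only [add_assoc, Nat.reduceAdd] at *
        omega
      · omega
    · exfalso
      rw [isTile_vert] at hd
      rw [isTile_horiz] at hd'
      simp only [Domino.mem_vert, Domino.mem_horiz, Prod.mk.injEq] at hm hm'
      rcases hm with ⟨rfl, rfl⟩ | ⟨rfl, rfl⟩ <;> rcases hm' with ⟨rfl, h1⟩ | ⟨rfl, h1⟩
      · omega
      · omega
      · simp only [Nat.add_sub_cancel] at hd'; omega
      · simp only [Nat.add_sub_cancel] at hd'; omega
  rcases d.eq_vert_or_eq_horiz with ⟨r, c, rfl⟩ | ⟨r, c, rfl⟩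
  · exact main r c d' hd hd' s hm hm'
  · rcases d'.eq_vert_or_eq_horiz with ⟨q, k, rfl⟩ | ⟨q, k, rfl⟩
    · exact (main q k _ hd' hd s hm' hm).symm
    · rcases s with ⟨x, y⟩
      rw [isTile_horiz] at hd hd'
      simp only [Domino.mem_horiz, Prod.mk.injEq] at hm hm'
      rw [Domino.horiz_inj]
      rcases hm with ⟨rfl, rfl⟩ | ⟨rfl, rfl⟩ <;> rcases hm' with ⟨rfl, h1⟩ | ⟨rfl, h1⟩ <;> omega

theorem IsDominoStrip.exists_isTile {a b : ℕ → ℕ} (h : IsDominoStrip a b) {r c : ℕ} (h1 : a r ≤ c)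
    (h2 : c < b r) : ∃ d, IsTile a b d ∧ (r, c) ∈ d.cells := by
  by_cases h3 : c < b (r + 1)
  · exact ⟨Domino.vert r c, isTile_vert.2 ⟨h1, h3⟩, by simp [Domino.mem_vert]⟩
  by_cases h4 : r ≠ 0 ∧ a (r - 1) ≤ c
  · obtain ⟨q, rfl⟩ := Nat.exists_eq_succ_of_ne_zero h4.1
    exact ⟨Domino.vert q c, isTile_vert.2 ⟨by simpa using h4.2, h2⟩, by simp [Domino.mem_vert]⟩
  have he := h.even r
  unfold overlap at he
  have hb := h.anti_right r
  have ha := h.le r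
  have hs : r ≠ 0 → b (r + 1) ≤ a (r - 1) ∧ a r ≤ a (r - 1) := fun h0 => by
    obtain ⟨q, rfl⟩ := Nat.exists_eq_succ_of_ne_zero h0
    exact ⟨h.strip q, h.anti_left q⟩
  by_cases h5 : (c - max (a r) (b (r + 1))) % 2 = 0
  · refine ⟨Domino.horiz r c, isTile_horiz.2 ⟨h1, by omega, ?_, ?_, h5⟩, by simp [Domino.mem_horiz]⟩
    · split_ifs at he <;> omega
    · split_ifs at he <;> omega
  · obtain ⟨k, rfl⟩ : ∃ k, c = k + 1 := ⟨c - 1, by omega⟩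
    exact ⟨Domino.horiz r k, isTile_horiz.2 ⟨by omega, by omega, by omega, by omega, by omega⟩,
      by simp [Domino.mem_horiz]⟩

namespace DominoTableau

variable {lam mu : YoungDiagram} (D : DominoTableau lam mu)

theorem mem_iff (s : ℕ × ℕ) : (s ∈ lam ∧ s ∉ mu) ↔ ∃ x ∈ D.dominoes, s ∈ x.1.cells := by
  have := congrArg (s ∈ ·) D.cover
  simpa using this.symm

theorem eq_of_mem {x y : Domino × ℕ} (hx : x ∈ D.dominoes) (hy : y ∈ D.dominoes) {s : ℕ × ℕ}
    (h : s ∈ x.1.cells) (h' : s ∈ y.1.cells) : x = y := by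
  by_contra hne
  exact Finset.disjoint_left.1 (D.disjoint x hx y hy hne) h h'

theorem entry_le {x y : Domino × ℕ} (hx : x ∈ D.dominoes) (hy : y ∈ D.dominoes) {r c r' c' : ℕ}
    (h : (r, c) ∈ x.1.cells) (h' : (r', c') ∈ y.1.cells) (hr : r ≤ r') (hc : c ≤ c') :
    x.2 ≤ y.2 := by
  have hmu := ((D.mem_iff _).2 ⟨x, hx, h⟩).2
  have hlam := ((D.mem_iff _).2 ⟨y, hy, h'⟩).1
  have hex : ∀ a b, r ≤ a → c ≤ b → a ≤ r' → b ≤ c' → ∃ z ∈ D.dominoes, (a, b) ∈ z.1.cells :=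
    fun a b h1 h2 h3 h4 => (D.mem_iff _).1
      ⟨lam.up_left_mem h3 h4 hlam, fun h5 => hmu (mu.up_left_mem h1 h2 h5)⟩
  have h1 : ∀ b, c ≤ b → b ≤ c' → ∀ z ∈ D.dominoes, (r, b) ∈ z.1.cells → x.2 ≤ z.2 := by
    intro b hb
    induction b, hb using Nat.le_induction with
    | base => intro _ z hz hm; rw [D.eq_of_mem hx hz h hm]
    | succ b hb ih =>
      intro hb' z hz hm
      obtain ⟨u, hu, hu'⟩ := hex r b le_rfl hb hr (by omega)
      exact (ih (by omega) u hu hu').trans (D.row_weak u hu z hz r b hu' hm)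
  have h2 : ∀ a, r ≤ a → a ≤ r' → ∀ z ∈ D.dominoes, (a, c') ∈ z.1.cells → x.2 ≤ z.2 := by
    intro a ha
    induction a, ha using Nat.le_induction with
    | base => exact fun _ z hz hm => h1 c' hc le_rfl z hz hm
    | succ a ha ih =>
      intro ha' z hz hm
      obtain ⟨u, hu, hu'⟩ := hex a c' ha hc (by omega) le_rfl
      refine (ih (by omega) u hu hu').trans ?_
      by_cases huz : u = z
      · rw [huz]
      · exact (D.col_strict u hu z hz huz a c' hu' hm).le
  exact h2 r' hr le_rfl y hy h'

/-- The partition formed by the inner shape and the dominoes with entries less than `p`. -/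
def below (p : ℕ) : YoungDiagram where
  cells := mu.cells ∪ (D.dominoes.filter fun x => x.2 < p).biUnion fun x => x.1.cells
  isLowerSet := by
    rintro ⟨r, c⟩ ⟨r', c'⟩ ⟨hr, hc⟩ h
    simp only [Finset.coe_union, Finset.coe_biUnion, Finset.coe_filter, Set.mem_union,
      Set.mem_iUnion, Finset.mem_coe, YoungDiagram.mem_cells, Set.mem_ofPred_eq] at h ⊢
    by_cases hin : (r', c') ∈ mu
    · exact Or.inl hin
    · right
      rcases h with h1 | ⟨y, ⟨hy, hyp⟩, hm⟩
      · exact absurd (mu.up_left_mem hr hc h1) hin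
      · obtain ⟨x, hx, hxm⟩ := (D.mem_iff (r', c')).1
          ⟨lam.up_left_mem hr hc ((D.mem_iff _).2 ⟨y, hy, hm⟩).1, hin⟩
        exact ⟨x, ⟨hx, (D.entry_le hx hy hxm hm hr hc).trans_lt hyp⟩, hxm⟩

theorem mem_below (p : ℕ) (s : ℕ × ℕ) :
    s ∈ D.below p ↔ s ∈ mu ∨ ∃ x ∈ D.dominoes, x.2 < p ∧ s ∈ x.1.cells := by
  rw [← YoungDiagram.mem_cells]
  simp [below, and_assoc]

theorem mem_below_iff_lt {x : Domino × ℕ} (hx : x ∈ D.dominoes) {s : ℕ × ℕ} (hs : s ∈ x.1.cells)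
    (p : ℕ) : s ∈ D.below p ↔ x.2 < p := by
  rw [mem_below]
  constructor
  · rintro (h | ⟨y, hy, h1, h2⟩)
    · exact absurd h ((D.mem_iff s).2 ⟨x, hx, hs⟩).2
    · rwa [D.eq_of_mem hx hy hs h2]
  · exact fun h => Or.inr ⟨x, hx, h, hs⟩

/-- The row lengths of the partition formed by the entries less than `p`. -/
def rows (p : ℕ) : ℕ → ℕ := (D.below p).rowLen

theorem rows_anti (p r : ℕ) : D.rows p (r + 1) ≤ D.rows p r :=
  (D.below p).rowLen_anti _ _ (by omega)

theorem rows_zero : D.below 0 = mu := by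
  refine YoungDiagram.ext ?_
  simp [below]

theorem below_mono {p q : ℕ} (h : p ≤ q) : D.below p ≤ D.below q := by
  intro s hs
  have h1 : s ∈ D.below p := hs
  show s ∈ D.below q
  rw [mem_below] at *
  rcases h1 with h1 | ⟨x, hx, h1, h2⟩
  · exact Or.inl h1
  · exact Or.inr ⟨x, hx, by omega, h2⟩

theorem rows_mono {p q : ℕ} (h : p ≤ q) (r : ℕ) : D.rows p r ≤ D.rows q r :=
  YoungDiagram.le_iff_rowLen.1 (D.below_mono h) r

theorem exists_bound : ∃ N, (∀ x ∈ D.dominoes, x.2 < N) ∧ ∀ p, N ≤ p → D.below p = lam := by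
  obtain ⟨N, hN⟩ : ∃ N, ∀ x ∈ D.dominoes, x.2 < N :=
    ⟨D.dominoes.sup Prod.snd + 1, fun x hx => Nat.lt_succ_of_le (Finset.le_sup (f := Prod.snd) hx)⟩
  refine ⟨N, hN, fun p hp => YoungDiagram.ext ?_⟩
  ext s
  rw [YoungDiagram.mem_cells, YoungDiagram.mem_cells, mem_below]
  constructor
  · rintro (h | ⟨x, hx, -, h⟩)
    · exact D.le h
    · exact ((D.mem_iff s).2 ⟨x, hx, h⟩).1
  · intro h
    by_cases hmu : s ∈ mu
    · exact Or.inl hmu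
    · obtain ⟨x, hx, h1⟩ := (D.mem_iff s).1 ⟨h, hmu⟩
      exact Or.inr ⟨x, hx, (hN x hx).trans_le hp, h1⟩

theorem exists_mem_of_rows {p r c : ℕ} (h1 : D.rows p r ≤ c) (h2 : c < D.rows (p + 1) r) :
    ∃ d, (d, p) ∈ D.dominoes ∧ (r, c) ∈ d.cells := by
  have h3 : (r, c) ∈ D.below (p + 1) := YoungDiagram.mem_iff_lt_rowLen.2 h2
  have h4 : (r, c) ∉ D.below p := by
    rw [YoungDiagram.mem_iff_lt_rowLen]; exact not_lt.2 h1
  rw [mem_below] at h3 h4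
  rcases h3 with h3 | ⟨⟨d, k⟩, hx, h5, h6⟩
  · exact absurd (Or.inl h3) h4
  · have : ¬ k < p := fun h7 => h4 (Or.inr ⟨_, hx, h7, h6⟩)
    simp only [] at h5
    obtain rfl : k = p := by omega
    exact ⟨d, hx, h6⟩

theorem rows_of_mem {d : Domino} {p r c : ℕ} (hd : (d, p) ∈ D.dominoes) (h : (r, c) ∈ d.cells) :
    D.rows p r ≤ c ∧ c < D.rows (p + 1) r := by
  have h1 := D.mem_below_iff_lt hd h p
  have h2 := D.mem_below_iff_lt hd h (p + 1)
  rw [YoungDiagram.mem_iff_lt_rowLen] at h1 h2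
  simp only [lt_irrefl, iff_false, not_lt] at h1
  exact ⟨h1, h2.2 (Nat.lt_succ_self p)⟩

theorem vert_mem {p r c : ℕ} (h1 : D.rows p r ≤ c) (h2 : c < D.rows (p + 1) (r + 1)) :
    (Domino.vert r c, p) ∈ D.dominoes := by
  obtain ⟨d, hd, hm⟩ := D.exists_mem_of_rows h1 (h2.trans_le (D.rows_anti _ _))
  obtain ⟨d', hd', hm'⟩ := D.exists_mem_of_rows ((D.rows_anti p r).trans h1) h2
  have heq : d = d' := by
    by_contra hne
    exact lt_irrefl p (D.col_strict _ hd _ hd' (fun h => hne (congrArg Prod.fst h)) r c hm hm')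
  subst heq
  rcases d.eq_vert_or_eq_horiz with ⟨q, k, rfl⟩ | ⟨q, k, rfl⟩
  · simp only [Domino.mem_vert, Prod.mk.injEq] at hm hm'
    obtain ⟨rfl, rfl⟩ : q = r ∧ k = c := by omega
    exact hd
  · simp only [Domino.mem_horiz, Prod.mk.injEq] at hm hm'
    omega

theorem rows_strip (p r : ℕ) : D.rows (p + 1) (r + 2) ≤ D.rows p r := by
  by_contra hlt
  have h1 := D.rows_anti p r
  have h2 : D.rows (p + 1) (r + 2) ≤ D.rows (p + 1) (r + 1) := D.rows_anti (p + 1) (r + 1)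
  have h3 := D.vert_mem (p := p) (r := r) (c := D.rows p r) le_rfl (by omega)
  have h4 := D.vert_mem (p := p) (r := r + 1) (c := D.rows p r) h1
    (by simp only [add_assoc, Nat.reduceAdd]; omega)
  have h5 := D.eq_of_mem h3 h4 (s := (r + 1, D.rows p r)) (by simp [Domino.mem_vert])
    (by simp [Domino.mem_vert])
  rw [Prod.mk.injEq, Domino.vert_inj] at h5
  omega

theorem horiz_bounds {p r c : ℕ} (h : (Domino.horiz r c, p) ∈ D.dominoes) :
    D.rows p r ≤ c ∧ D.rows (p + 1) (r + 1) ≤ c ∧ c + 1 < D.rows (p + 1) r ∧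
      (r = 0 ∨ c + 1 < D.rows p (r - 1)) := by
  have h1 := D.rows_of_mem h (r := r) (c := c) (by simp [Domino.mem_horiz])
  have h2 := D.rows_of_mem h (r := r) (c := c + 1) (by simp [Domino.mem_horiz])
  refine ⟨h1.1, ?_, h2.2, ?_⟩
  · by_contra hlt
    have h5 := D.eq_of_mem (D.vert_mem h1.1 (by omega)) h (s := (r, c)) (by simp [Domino.mem_vert])
      (by simp [Domino.mem_horiz])
    exact Domino.vert_ne_horiz (congrArg Prod.fst h5)
  · by_contra hlt
    obtain ⟨q, rfl⟩ : ∃ q, r = q + 1 := ⟨r - 1, by omega⟩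
    simp only [Nat.add_sub_cancel] at hlt
    have h5 := D.eq_of_mem (D.vert_mem (r := q) (c := c + 1) (p := p) (by omega) h2.2) h
      (s := (q + 1, c + 1)) (by simp [Domino.mem_vert]) (by simp [Domino.mem_horiz])
    exact Domino.vert_ne_horiz (congrArg Prod.fst h5)

/-- The squares of a row that do not belong to vertical dominoes are paired from left to right. -/
theorem horiz_mem_iff {p r c : ℕ} (hm : max (D.rows p r) (D.rows (p + 1) (r + 1)) ≤ c)
    (hc : c < D.rows (p + 1) r) (hc' : r = 0 ∨ c < D.rows p (r - 1)) :
    (Domino.horiz r c, p) ∈ D.dominoes ↔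
      (c - max (D.rows p r) (D.rows (p + 1) (r + 1))) % 2 = 0 := by
  -- a square that is alone in its column belongs to a horizontal domino
  have hor : ∀ c, max (D.rows p r) (D.rows (p + 1) (r + 1)) ≤ c → c < D.rows (p + 1) r →
      (r = 0 ∨ c < D.rows p (r - 1)) → (Domino.horiz r c, p) ∈ D.dominoes ∨
        ∃ k, k + 1 = c ∧ (Domino.horiz r k, p) ∈ D.dominoes := by
    intro c hm hc hc'
    obtain ⟨d, hd, hmem⟩ := D.exists_mem_of_rows (p := p) (r := r) (c := c) (by omega) hc
    rcases d.eq_vert_or_eq_horiz with ⟨q, k, rfl⟩ | ⟨q, k, rfl⟩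
    · exfalso
      have h1 := D.rows_of_mem hd (r := q) (c := k) (by simp [Domino.mem_vert])
      have h2 := D.rows_of_mem hd (r := q + 1) (c := k) (by simp [Domino.mem_vert])
      simp only [Domino.mem_vert, Prod.mk.injEq] at hmem
      rcases hmem with ⟨rfl, rfl⟩ | ⟨rfl, rfl⟩
      · omega
      · simp only [Nat.add_sub_cancel] at hc'; omega
    · simp only [Domino.mem_horiz, Prod.mk.injEq] at hmem
      rcases hmem with ⟨rfl, rfl⟩ | ⟨rfl, rfl⟩
      · exact Or.inl hd
      · exact Or.inr ⟨k, rfl, hd⟩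
  induction c, hm using Nat.le_induction with
  | base =>
    simp only [Nat.sub_self, Nat.zero_mod, iff_true]
    rcases hor _ le_rfl hc hc' with h | ⟨k, hk, h⟩
    · exact h
    · have := D.horiz_bounds h
      omega
  | succ c hm ih =>
    have ih := ih (by omega) (by omega)
    have h1 := hor (c + 1) (by omega) hc hc'
    by_cases h2 : (Domino.horiz r c, p) ∈ D.dominoes
    · have h3 := ih.1 h2
      refine ⟨fun h4 => ?_, fun h4 => by omega⟩
      have h5 := D.eq_of_mem h2 h4 (s := (r, c + 1)) (by simp [Domino.mem_horiz])
        (by simp [Domino.mem_horiz])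
      rw [Prod.mk.injEq, Domino.horiz_inj] at h5
      omega
    · have h3 := ih.not.1 h2
      refine ⟨fun _ => by omega, fun _ => ?_⟩
      rcases h1 with h1 | ⟨k, hk, h1⟩
      · exact h1
      · obtain rfl : k = c := by omega
        exact absurd h1 h2

theorem isDominoStrip (p : ℕ) : IsDominoStrip (D.rows p) (D.rows (p + 1)) := by
  refine ⟨D.rows_anti p, D.rows_anti (p + 1), D.rows_mono (by omega), D.rows_strip p, fun r => ?_⟩
  have h1 := D.rows_mono (by omega : p ≤ p + 1) r
  have h2 := D.rows_anti (p + 1) r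
  have h3 : r ≠ 0 → D.rows (p + 1) (r + 1) ≤ D.rows p (r - 1) ∧ D.rows p r ≤ D.rows p (r - 1) :=
    fun h0 => by
      obtain ⟨q, rfl⟩ := Nat.exists_eq_succ_of_ne_zero h0
      exact ⟨D.rows_strip p q, D.rows_anti p q⟩
  by_contra hodd
  unfold overlap at hodd
  -- the last square that is alone in its column would be the left half of a domino
  have key : ∃ c, max (D.rows p r) (D.rows (p + 1) (r + 1)) ≤ c ∧ c < D.rows (p + 1) r ∧
      (r = 0 ∨ c < D.rows p (r - 1)) ∧
      (c + 1 = D.rows (p + 1) r ∨ (r ≠ 0 ∧ c + 1 = D.rows p (r - 1))) ∧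
      (c - max (D.rows p r) (D.rows (p + 1) (r + 1))) % 2 = 0 := by
    by_cases h0 : r = 0
    · rw [if_pos h0] at hodd
      exact ⟨D.rows (p + 1) r - 1, by omega, by omega, by omega, by omega, by omega⟩
    · rw [if_neg h0] at hodd
      exact ⟨min (D.rows (p + 1) r) (D.rows p (r - 1)) - 1, by omega, by omega, by omega, by omega,
        by omega⟩
  obtain ⟨c, h4, h5, h6, h7, h8⟩ := key
  have := D.horiz_bounds ((D.horiz_mem_iff h4 h5 h6).2 h8)
  omega

theorem mem_dominoes_iff (d : Domino) (p : ℕ) :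
    (d, p) ∈ D.dominoes ↔ IsTile (D.rows p) (D.rows (p + 1)) d := by
  rcases d.eq_vert_or_eq_horiz with ⟨r, c, rfl⟩ | ⟨r, c, rfl⟩
  · rw [isTile_vert]
    refine ⟨fun h => ⟨?_, ?_⟩, fun h => D.vert_mem h.1 h.2⟩
    · exact (D.rows_of_mem h (r := r) (by simp [Domino.mem_vert])).1
    · exact (D.rows_of_mem h (r := r + 1) (by simp [Domino.mem_vert])).2
  · rw [isTile_horiz]
    constructor
    · intro h
      obtain ⟨h1, h2, h3, h4⟩ := D.horiz_bounds h
      exact ⟨h1, h2, h3, h4, (D.horiz_mem_iff (by omega) (by omega) (by omega)).1 h⟩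
    · rintro ⟨h1, h2, h3, h4, h5⟩
      exact (D.horiz_mem_iff (by omega) (by omega) (by omega)).2 h5

end DominoTableau

/-! ### Domino tableaux from chains of partitions -/

/-- A chain of partitions, presented by row lengths, that differ by horizontal strips of dominoes,
is the chain of a domino tableau. -/
theorem exists_dominoTableau {lam mu : YoungDiagram} {g : ℕ → ℕ → ℕ} {N : ℕ}
    (h0 : g 0 = mu.rowLen) (hN : ∀ p, N ≤ p → g p = lam.rowLen)
    (hg : ∀ p, IsDominoStrip (g p) (g (p + 1))) :
    ∃ D : DominoTableau lam mu, ∀ p, D.rows p = g p := by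
  classical
  have hmono : ∀ r, Monotone fun p => g p r := fun r =>
    monotone_nat_of_le_succ fun p => (hg p).le r
  have hlam : ∀ p r, g p r ≤ lam.rowLen r := fun p r => by
    rw [← hN (max p N) (le_max_right _ _)]
    exact hmono r (le_max_left _ _)
  have hfin : {x : Domino × ℕ | IsTile (g x.2) (g (x.2 + 1)) x.1}.Finite := by
    refine Set.Finite.subset (((lam.cells ×ˢ Finset.range N) ×ˢ (Finset.univ : Finset Bool)).image
      fun y => ((⟨y.1.1.1, y.1.1.2, y.2⟩ : Domino), y.1.2)).finite_toSet ?_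
    rintro ⟨d, p⟩ hd
    have hd : IsTile (g p) (g (p + 1)) d := hd
    have h1 := hd.mem (hg p) (r := d.row) (c := d.col) (by simp [Domino.cells])
    have hp : p < N := by
      by_contra hp
      rw [hN p (by omega), hN (p + 1) (by omega)] at h1
      omega
    simp only [Finset.coe_image, Set.mem_image, Finset.mem_coe, Finset.mem_product,
      Finset.mem_range, Finset.mem_univ, and_true, YoungDiagram.mem_cells]
    refine ⟨(((d.row, d.col), p), d.vertical), ⟨?_, hp⟩, rfl⟩
    rw [YoungDiagram.mem_iff_lt_rowLen]
    exact h1.2.trans_le (hlam _ _)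
  set S := hfin.toFinset with hS
  have hmem : ∀ d p, (d, p) ∈ S ↔ IsTile (g p) (g (p + 1)) d := fun d p => by
    rw [hS, Set.Finite.mem_toFinset]; rfl
  have hletter : ∀ {p q r c}, c < g (p + 1) r → g q r ≤ c → q ≤ p := by
    intro p q r c h1 h2
    by_contra hlt
    have := hmono r (by omega : p + 1 ≤ q)
    simp only [] at this
    omega
  have huniq : ∀ x ∈ S, ∀ y ∈ S, ∀ s, s ∈ x.1.cells → s ∈ y.1.cells → x = y := by
    rintro ⟨d, p⟩ hx ⟨d', q⟩ hy ⟨r, c⟩ hs hs'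
    rw [hmem] at hx hy
    have h1 := hx.mem (hg p) hs
    have h2 := hy.mem (hg q) hs'
    obtain rfl : p = q := le_antisymm (hletter h2.2 h1.1) (hletter h1.2 h2.1)
    rw [hx.unique (hg p) hy hs hs']
  have hcov : ∀ p r c, mu.rowLen r ≤ c → c < g p r →
      ∃ x ∈ S, x.2 < p ∧ (r, c) ∈ x.1.cells := by
    intro p r c h1 h2
    induction p with
    | zero => rw [h0] at h2; omega
    | succ p ih =>
      by_cases h3 : c < g p r
      · obtain ⟨x, hx, h4, h5⟩ := ih h3
        exact ⟨x, hx, by omega, h5⟩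
      · obtain ⟨d, hd, hm⟩ := (hg p).exists_isTile (by omega) h2
        exact ⟨(d, p), (hmem _ _).2 hd, Nat.lt_succ_self p, hm⟩
  let D : DominoTableau lam mu :=
    { dominoes := S
      le := YoungDiagram.le_iff_rowLen.2 fun r => by rw [← h0]; exact hlam 0 r
      disjoint := fun x hx y hy hne => Finset.disjoint_left.2 fun s hs hs' =>
        hne (huniq x hx y hy s hs hs')
      cover := by
        ext ⟨r, c⟩
        simp only [Finset.mem_biUnion, Finset.mem_sdiff, YoungDiagram.mem_cells,
          YoungDiagram.mem_iff_lt_rowLen, not_lt]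
        constructor
        · rintro ⟨⟨d, p⟩, hx, hm⟩
          rw [hmem] at hx
          have h1 := hx.mem (hg p) hm
          refine ⟨h1.2.trans_le (hlam _ _), le_trans ?_ h1.1⟩
          rw [← h0]
          exact hmono r (Nat.zero_le p)
        · rintro ⟨h1, h2⟩
          rw [← hN N le_rfl] at h1
          obtain ⟨x, hx, -, hm⟩ := hcov N r c h2 h1
          exact ⟨x, hx, hm⟩
      row_weak := by
        rintro ⟨d, p⟩ hx ⟨d', q⟩ hy r c hm hm'
        rw [hmem] at hx hy
        have h1 := hx.mem (hg p) hm
        have h2 := hy.mem (hg q) hm'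
        exact hletter h2.2 (h1.1.trans (by omega))
      col_strict := by
        rintro ⟨d, p⟩ hx ⟨d', q⟩ hy hne r c hm hm'
        have hx' := hx
        have hy' := hy
        rw [hmem] at hx hy
        have h1 := hx.mem (hg p) hm
        have h2 := hy.mem (hg q) hm'
        have hpq : p ≤ q := hletter h2.2 (((hg p).anti_left r).trans h1.1)
        refine lt_of_le_of_ne hpq ?_
        rintro (rfl : p = q)
        have hv : (Domino.vert r c, p) ∈ S := (hmem _ _).2 (isTile_vert.2 ⟨h1.1, h2.2⟩)
        exact hne ((huniq _ hx' _ hv (r, c) hm (by simp [Domino.mem_vert])).trans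
          (huniq _ hv _ hy' (r + 1, c) (by simp [Domino.mem_vert]) hm')) }
  refine ⟨D, fun p => funext fun r => ?_⟩
  have key : ∀ c, c < D.rows p r ↔ c < g p r := by
    intro c
    have : c < D.rows p r ↔ (r, c) ∈ D.below p := YoungDiagram.mem_iff_lt_rowLen.symm
    rw [this, D.mem_below, YoungDiagram.mem_iff_lt_rowLen]
    constructor
    · rintro (h1 | ⟨⟨d, q⟩, hx, h1, h2⟩)
      · rw [← h0] at h1
        exact h1.trans_le (hmono r (Nat.zero_le p))
      · have h3 := (((hmem _ _).1 hx).mem (hg q) h2).2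
        exact h3.trans_le (hmono r h1)
    · intro h1
      by_cases h2 : c < mu.rowLen r
      · exact Or.inl h2
      · exact Or.inr (hcov p r c (by omega) h1)
  have h1 := key (D.rows p r)
  have h2 := key (g p r)
  omega

/-! ### Standardisation of domino tableaux -/

theorem Domino.lastCol_vert {r c : ℕ} : (Domino.vert r c).lastCol = c := rfl

theorem Domino.lastCol_horiz {r c : ℕ} : (Domino.horiz r c).lastCol = c + 1 := rfl

theorem Domino.lastRow_vert {r c : ℕ} : (Domino.vert r c).lastRow = r + 1 := rfl

theorem Domino.lastRow_horiz {r c : ℕ} : (Domino.horiz r c).lastRow = r := rfl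

theorem Domino.row_vert {r c : ℕ} : (Domino.vert r c).row = r := rfl

theorem Domino.row_horiz {r c : ℕ} : (Domino.horiz r c).row = r := rfl

theorem Domino.col_vert {r c : ℕ} : (Domino.vert r c).col = c := rfl

theorem Domino.col_horiz {r c : ℕ} : (Domino.horiz r c).col = c := rfl

theorem Domino.pos_vert {r c : ℕ} : (Domino.vert r c).pos = (c : ℤ) - r := rfl

theorem Domino.pos_horiz {r c : ℕ} : (Domino.horiz r c).pos = (c : ℤ) + 1 - r := by
  simp [Domino.pos, Domino.horiz, Domino.lastCol]

/-- In a horizontal strip of dominoes, the dominoes of a lower row lie further left. -/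
theorem IsTile.lastCol_lt_col {a b : ℕ → ℕ} (h : IsDominoStrip a b) {d d' : Domino}
    (hd : IsTile a b d) (hd' : IsTile a b d') (hlt : d.row < d'.row) : d'.lastCol < d.col := by
  have ha : Antitone a := antitone_nat_of_succ_le h.anti_left
  have hb : Antitone b := antitone_nat_of_succ_le h.anti_right
  have main : ∀ r r', r < r' → (b (r' + 1) ≤ a r ∧ a (r' - 1) ≤ a r ∧ b (r' + 1) ≤ b (r + 1)) :=
    fun r r' hlt => ⟨(hb (by omega : r + 2 ≤ r' + 1)).trans (h.strip r),
      ha (by omega : r ≤ r' - 1), hb (by omega)⟩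
  rcases d.eq_vert_or_eq_horiz with ⟨r, c, rfl⟩ | ⟨r, c, rfl⟩ <;>
  rcases d'.eq_vert_or_eq_horiz with ⟨r', c', rfl⟩ | ⟨r', c', rfl⟩ <;>
  simp only [isTile_vert, isTile_horiz, Domino.row_vert, Domino.row_horiz, Domino.lastCol_vert,
    Domino.lastCol_horiz, Domino.col_vert, Domino.col_horiz] at * <;>
  have := main r r' hlt <;> omega

theorem Domino.lt_lastCol_add (d : Domino) : d.col ≤ d.lastCol := by
  unfold Domino.lastCol; split <;> omega

theorem IsTile.pos_lt_of_row_lt {a b : ℕ → ℕ} (h : IsDominoStrip a b) {d d' : Domino}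
    (hd : IsTile a b d) (hd' : IsTile a b d') (hlt : d.row < d'.row) : d'.pos < d.pos := by
  have h1 := hd.lastCol_lt_col h hd' hlt
  have h2 := d.lt_lastCol_add
  unfold Domino.pos
  omega

theorem IsTile.pos_ne {a b : ℕ → ℕ} (h : IsDominoStrip a b) {d d' : Domino}
    (hd : IsTile a b d) (hd' : IsTile a b d') (hne : d ≠ d') : d.pos ≠ d'.pos := by
  rcases lt_trichotomy d.row d'.row with h1 | h1 | h1
  · exact (hd.pos_lt_of_row_lt h hd' h1).ne'
  · rcases d.eq_vert_or_eq_horiz with ⟨r, c, rfl⟩ | ⟨r, c, rfl⟩ <;>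
    rcases d'.eq_vert_or_eq_horiz with ⟨r', c', rfl⟩ | ⟨r', c', rfl⟩ <;>
    simp only [isTile_vert, isTile_horiz, Domino.row_vert, Domino.row_horiz, Domino.pos_vert,
      Domino.pos_horiz, ne_eq, Domino.vert_inj, Domino.horiz_inj] at * <;>
    subst h1 <;> omega
  · exact (hd'.pos_lt_of_row_lt h hd h1).ne

theorem IsTile.eq_or_pos_lt {a b : ℕ → ℕ} (h : IsDominoStrip a b) {d d' : Domino}
    (hd : IsTile a b d) (hd' : IsTile a b d') {r c r' c' : ℕ} (hm : (r, c) ∈ d.cells)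
    (hm' : (r', c') ∈ d'.cells) (hr : r' ≤ r) (hc : c' ≤ c) : d' = d ∨ d'.pos < d.pos := by
  rcases lt_trichotomy d.row d'.row with h1 | h1 | h1
  · exact Or.inr (hd.pos_lt_of_row_lt h hd' h1)
  · rcases d.eq_vert_or_eq_horiz with ⟨q, k, rfl⟩ | ⟨q, k, rfl⟩ <;>
    rcases d'.eq_vert_or_eq_horiz with ⟨q', k', rfl⟩ | ⟨q', k', rfl⟩ <;>
    simp only [isTile_vert, isTile_horiz, Domino.row_vert, Domino.row_horiz, Domino.pos_vert,
      Domino.pos_horiz, Domino.vert_inj, Domino.horiz_inj, Domino.mem_vert,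
      Domino.mem_horiz, Prod.mk.injEq] at * <;>
    subst h1 <;> omega
  · exfalso
    have h2 := hd'.lastCol_lt_col h hd h1
    rcases d.eq_vert_or_eq_horiz with ⟨q, k, rfl⟩ | ⟨q, k, rfl⟩ <;>
    rcases d'.eq_vert_or_eq_horiz with ⟨q', k', rfl⟩ | ⟨q', k', rfl⟩ <;>
    simp only [Domino.lastCol_vert, Domino.lastCol_horiz, Domino.col_vert, Domino.col_horiz,
      Domino.mem_vert, Domino.mem_horiz, Prod.mk.injEq] at * <;> omega

/-- The order of the dominoes in the standardisation: by entries, and from left to right among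
equal entries. -/
def dominoOrder (x y : Domino × ℕ) : Prop := x.2 < y.2 ∨ (x.2 = y.2 ∧ x.1.pos < y.1.pos)

namespace DominoTableau

variable {lam mu : YoungDiagram} (D : DominoTableau lam mu)

theorem isReadingOrder_dominoOrder : IsReadingOrder D.dominoes dominoOrder where
  irrefl x _ h := by unfold dominoOrder at h; omega
  trans x _ y _ z _ h h' := by unfold dominoOrder at *; omega
  total := by
    rintro ⟨d, p⟩ hx ⟨d', q⟩ hy
    unfold dominoOrder
    simp only [Prod.mk.injEq]
    rcases lt_trichotomy p q with h | rfl | h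
    · exact Or.inr (Or.inl (Or.inl h))
    · rw [D.mem_dominoes_iff] at hx hy
      by_cases hd : d = d'
      · exact Or.inl ⟨hd, rfl⟩
      · have := hx.pos_ne (D.isDominoStrip p) hy hd
        omega
    · exact Or.inr (Or.inr (Or.inl h))

theorem exists_isStandardisation : ∃ n c w, D.IsStandardisation n c w := by
  classical
  have hord := D.isReadingOrder_dominoOrder
  set rk := placeRank D.dominoes dominoOrder with hrk
  set n := D.dominoes.card with hn
  have hlt : ∀ x ∈ D.dominoes, rk x < n := fun x hx =>
    Finset.card_lt_card (Finset.filter_ssubset.2 ⟨x, hx, hord.irrefl x hx⟩)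
  have hsurj : ∀ k < n, ∃ x ∈ D.dominoes, rk x = k := by
    intro k hk
    obtain ⟨x, hx, h⟩ := Finset.surj_on_of_inj_on_of_card_le (s := D.dominoes)
      (t := Finset.range n) (fun x _ => rk x) (fun x hx => Finset.mem_range.2 (hlt x hx))
      (fun x y hx hy hxy => by
        rcases hord.total x hx y hy with h | h | h
        · exact h
        · have := hord.placeRank_lt hx hy h
          simp only [hrk] at hxy; omega
        · have := hord.placeRank_lt hy hx h
          simp only [hrk] at hxy; omega)
      (by simp [hn]) k (Finset.mem_range.2 hk)
    exact ⟨x, hx, h.symm⟩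
  have : Nonempty (Domino × ℕ) := ⟨(⟨0, 0, true⟩, 0)⟩
  choose! z hz hzr using hsurj
  have hzrk : ∀ x ∈ D.dominoes, z (rk x) = x := by
    intro x hx
    have h1 := hz _ (hlt x hx)
    have h2 := hzr _ (hlt x hx)
    rcases hord.total _ h1 x hx with h | h | h
    · exact h
    · exact absurd h2 (hord.placeRank_lt h1 hx h).ne
    · exact absurd h2 (hord.placeRank_lt hx h1 h).ne'
  let c : ℕ → YoungDiagram := fun k =>
    { cells := mu.cells ∪ (D.dominoes.filter fun x => rk x < k).biUnion fun x => x.1.cells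
      isLowerSet := by
        rintro ⟨r, q⟩ ⟨r', q'⟩ ⟨hr, hq⟩ h
        simp only [Finset.coe_union, Finset.coe_biUnion, Finset.coe_filter, Set.mem_union,
          Set.mem_iUnion, Finset.mem_coe, YoungDiagram.mem_cells, Set.mem_ofPred_eq] at h ⊢
        by_cases hin : (r', q') ∈ mu
        · exact Or.inl hin
        · right
          rcases h with h1 | ⟨y, ⟨hy, hyp⟩, hm⟩
          · exact absurd (mu.up_left_mem hr hq h1) hin
          · obtain ⟨x, hx, hxm⟩ := (D.mem_iff (r', q')).1
              ⟨lam.up_left_mem hr hq ((D.mem_iff _).2 ⟨y, hy, hm⟩).1, hin⟩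
            refine ⟨x, ⟨hx, ?_⟩, hxm⟩
            have hle := D.entry_le hx hy hxm hm hr hq
            by_cases hxy : x = y
            · rwa [hxy]
            · refine (hord.placeRank_lt hx hy ?_).trans hyp
              rcases x with ⟨d, p⟩
              rcases y with ⟨d', p'⟩
              rcases hle.lt_or_eq with h | h
              · exact Or.inl h
              · refine Or.inr ⟨h, ?_⟩
                simp only [] at h
                subst h
                have hd := (D.mem_dominoes_iff _ _).1 hx
                have hd' := (D.mem_dominoes_iff _ _).1 hy
                exact (hd'.eq_or_pos_lt (D.isDominoStrip p) hd hm hxm hr hq).resolve_left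
                  fun h => hxy (by rw [h]) }
  have hc : ∀ k s, s ∈ (c k).cells ↔ s ∈ mu ∨ ∃ x ∈ D.dominoes, rk x < k ∧ s ∈ x.1.cells := by
    intro k s
    simp [c, and_assoc]
  refine ⟨n, c, fun k => (z k).2, ?_, ?_, fun k => (z k).1, fun k hk => ⟨?_, ?_, hz k hk⟩,
    fun k hk => ?_⟩
  · refine YoungDiagram.ext ?_
    ext s
    simp [hc]
  · refine YoungDiagram.ext ?_
    ext s
    rw [hc, YoungDiagram.mem_cells]
    constructor
    · rintro (h | ⟨x, hx, -, h⟩)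
      · exact D.le h
      · exact ((D.mem_iff s).2 ⟨x, hx, h⟩).1
    · intro h
      by_cases hmu : s ∈ mu
      · exact Or.inl hmu
      · obtain ⟨x, hx, h1⟩ := (D.mem_iff s).1 ⟨h, hmu⟩
        exact Or.inr ⟨x, hx, hlt x hx, h1⟩
  · refine Finset.disjoint_left.2 fun s hs hs' => ?_
    rcases (hc k s).1 hs' with h | ⟨x, hx, h1, h2⟩
    · exact ((D.mem_iff s).2 ⟨_, hz k hk, hs⟩).2 h
    · rw [D.eq_of_mem hx (hz k hk) h2 hs, hzr k hk] at h1
      exact lt_irrefl _ h1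
  · ext s
    show s ∈ (c (k + 1)).cells ↔ s ∈ (z k).1.cells ∪ (c k).cells
    rw [hc, Finset.mem_union, hc]
    constructor
    · rintro (h | ⟨x, hx, h1, h2⟩)
      · exact Or.inr (Or.inl h)
      · rcases Nat.lt_succ_iff_lt_or_eq.1 h1 with h3 | h3
        · exact Or.inr (Or.inr ⟨x, hx, h3, h2⟩)
        · left
          rw [← h3, hzrk x hx]
          exact h2
    · rintro (h | h | ⟨x, hx, h1, h2⟩)
      · exact Or.inr ⟨z k, hz k hk, by rw [hzr k hk]; omega, h⟩
      · exact Or.inl h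
      · exact Or.inr ⟨x, hx, by omega, h2⟩
  · have h1 := (hord.before_iff (hz k (by omega)) (hz (k + 1) hk)).2 (by
      have h1 := hzr k (by omega)
      have h2 := hzr (k + 1) hk
      simp only [hrk] at h1 h2
      omega)
    exact h1

variable {D} {n : ℕ} {c : ℕ → YoungDiagram} {w : ℕ → ℕ}

theorem IsStandardisation.le_succ (h : D.IsStandardisation n c w) (k : ℕ) (hk : k + 1 < n) :
    w k ≤ w (k + 1) := by
  obtain ⟨-, -, d, -, h2⟩ := h
  rcases h2 k hk with h3 | h3 <;> omega

/-- A square of the chain of a standardisation is added in a definite step. -/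
theorem domino_chain_mem_iff {d : ℕ → Domino}
    (hd : ∀ k < n, (c (k + 1)).cells = (d k).cells ∪ (c k).cells) {k : ℕ} (hk : k ≤ n)
    (s : ℕ × ℕ) : s ∈ c k ↔ s ∈ c 0 ∨ ∃ l < k, s ∈ (d l).cells := by
  induction k with
  | zero => simp
  | succ k ih =>
    rw [← YoungDiagram.mem_cells, hd k (by omega), Finset.mem_union, YoungDiagram.mem_cells,
      ih (by omega)]
    constructor
    · rintro (h | h | ⟨l, hl, h⟩)
      · exact Or.inr ⟨k, by omega, h⟩
      · exact Or.inl h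
      · exact Or.inr ⟨l, by omega, h⟩
    · rintro (h | ⟨l, hl, h⟩)
      · exact Or.inr (Or.inl h)
      · rcases Nat.lt_succ_iff_lt_or_eq.1 hl with h1 | rfl
        · exact Or.inr (Or.inr ⟨l, h1, h⟩)
        · exact Or.inl h

theorem IsStandardisation.exists_index (h : D.IsStandardisation n c w) : ∃ d : ℕ → Domino,
    (∀ k < n, Disjoint (d k).cells (c k).cells ∧ (c (k + 1)).cells = (d k).cells ∪ (c k).cells ∧
      (d k, w k) ∈ D.dominoes) ∧
    (∀ k, k + 1 < n → w k < w (k + 1) ∨ (w k = w (k + 1) ∧ (d k).pos < (d (k + 1)).pos)) ∧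
    (∀ x ∈ D.dominoes, ∃ k < n, x = (d k, w k)) ∧ ∀ k < n, ∀ l < n, d k = d l → k = l := by
  obtain ⟨h0, hn, d, h1, h2⟩ := h
  have hmem := fun k (hk : k ≤ n) => domino_chain_mem_iff (fun k hk => (h1 k hk).2.1) hk
  have hcell : ∀ d : Domino, (d.row, d.col) ∈ d.cells := fun d => by simp [Domino.cells]
  refine ⟨d, h1, h2, fun x hx => ?_, ?_⟩
  · have h3 := (D.mem_iff _).2 ⟨x, hx, hcell x.1⟩
    rw [← hn, hmem n le_rfl, h0] at h3
    obtain ⟨k, hk, h4⟩ := h3.1.resolve_left h3.2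
    exact ⟨k, hk, D.eq_of_mem hx (h1 k hk).2.2 (hcell _) h4⟩
  · have : ∀ k < n, ∀ l < k, d l ≠ d k := fun k hk l hl he =>
      Finset.disjoint_left.1 (h1 k hk).1 (hcell _)
        ((hmem k hk.le _).2 (Or.inr ⟨l, hl, by rw [he]; exact hcell _⟩))
    intro k hk l hl he
    rcases lt_trichotomy k l with h3 | h3 | h3
    · exact absurd he (this l hl k h3)
    · exact h3
    · exact absurd he.symm (this k hk l h3)

theorem IsStandardisation.below_eq (h : D.IsStandardisation n c w) (p : ℕ) :
    D.below p = c (countBelow n w p) := by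
  have hle := h.le_succ
  obtain ⟨d, h1, -, h2, -⟩ := h.exists_index
  have hmem := fun k (hk : k ≤ n) => domino_chain_mem_iff (fun k hk => (h1 k hk).2.1) hk
  refine YoungDiagram.ext ?_
  ext s
  rw [YoungDiagram.mem_cells, YoungDiagram.mem_cells, mem_below, hmem _ (countBelow_le n w p), h.1]
  constructor
  · rintro (h3 | ⟨x, hx, h3, h4⟩)
    · exact Or.inl h3
    · obtain ⟨k, hk, rfl⟩ := h2 x hx
      exact Or.inr ⟨k, (lt_iff_lt_countBelow hle hk p).1 h3, h4⟩
  · rintro (h3 | ⟨k, hk, h3⟩)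
    · exact Or.inl h3
    · have hkn := hk.trans_le (countBelow_le n w p)
      exact Or.inr ⟨_, (h1 k hkn).2.2, (lt_iff_lt_countBelow hle hkn p).2 hk, h3⟩

theorem IsStandardisation.weight_eq (h : D.IsStandardisation n c w) (p : ℕ) :
    D.weight p = ((Finset.range n).filter fun l => w l = p).card := by
  obtain ⟨d, h1, -, h2, h3⟩ := h.exists_index
  symm
  refine Finset.card_bij (fun l _ => (d l, w l)) ?_ ?_ ?_
  · intro l hl
    simp only [Finset.mem_filter, Finset.mem_range] at hl ⊢
    exact ⟨(h1 l hl.1).2.2, hl.2⟩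
  · intro l hl l' hl' he
    simp only [Finset.mem_filter, Finset.mem_range, Prod.mk.injEq] at hl hl' he
    exact h3 l hl.1 l' hl'.1 he.1
  · intro x hx
    rw [Finset.mem_filter] at hx
    obtain ⟨l, hl, rfl⟩ := h2 x hx.1
    exact ⟨l, by simpa [hl] using hx.2, rfl⟩

end DominoTableau

/-! ### The self-switching pair of a domino tableau -/

/-- A domino is added in two steps, its upper left square first. -/
theorem exists_addsRow_domino {a b : YoungDiagram} {d : Domino} (h : Disjoint d.cells a.cells)
    (hb : b.cells = d.cells ∪ a.cells) :
    ∃ e, AddsRow d.row a e ∧ AddsRow d.lastRow e b := by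
  obtain ⟨h1, h2⟩ : (d.row, d.col) ≠ (d.lastRow, d.lastCol) ∧
      ¬ (d.lastRow, d.lastCol) ≤ (d.row, d.col) := by
    rcases d.eq_vert_or_eq_horiz with ⟨r, c, rfl⟩ | ⟨r, c, rfl⟩ <;>
    simp [Domino.lastRow, Domino.lastCol, Domino.vert, Domino.horiz]
  have hcells : d.cells = {(d.row, d.col), (d.lastRow, d.lastCol)} := rfl
  rw [hcells] at hb h
  simp only [Finset.disjoint_insert_left, Finset.disjoint_singleton_left] at h
  have hmem : ∀ s, s ∈ b.cells ↔ s = (d.row, d.col) ∨ s = (d.lastRow, d.lastCol) ∨ s ∈ a.cells := by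
    intro s; rw [hb]; simp
  have hrow : ∀ {a e : YoungDiagram} {s : ℕ × ℕ}, s ∉ a.cells → e.cells = insert s a.cells →
      AddsRow s.1 a e := by
    intro a e s hs he
    have hA : AddsSquare a e := by
      refine ⟨YoungDiagram.cells_subset_iff.1 (by rw [he]; exact Finset.subset_insert _ _), ?_⟩
      show e.cells.card = _
      rw [he, Finset.card_insert_of_notMem hs]
    obtain ⟨ρ, hρ⟩ := addsSquare_iff.1 hA
    have h5 : s ∈ e.cells := by rw [he]; exact Finset.mem_insert_self _ _
    rw [addsRow_iff_cells.1 hρ, Finset.mem_insert] at h5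
    rw [h5.resolve_right hs]
    exact hρ
  let e : YoungDiagram := ⟨insert (d.row, d.col) a.cells, by
    intro s s' hle hs
    rw [Finset.mem_coe, Finset.mem_insert] at hs ⊢
    have hs' : s' ∈ b.cells := b.isLowerSet hle (by
      rw [Finset.mem_coe, hmem]; tauto)
    rw [hmem] at hs'
    rcases hs' with h3 | h3 | h3
    · exact Or.inl h3
    · rcases hs with h4 | h4
      · rw [h3, h4] at hle; exact absurd hle h2
      · exact Or.inr (a.isLowerSet hle h4)
    · exact Or.inr h3⟩
  refine ⟨e, hrow h.1 rfl, hrow (s := (d.lastRow, d.lastCol)) ?_ ?_⟩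
  · show _ ∉ insert (d.row, d.col) a.cells
    rw [Finset.mem_insert]
    rintro (h3 | h3)
    · exact h1 h3.symm
    · exact h.2 h3
  · ext s
    rw [hmem, Finset.mem_insert]
    show _ ↔ _ ∨ s ∈ insert (d.row, d.col) a.cells
    rw [Finset.mem_insert]
    tauto

/-- The diagonals of the symmetric switching family with given main diagonal `c` and given next
diagonal `e`. -/
noncomputable def switchDiagonal (c e : ℕ → YoungDiagram) : ℕ → ℕ → YoungDiagram
  | 0, i => c i
  | 1, i => e i
  | k + 2, i => switchCorner (switchDiagonal c e (k + 1) i) (switchDiagonal c e k (i + 1))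
      (switchDiagonal c e (k + 1) (i + 1))

theorem switchDiagonal_addsSquare {n : ℕ} {c e : ℕ → YoungDiagram}
    (h : ∀ k < n, AddsSquare (c k) (e k) ∧ AddsSquare (e k) (c (k + 1))) (k : ℕ) :
    ∀ i, i + k < n → AddsSquare (switchDiagonal c e k i) (switchDiagonal c e (k + 1) i) ∧
      AddsSquare (switchDiagonal c e (k + 1) i) (switchDiagonal c e k (i + 1)) := by
  induction k with
  | zero => exact fun i hi => h i hi
  | succ k ih =>
    intro i hi
    have := switchCorner_spec (ih i (by omega)).2 (ih (i + 1) (by omega)).1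
    exact ⟨this.1, this.2.1⟩

/-- The symmetric switching family with given main diagonal `c` and given next diagonal `e`. -/
noncomputable def switchFamily (c e : ℕ → YoungDiagram) (i j : ℕ) : YoungDiagram :=
  if i ≤ j then switchDiagonal c e (j - i) i else switchDiagonal c e (i - j) j

theorem switchFamily_symm (c e : ℕ → YoungDiagram) (i j : ℕ) :
    switchFamily c e i j = switchFamily c e j i := by
  unfold switchFamily
  rcases lt_trichotomy i j with h | rfl | h
  · rw [if_pos h.le, if_neg (by omega)]
  · rfl
  · rw [if_neg (by omega), if_pos h.le]

theorem switchFamily_add (c e : ℕ → YoungDiagram) (i k : ℕ) :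
    switchFamily c e i (i + k) = switchDiagonal c e k i := by
  unfold switchFamily
  rw [if_pos (by omega), Nat.add_sub_cancel_left]

theorem isSwitchingFamily_switchFamily {n : ℕ} {c e : ℕ → YoungDiagram}
    (h : ∀ k < n, AddsSquare (c k) (e k) ∧ AddsSquare (e k) (c (k + 1)))
    (hd : ∀ k < n, ∃ d : Domino, (c (k + 1)).cells \ (c k).cells = d.cells) :
    IsSwitchingFamily n n (switchFamily c e) := by
  have key := switchDiagonal_addsSquare h
  have hor : ∀ i k, i + k < n →
      AddsSquare (switchFamily c e i (i + k)) (switchFamily c e i (i + (k + 1))) := by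
    intro i k hk
    rw [switchFamily_add, switchFamily_add]
    exact (key k i hk).1
  have ver : ∀ i k, i + k < n →
      AddsSquare (switchFamily c e i (i + 1 + k)) (switchFamily c e (i + 1) (i + 1 + k)) := by
    intro i k hk
    rw [switchFamily_add c e (i + 1), add_assoc i, add_comm 1, switchFamily_add]
    exact (key k i hk).2
  have hsw : ∀ i k, i + (k + 1) < n → (switchFamily c e (i + 1) (i + (k + 1)) =
      switchFamily c e i (i + (k + 1) + 1) ↔ ∃ d : Domino,
        (switchFamily c e (i + 1) (i + (k + 1) + 1)).cells \
          (switchFamily c e i (i + (k + 1))).cells = d.cells) := by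
    intro i k hk
    have e1 : switchFamily c e (i + 1) (i + (k + 1)) = switchDiagonal c e k (i + 1) := by
      rw [← switchFamily_add]; congr 1; omega
    have e2 : switchFamily c e (i + 1) (i + (k + 1) + 1) = switchDiagonal c e (k + 1) (i + 1) := by
      rw [← switchFamily_add]; congr 1; omega
    have e3 : switchFamily c e i (i + (k + 1) + 1) = switchDiagonal c e (k + 2) i := by
      rw [← switchFamily_add]; congr 1
    rw [e1, e2, e3, switchFamily_add]
    exact (switchCorner_spec (key k i (by omega)).2 (key k (i + 1) (by omega)).1).2.2
  refine ⟨fun i j hi hj => ?_, fun i j hi hj => ?_, fun i j hi hj => ?_⟩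
  · by_cases hij : i + 1 ≤ j
    · obtain ⟨k, rfl⟩ := Nat.exists_eq_add_of_le hij
      exact ver i k (by omega)
    · obtain ⟨k, rfl⟩ := Nat.exists_eq_add_of_le (by omega : j ≤ i)
      rw [switchFamily_symm, switchFamily_symm c e (j + k + 1)]
      exact hor j k hi
  · by_cases hij : i ≤ j
    · obtain ⟨k, rfl⟩ := Nat.exists_eq_add_of_le hij
      exact hor i k hj
    · obtain ⟨k, rfl⟩ := Nat.exists_eq_add_of_le (by omega : j + 1 ≤ i)
      rw [switchFamily_symm, switchFamily_symm c e _ (j + 1)]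
      exact ver j k (by omega)
  · rcases lt_trichotomy i j with hij | rfl | hij
    · obtain ⟨k, rfl⟩ := Nat.exists_eq_add_of_lt hij
      exact hsw i k hj
    · rw [switchFamily_symm c e i]
      have e1 := switchFamily_add c e i 0
      have e2 := switchFamily_add c e (i + 1) 0
      rw [add_zero] at e1 e2
      rw [e1, e2]
      exact iff_of_true rfl (hd i hi)
    · obtain ⟨k, rfl⟩ := Nat.exists_eq_add_of_lt hij
      rw [switchFamily_symm c e _ j, switchFamily_symm c e _ (j + 1),
        switchFamily_symm c e _ (j + 1), switchFamily_symm c e _ j, eq_comm]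
      exact hsw j k hi

theorem IsAscending.congr {c c' : ℕ → YoungDiagram} {a b : ℕ} (h : IsAscending c a b)
    (hcc : ∀ j, a ≤ j → j ≤ b → c j = c' j) : IsAscending c' a b := by
  obtain ⟨ρ, h1, h2⟩ := h
  exact ⟨ρ, fun j hj hj' => by
    rw [← hcc j hj hj'.le, ← hcc (j + 1) (by omega) hj']; exact h1 j hj hj', h2⟩

theorem DominoTableau.exists_isProjection {lam mu : YoungDiagram} (D : DominoTableau lam mu) :
    ∃ T, IsProjection D T := by
  obtain ⟨n, c, w, hD⟩ := D.exists_isStandardisation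
  obtain ⟨d, h1, h2, -⟩ := hD.exists_index
  have hex : ∀ k, ∃ e, k < n → AddsRow (d k).row (c k) e ∧ AddsRow (d k).lastRow e (c (k + 1)) := by
    intro k
    by_cases hk : k < n
    · obtain ⟨e, he⟩ := exists_addsRow_domino (h1 k hk).1 (h1 k hk).2.1
      exact ⟨e, fun _ => he⟩
    · exact ⟨⊥, fun h => absurd h hk⟩
  choose e he using hex
  have hF := isSwitchingFamily_switchFamily (n := n) (c := c) (e := e)
    (fun k hk => ⟨addsSquare_iff.2 ⟨_, (he k hk).1⟩, addsSquare_iff.2 ⟨_, (he k hk).2⟩⟩)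
    (fun k hk => ⟨d k, by
      rw [(h1 k hk).2.1, Finset.union_sdiff_right]
      exact Finset.sdiff_eq_self_of_disjoint (h1 k hk).1⟩)
  set F := switchFamily c e with hFdef
  have hdiag : ∀ i, F i i = c i := fun i => switchFamily_add c e i 0
  have hnext : ∀ i, F i (i + 1) = e i := fun i => switchFamily_add c e i 1
  have hsymm : ∀ i j, F i j = F j i := switchFamily_symm c e
  have hstd : ∀ i ≤ n, IsStandardChain n (F i) w := by
    intro i hi
    refine ⟨fun k hk => hF.horizontal i k hi hk, fun k hk => ?_⟩
    rcases h2 k hk with h3 | ⟨h3, h4⟩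
    · exact Or.inl h3
    refine Or.inr ⟨h3, ?_⟩
    rw [hF.isAscending_iff hi (by omega : k ≤ n) (by omega), _root_.isAscending_iff]
    refine ⟨fun j _ hj => hF.horizontal k j (by omega) (by omega), fun j hj hj' ρ ρ' hρ hρ' => ?_⟩
    obtain rfl : j = k := by omega
    -- dominoes with equal entries are added upwards
    have hrow : (d (j + 1)).row ≤ (d j).row := by
      by_contra hlt
      have t1 := (D.mem_dominoes_iff _ _).1 (h1 j (by omega)).2.2
      have t2 := (D.mem_dominoes_iff _ _).1 (h1 (j + 1) hk).2.2
      rw [← h3] at t2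
      have := t1.pos_lt_of_row_lt (D.isDominoStrip _) t2 (by omega)
      omega
    have hle : (d j).row ≤ (d j).lastRow := by unfold Domino.lastRow; split <;> omega
    obtain ⟨x, s, t, y, hs⟩ := hF.exists_isSwitchSquare (i := j) (j := j + 1) (by omega) hk
    have e1 : x = (d j).lastRow := by
      have := hs.left
      rw [hnext, hdiag] at this
      exact this.eq_of (he j (by omega)).2
    have e2 : t = (d (j + 1)).row := by
      have := hs.lower
      rw [hnext, hdiag] at this
      exact this.eq_of (he (j + 1) hk).1
    have e3 : s = ρ' := hs.upper.eq_of hρ'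
    have e4 : ρ = (d j).row := by
      rw [hnext, hdiag] at hρ
      exact hρ.eq_of (he j (by omega)).1
    have := hs.rule
    omega
  obtain ⟨U, hU⟩ := (hstd 0 (Nat.zero_le n)).exists_skewTableau
  obtain ⟨V, hV, hUV⟩ := hF.exists_equiv hU le_rfl
  obtain ⟨T, hT⟩ := exists_rectification _ n hU rfl
  refine ⟨T, U, V, ⟨n, F, w, hF, fun i j _ _ => hsymm i j, ?_, ?_, hV⟩, hT, hUV⟩
  · simpa only [hdiag] using hD
  · simpa only [hsymm _ 0] using hU

/-! ### Domino tableaux and Young tableaux related by symmetric families -/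

/-- The chain of partial sums of a domino tableau. -/
def DominoTableau.chain {lam mu : YoungDiagram} (D : DominoTableau lam mu) (p : ℕ) : ℕ → ℤ :=
  psum (D.below p)

/-- The chain of the domino tableau `D` is the diagonal of a symmetric solution of the octahedron
recurrence, whose first row is equivalent to the chain of the Young tableau `T` of the same
weight. -/
def IsOctaProjection {lam mu : YoungDiagram} (D : DominoTableau lam mu) (T : YoungTableau) : Prop :=
  ∃ g : ℕ → ℕ → ℕ → ℤ, IsSymmFamily g ∧ (∀ p, g p p = D.chain p) ∧
    Relation.EqvGen CoSlide T.toSkew.chain (g 0) ∧ ∀ k, D.weight k = T.toSkew.weight k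

theorem IsProjection.isOctaProjection {lam mu : YoungDiagram} {D : DominoTableau lam mu}
    {T : YoungTableau} (h : IsProjection D T) : IsOctaProjection D T := by
  obtain ⟨U, V, ⟨n, F, w, hF, hsymm, hD, hU, -⟩, hTU, -⟩ := h
  have hstd := hU.isStandardChain
  have hcb : ∀ p, countBelow n w p ≤ n := countBelow_le n w
  have hcol : ∀ p, IsAscending (F 0) (countBelow n w p) (countBelow n w (p + 1)) := fun p =>
    (hstd.isAscending p).congr fun j _ hj => hsymm _ _ (hj.trans (hcb _)) (Nat.zero_le n)
  have hrow : ∀ p a, a ≤ n → IsAscending (fun i => F i a) (countBelow n w p)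
      (countBelow n w (p + 1)) := fun p a ha =>
    ((hF.isAscending_iff (Nat.zero_le n) ha (hcb _)).1 (hcol p)).congr fun j _ hj =>
      hsymm _ _ ha (hj.trans (hcb _))
  have hE := hTU.eqvGen
  refine ⟨fun p q => psum (F (countBelow n w p) (countBelow n w q)), ⟨fun p q => ?_, fun p q => ?_⟩,
    fun p => ?_, ?_, fun k => ?_⟩
  · rw [hsymm _ _ (hcb p) (hcb q)]
  · exact (hF.octa (countBelow_mono n w (by omega)) (hcb _) (countBelow_mono n w (by omega)) (hcb _)
      (hcol q) (hrow p _ (hcb q))).symm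
  · rw [DominoTableau.chain, hD.below_eq]
  · convert hE.1 using 1
    funext p
    have h0 : countBelow n w 0 = 0 := by simp [countBelow]
    rw [SkewTableau.chain, hU.below_eq]
    show psum (F (countBelow n w 0) (countBelow n w p)) = _
    rw [h0, hsymm _ _ (Nat.zero_le n) (hcb p)]
  · rw [hE.2 k, hU.weight_eq, hD.weight_eq]

/-! ### The column reading of a domino tableau -/

namespace DominoTableau

variable {lam mu : YoungDiagram} (D : DominoTableau lam mu)

theorem card_filter_vert (p r C : ℕ) :
    (D.dominoes.filter fun x => x.2 = p ∧ x.1.vertical = true ∧ x.1.row = r ∧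
      x.1.lastCol < C).card = min C (D.rows (p + 1) (r + 1)) - D.rows p r := by
  rw [← Nat.card_Ico]
  symm
  refine Finset.card_bij (fun c _ => (Domino.vert r c, p)) ?_ ?_ ?_
  · intro c hc
    rw [Finset.mem_Ico] at hc
    rw [Finset.mem_filter, D.mem_dominoes_iff, isTile_vert]
    exact ⟨⟨hc.1, by omega⟩, rfl, rfl, rfl, by simp only [Domino.lastCol_vert]; omega⟩
  · intro c _ c' _ h
    simp only [Prod.mk.injEq, Domino.vert_inj] at h
    exact h.1.2
  · rintro ⟨d, q⟩ hd
    rw [Finset.mem_filter, D.mem_dominoes_iff] at hd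
    obtain ⟨h1, h2, h3, h4, h5⟩ := hd
    rcases d.eq_vert_or_eq_horiz with ⟨r', c, rfl⟩ | ⟨r', c, rfl⟩
    · simp only [isTile_vert, Domino.row_vert, Domino.lastCol_vert] at *
      subst h2 h4
      exact ⟨c, Finset.mem_Ico.2 ⟨h1.1, by omega⟩, rfl⟩
    · simp [Domino.horiz] at h3

/-- The end of the part of row `r` that consists of horizontal dominoes with entry `p`. -/
def horizEnd (p r : ℕ) : ℕ :=
  if r = 0 then D.rows (p + 1) r else min (D.rows (p + 1) r) (D.rows p (r - 1))

theorem card_filter_horiz (p r C : ℕ) :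
    (D.dominoes.filter fun x => x.2 = p ∧ x.1.vertical = false ∧ x.1.row = r ∧
      x.1.lastCol < C).card =
      (min C (D.horizEnd p r) - max (D.rows p r) (D.rows (p + 1) (r + 1))) / 2 := by
  conv_rhs => rw [← Finset.card_range
    ((min C (D.horizEnd p r) - max (D.rows p r) (D.rows (p + 1) (r + 1))) / 2)]
  have hend : ∀ c, c + 1 < D.horizEnd p r ↔ c + 1 < D.rows (p + 1) r ∧
      (r = 0 ∨ c + 1 < D.rows p (r - 1)) := by
    intro c
    unfold horizEnd
    split_ifs <;> omega
  symm
  refine Finset.card_bij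
    (fun t _ => (Domino.horiz r (max (D.rows p r) (D.rows (p + 1) (r + 1)) + 2 * t), p)) ?_ ?_ ?_
  · intro t ht
    rw [Finset.mem_range] at ht
    rw [Finset.mem_filter, D.mem_dominoes_iff, isTile_horiz]
    have := (hend (max (D.rows p r) (D.rows (p + 1) (r + 1)) + 2 * t)).1 (by omega)
    exact ⟨⟨by omega, by omega, this.1, this.2, by omega⟩, rfl, rfl, rfl,
      by simp only [Domino.lastCol_horiz]; omega⟩
  · intro c _ c' _ h
    simp only [Prod.mk.injEq, Domino.horiz_inj] at h
    omega
  · rintro ⟨d, q⟩ hd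
    rw [Finset.mem_filter, D.mem_dominoes_iff] at hd
    obtain ⟨h1, h2, h3, h4, h5⟩ := hd
    rcases d.eq_vert_or_eq_horiz with ⟨r', c, rfl⟩ | ⟨r', c, rfl⟩
    · simp [Domino.vert] at h3
    · simp only [isTile_horiz, Domino.row_horiz, Domino.lastCol_horiz] at *
      subst h2 h4
      have := (hend c).2 ⟨h1.2.2.1, h1.2.2.2.1⟩
      refine ⟨(c - max (D.rows q r') (D.rows (q + 1) (r' + 1))) / 2, Finset.mem_range.2 (by omega),
        ?_⟩
      rw [Prod.mk.injEq, Domino.horiz_inj]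
      omega

theorem card_filter_row (p r C : ℕ) :
    (D.dominoes.filter fun x => x.2 = p ∧ x.1.row = r ∧ x.1.lastCol < C).card =
      (min C (D.rows (p + 1) (r + 1)) - D.rows p r) +
      (min C (D.horizEnd p r) - max (D.rows p r) (D.rows (p + 1) (r + 1))) / 2 := by
  rw [← D.card_filter_vert, ← D.card_filter_horiz, ← Finset.card_union_of_disjoint]
  · congr 1
    ext ⟨⟨r', c, v⟩, q⟩
    cases v <;> simp
  · rw [Finset.disjoint_filter]
    rintro x - ⟨-, h1, -⟩ ⟨-, h2, -⟩
    simp [h1] at h2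

theorem card_filter_lastRow (p r C : ℕ) :
    (D.dominoes.filter fun x => x.2 = p ∧ x.1.lastRow = r ∧ x.1.lastCol < C).card =
      (if r = 0 then 0 else min C (D.rows (p + 1) r) - D.rows p (r - 1)) +
      (min C (D.horizEnd p r) - max (D.rows p r) (D.rows (p + 1) (r + 1))) / 2 := by
  by_cases hr : r = 0
  · subst hr
    rw [if_pos rfl, zero_add, ← D.card_filter_horiz]
    congr 1
    ext ⟨⟨r', c, v⟩, q⟩
    simp only [Finset.mem_filter]
    cases v <;> simp [Domino.lastRow]
  · obtain ⟨s, rfl⟩ := Nat.exists_eq_succ_of_ne_zero hr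
    rw [if_neg hr, Nat.succ_eq_add_one, Nat.add_sub_cancel, ← D.card_filter_horiz,
      ← D.card_filter_vert, ← Finset.card_union_of_disjoint]
    · congr 1
      ext ⟨⟨r', c, v⟩, q⟩
      simp only [Finset.mem_filter, Finset.mem_union]
      cases v <;> simp [Domino.lastRow]
    · rw [Finset.disjoint_filter]
      rintro x - ⟨-, h1, -⟩ ⟨-, h2, -⟩
      simp [h1] at h2

theorem lastCol_lt {x : Domino × ℕ} (hx : x ∈ D.dominoes) :
    D.rows x.2 x.1.lastRow ≤ x.1.lastCol ∧ x.1.lastCol < D.rows (x.2 + 1) x.1.lastRow :=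
  D.rows_of_mem (d := x.1) (p := x.2) hx (by simp [Domino.cells])

theorem col_bounds {x : Domino × ℕ} (hx : x ∈ D.dominoes) :
    D.rows x.2 x.1.row ≤ x.1.col ∧ x.1.col < D.rows (x.2 + 1) x.1.row :=
  D.rows_of_mem (d := x.1) (p := x.2) hx (by simp [Domino.cells])

theorem rows_antitone (p : ℕ) : Antitone (D.rows p) := antitone_nat_of_succ_le (D.rows_anti p)

theorem isReadingOrder_dominoBefore : IsReadingOrder D.dominoes dominoBefore where
  irrefl x _ h := by unfold dominoBefore at h; omega
  trans x _ y _ z _ h h' := by unfold dominoBefore at *; omega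
  total x hx y hy := by
    by_cases hxy : x = y
    · exact Or.inl hxy
    · right
      have : ¬ (x.1.lastRow = y.1.lastRow ∧ x.1.lastCol = y.1.lastCol) := by
        rintro ⟨h1, h2⟩
        exact hxy (D.eq_of_mem hx hy (s := (x.1.lastRow, x.1.lastCol)) (by simp [Domino.cells])
          (by rw [h1, h2]; simp [Domino.cells]))
      unfold dominoBefore
      omega

open scoped Classical in
theorem card_filter_row' (p r : ℕ) :
    (D.dominoes.filter fun x => x.2 = p ∧ x.1.row = r).card =
      (D.rows (p + 1) (r + 1) - D.rows p r) +
      (D.horizEnd p r - max (D.rows p r) (D.rows (p + 1) (r + 1))) / 2 := by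
  have h := D.card_filter_row p r (D.rows (p + 1) 0)
  have h1 : D.rows (p + 1) (r + 1) ≤ D.rows (p + 1) 0 := D.rows_antitone _ (Nat.zero_le _)
  have h2 : D.rows (p + 1) r ≤ D.rows (p + 1) 0 := D.rows_antitone _ (Nat.zero_le _)
  have h3 : D.horizEnd p r ≤ D.rows (p + 1) r := by unfold horizEnd; split_ifs <;> omega
  rw [min_eq_right h1, min_eq_right (h3.trans h2)] at h
  rw [← h]
  congr 1
  refine Finset.filter_congr fun x hx => ?_
  have h4 := (D.lastCol_lt hx).2
  have h5 : D.rows (x.2 + 1) x.1.lastRow ≤ D.rows (x.2 + 1) 0 := D.rows_antitone _ (Nat.zero_le _)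
  constructor
  · rintro ⟨h6, h7⟩
    exact ⟨h6, h7, by rw [← h6]; omega⟩
  · rintro ⟨h6, h7, -⟩
    exact ⟨h6, h7⟩

open scoped Classical in
theorem card_filter_lastRow' (p r : ℕ) :
    (D.dominoes.filter fun x => x.2 = p ∧ x.1.lastRow = r).card =
      (if r = 0 then 0 else D.rows (p + 1) r - D.rows p (r - 1)) +
      (D.horizEnd p r - max (D.rows p r) (D.rows (p + 1) (r + 1))) / 2 := by
  have h := D.card_filter_lastRow p r (D.rows (p + 1) 0)
  have h2 : D.rows (p + 1) r ≤ D.rows (p + 1) 0 := D.rows_antitone _ (Nat.zero_le _)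
  have h3 : D.horizEnd p r ≤ D.rows (p + 1) r := by unfold horizEnd; split_ifs <;> omega
  rw [min_eq_right h2, min_eq_right (h3.trans h2)] at h
  rw [← h]
  congr 1
  refine Finset.filter_congr fun x hx => ?_
  have h4 := (D.lastCol_lt hx).2
  have h5 : D.rows (x.2 + 1) x.1.lastRow ≤ D.rows (x.2 + 1) 0 := D.rows_antitone _ (Nat.zero_le _)
  constructor
  · rintro ⟨h6, h7⟩
    exact ⟨h6, h7, by rw [← h6]; omega⟩
  · rintro ⟨h6, h7, -⟩
    exact ⟨h6, h7⟩

theorem lastCol_lt_of_row_lt {x y : Domino × ℕ} (hx : x ∈ D.dominoes) (hy : y ∈ D.dominoes)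
    (hxy : x.2 = y.2) (hlt : x.1.row < y.1.row) : y.1.lastCol < x.1.lastCol := by
  rcases x with ⟨d, p⟩
  rcases y with ⟨d', q⟩
  simp only [] at hxy hlt ⊢
  subst hxy
  rw [D.mem_dominoes_iff] at hx hy
  exact (hx.lastCol_lt_col (D.isDominoStrip p) hy hlt).trans_le d.lt_lastCol_add

/-- The comparison of the letters `i + 1` that start in a row with the letters `i` that end in the
row above, where `C` is the column of a letter `i + 1`. The former occupy `w` columns from `k` on
and `g` pairs of columns after these, the latter `h` pairs of columns from `m` on and `v` columns
after these. -/
theorem strip_comparison {k w g m h v C : ℕ} (h1 : k ≤ m) (h2 : k + w + 2 * g ≤ m + 2 * h + v)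
    (hC : (k ≤ C ∧ C < k + w) ∨ ∃ t < g, C = k + w + 2 * t + 1) :
    ((min C (m + 2 * h + v) - (m + 2 * h)) + (min C (m + 2 * h) - m) / 2 ≤
      (min C (k + w) - k) + (min C (k + w + 2 * g) - (k + w)) / 2 ∨
    w + g + ((min C (m + 2 * h + v) - (m + 2 * h)) + (min C (m + 2 * h) - m) / 2) ≤
      v + h + ((min C (k + w) - k) + (min C (k + w + 2 * g) - (k + w)) / 2)) ∧
    (v + h < w + g → 0 < (min C (k + w) - k) + (min C (k + w + 2 * g) - (k + w)) / 2 →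
      (min C (m + 2 * h + v) - (m + 2 * h)) + (min C (m + 2 * h) - m) / 2 ≠
      (min C (k + w) - k) + (min C (k + w + 2 * g) - (k + w)) / 2) := by
  have hCle : C ≤ m + 2 * h + v := by
    rcases hC with hC | ⟨t, ht, rfl⟩ <;> omega
  have hj : (min C (k + w) - k) + (min C (k + w + 2 * g) - (k + w)) / 2 =
      if C < k + w then C - k else w + (C - (k + w)) / 2 := by
    rcases hC with hC | ⟨t, ht, rfl⟩
    · rw [if_pos hC.2]; omega
    · rw [if_neg (by omega)]; omega
  have hz : (min C (m + 2 * h + v) - (m + 2 * h)) + (min C (m + 2 * h) - m) / 2 =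
      if C ≤ m + 2 * h then (C - m) / 2 else C - (m + 2 * h) + h := by
    split_ifs <;> omega
  rw [hj, hz]
  clear hj hz
  rcases hC with hC | ⟨t, ht, rfl⟩
  · rw [if_pos hC.2]
    split_ifs
    · exact ⟨Or.inl (by omega), fun _ _ => by omega⟩
    · exact ⟨Or.inr (by omega), fun _ _ => by omega⟩
  · rw [if_neg (by omega : ¬ k + w + 2 * t + 1 < k + w),
      show (k + w + 2 * t + 1 - (k + w)) / 2 = t by omega]
    split_ifs
    · exact ⟨Or.inl (by omega), fun _ _ => by omega⟩
    · exact ⟨Or.inr (by omega), fun _ _ => by omega⟩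

set_option maxHeartbeats 400000 in
/-- The comparison in terms of the row lengths of three consecutive partitions `m, k, l` of a chain:
the letters `i` are in `k / m`, the letters `i + 1` in `l / k`, and rows are numbered relatively,
`0` for the upper row. The columns from `P` on of the upper row of `k / m` belong to vertical
dominoes that start in the row above it. -/
theorem strip_comparison_of_rows {k1 l1 l2 k0 m0 P C : ℕ} (h1 : k1 ≤ P) (h2 : m0 ≤ P) (h3 : k1 ≤ k0)
    (h4 : m0 ≤ k0) (h5 : k1 ≤ l1) (h6 : l2 ≤ l1) (h7 : l2 ≤ k0)
    (e1 : (min k0 P - max m0 k1) % 2 = 0) (e2 : (min l1 k0 - max k1 l2) % 2 = 0)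
    (hC : (k1 ≤ C ∧ C < l2) ∨ ∃ c, C = c + 1 ∧ k1 ≤ c ∧ l2 ≤ c ∧ c + 1 < l1 ∧ c + 1 < k0 ∧
      (c - max k1 l2) % 2 = 0) :
    ((min C k0 - P) + (min C (min k0 P) - max m0 k1) / 2 ≤
      (min C l2 - k1) + (min C (min l1 k0) - max k1 l2) / 2 ∨
    (l2 - k1) + (min l1 k0 - max k1 l2) / 2 +
        ((min C k0 - P) + (min C (min k0 P) - max m0 k1) / 2) ≤
      (k0 - P) + (min k0 P - max m0 k1) / 2 +
        ((min C l2 - k1) + (min C (min l1 k0) - max k1 l2) / 2)) ∧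
    ((k0 - P) + (min k0 P - max m0 k1) / 2 < (l2 - k1) + (min l1 k0 - max k1 l2) / 2 →
      0 < (min C l2 - k1) + (min C (min l1 k0) - max k1 l2) / 2 →
      (min C k0 - P) + (min C (min k0 P) - max m0 k1) / 2 ≠
        (min C l2 - k1) + (min C (min l1 k0) - max k1 l2) / 2) := by
  obtain ⟨M, hM⟩ : ∃ M, M = max k1 l2 := ⟨_, rfl⟩
  obtain ⟨m, hm⟩ : ∃ m, m = max m0 k1 := ⟨_, rfl⟩
  obtain ⟨n, hn⟩ : ∃ n, n = min k0 P := ⟨_, rfl⟩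
  obtain ⟨N, hN⟩ : ∃ N, N = min l1 k0 := ⟨_, rfl⟩
  have hMN : M ≤ N := by clear hC e1 e2; omega
  have hmn : m ≤ n := by clear hC e1 e2; omega
  have hkm : k1 ≤ m := by clear hC e1 e2; omega
  have hNk : N ≤ k0 := by clear hC e1 e2; omega
  have hnk : n ≤ k0 := by clear hC e1 e2; omega
  have hP : ∀ X, X ≤ k0 → X - P = X - n := fun X hX => by clear hC e1 e2; omega
  have hw : ∀ X, min X l2 - k1 = min X M - k1 := fun X => by clear hC e1 e2; omega
  have hw' : l2 - k1 = M - k1 := by clear hC e1 e2; omega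
  have hkM : k1 ≤ M := by clear hC e1 e2; omega
  have hC' : (k1 ≤ C ∧ C < M) ∨ ∃ t, 2 * t < N - M ∧ C = M + 2 * t + 1 := by
    rcases hC with hC | ⟨c, rfl, hC⟩
    · left; clear e1 e2; omega
    · right
      rw [← hM] at hC
      have hMc : M ≤ c := by clear e1 e2; omega
      obtain ⟨t, rfl⟩ : ∃ t, c = M + 2 * t := ⟨(c - M) / 2, by clear e1 e2 hM hN hn hm; omega⟩
      exact ⟨t, by clear e1 e2; omega, rfl⟩
  clear hC
  rw [hP _ (min_le_right _ _), hP k0 le_rfl, hw, hw', ← hM, ← hm, ← hn, ← hN]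
  rw [← hM, ← hN] at e2
  rw [← hm, ← hn] at e1
  clear hP hw hw' hM hm hn hN h1 h2 h3 h4 h5 h6 h7
  obtain ⟨h, rfl⟩ : ∃ h, n = m + 2 * h := ⟨(n - m) / 2, by clear hC'; omega⟩
  obtain ⟨g, rfl⟩ : ∃ g, N = M + 2 * g := ⟨(N - M) / 2, by clear hC'; omega⟩
  obtain ⟨w, rfl⟩ : ∃ w, M = k1 + w := ⟨M - k1, by clear hC'; omega⟩
  obtain ⟨v, rfl⟩ : ∃ v, k0 = m + 2 * h + v := ⟨k0 - (m + 2 * h), by clear hC'; omega⟩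
  have key := strip_comparison (k := k1) (w := w) (g := g) (m := m) (h := h) (v := v) (C := C) hkm
    hNk (by
      rcases hC' with hC | ⟨t, ht, hC⟩
      · exact Or.inl hC
      · exact Or.inr ⟨t, by omega, hC⟩)
  clear hC'
  rw [show k1 + w - k1 = w by omega, show k1 + w + 2 * g - (k1 + w) = 2 * g by omega,
    show m + 2 * h + v - (m + 2 * h) = v by omega, show m + 2 * h - m = 2 * h by omega,
    Nat.mul_div_cancel_left g two_pos, Nat.mul_div_cancel_left h two_pos]
  exact key

theorem row_comparison {i q : ℕ} {x : Domino} (hx : (x, i + 1) ∈ D.dominoes)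
    (hq : x.row = q + 1) {z j a b : ℕ}
    (hz : z = (if q = 0 then 0 else min x.lastCol (D.rows (i + 1) q) - D.rows i (q - 1)) +
      (min x.lastCol (D.horizEnd i q) - max (D.rows i q) (D.rows (i + 1) (q + 1))) / 2)
    (hj : j = (min x.lastCol (D.rows (i + 1 + 1) (q + 1 + 1)) - D.rows (i + 1) (q + 1)) +
      (min x.lastCol (D.horizEnd (i + 1) (q + 1)) -
        max (D.rows (i + 1) (q + 1)) (D.rows (i + 1 + 1) (q + 1 + 1))) / 2)
    (ha : a = (if q = 0 then 0 else D.rows (i + 1) q - D.rows i (q - 1)) +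
      (D.horizEnd i q - max (D.rows i q) (D.rows (i + 1) (q + 1))) / 2)
    (hb : b = (D.rows (i + 1 + 1) (q + 1 + 1) - D.rows (i + 1) (q + 1)) +
      (D.horizEnd (i + 1) (q + 1) -
        max (D.rows (i + 1) (q + 1)) (D.rows (i + 1 + 1) (q + 1 + 1))) / 2) :
    (z ≤ j ∨ b + z ≤ a + j) ∧ (a < b → 0 < j → z ≠ j) := by
  have s1 := D.isDominoStrip i
  have s2 := D.isDominoStrip (i + 1)
  have e1 := s1.even q
  have e2 := s2.even (q + 1)
  have n1 := s1.le q
  have n2 := s2.le (q + 1)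
  have n3 := s1.anti_right q
  have n4 := s2.anti_right (q + 1)
  have n5 := s2.strip q
  have n9 : q ≠ 0 → D.rows (i + 1) (q + 1) ≤ D.rows i (q - 1) ∧
      D.rows i q ≤ D.rows i (q - 1) := by
    intro hq0
    obtain ⟨t, rfl⟩ := Nat.exists_eq_succ_of_ne_zero hq0
    exact ⟨s1.strip t, s1.anti_left t⟩
  have hC : (D.rows (i + 1) (q + 1) ≤ x.lastCol ∧ x.lastCol < D.rows (i + 1 + 1) (q + 1 + 1)) ∨
      ∃ c, x.lastCol = c + 1 ∧ D.rows (i + 1) (q + 1) ≤ c ∧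
        D.rows (i + 1 + 1) (q + 1 + 1) ≤ c ∧
        c + 1 < D.rows (i + 1 + 1) (q + 1) ∧ c + 1 < D.rows (i + 1) q ∧
        (c - max (D.rows (i + 1) (q + 1)) (D.rows (i + 1 + 1) (q + 1 + 1))) % 2 = 0 := by
    rw [D.mem_dominoes_iff] at hx
    rcases x.eq_vert_or_eq_horiz with ⟨r, c, rfl⟩ | ⟨r, c, rfl⟩
    · simp only [Domino.row_vert, isTile_vert, Domino.lastCol_vert] at *
      subst hq
      exact Or.inl hx
    · simp only [Domino.row_horiz, isTile_horiz, Domino.lastCol_horiz] at *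
      subst hq
      refine Or.inr ⟨c, rfl, hx.1, hx.2.1, hx.2.2.1, ?_, hx.2.2.2.2⟩
      simpa using hx.2.2.2.1
  have hend : D.horizEnd (i + 1) (q + 1) = min (D.rows (i + 2) (q + 1)) (D.rows (i + 1) q) := by
    simp [horizEnd]
  obtain ⟨P, hP⟩ : ∃ P, P = if q = 0 then D.rows (i + 1) q else D.rows i (q - 1) := ⟨_, rfl⟩
  have hend' : D.horizEnd i q = min (D.rows (i + 1) q) P := by
    rw [hP, horizEnd]; split_ifs <;> simp
  have hz' : (if q = 0 then 0 else min x.lastCol (D.rows (i + 1) q) - D.rows i (q - 1)) =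
      min x.lastCol (D.rows (i + 1) q) - P := by
    rw [hP]; split_ifs
    · have := min_le_right x.lastCol (D.rows (i + 1) q)
      omega
    · rfl
  have ha' : (if q = 0 then 0 else D.rows (i + 1) q - D.rows i (q - 1)) =
      D.rows (i + 1) q - P := by
    rw [hP]; split_ifs
    · omega
    · rfl
  have hP1 : D.rows (i + 1) (q + 1) ≤ P ∧ D.rows i q ≤ P := by
    rw [hP]; split_ifs with hq0
    · exact ⟨n3, n1⟩
    · exact n9 hq0
  have e1' : (min (D.rows (i + 1) q) P - max (D.rows i q) (D.rows (i + 1) (q + 1))) % 2 = 0 := by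
    rw [overlap, ha'] at e1
    clear hC hz hj ha hb hz' ha' hend hend' e2
    omega
  have e2' : (min (D.rows (i + 2) (q + 1)) (D.rows (i + 1) q) -
      max (D.rows (i + 1) (q + 1)) (D.rows (i + 2) (q + 2))) % 2 = 0 := by
    simp only [overlap, Nat.add_sub_cancel, Nat.add_eq_zero_iff, one_ne_zero, and_false,
      if_false, add_assoc, Nat.reduceAdd] at e2 n2 n4
    clear hC hz hj ha hb hz' ha' hend hend' e1
    omega
  rw [hz', hend'] at hz
  rw [ha', hend'] at ha
  rw [hend] at hj hb
  rw [hz, ha, hj, hb]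
  exact strip_comparison_of_rows hP1.1 hP1.2 n3 n1 n2 n4 n5 e1' e2' hC

theorem isRowCompatible (i : ℕ) : IsRowCompatible D.dominoes dominoBefore Prod.snd i
    (fun x => x.1.row) (fun x => x.1.lastRow) := by
  classical
  -- letters `i` that end in the row above are read before `x` if they are further left
  have hz : ∀ x ∈ D.dominoes, ∀ y : Domino × ℕ,
      (y.2 = i ∧ y.1.lastRow + 1 = x.1.row ∧ dominoBefore y x) ↔
      (y.2 = i ∧ y.1.lastRow + 1 = x.1.row ∧ y.1.lastCol < x.1.lastCol) := by
    intro x hx y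
    have : x.1.row ≤ x.1.lastRow := by unfold Domino.lastRow; split <;> omega
    unfold dominoBefore
    constructor <;> rintro ⟨h1, h2, h3⟩ <;> exact ⟨h1, h2, by omega⟩
  have hj : ∀ x ∈ D.dominoes, x.2 = i + 1 → ∀ y ∈ D.dominoes,
      ((y.2 = i + 1 ∧ y.1.row = x.1.row ∧ dominoBefore y x) ↔
      (y.2 = i + 1 ∧ y.1.row = x.1.row ∧ y.1.lastCol < x.1.lastCol)) := by
    intro x hx hxi y hy
    constructor
    · rintro ⟨h1, h2, h3⟩
      refine ⟨h1, h2, ?_⟩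
      rcases h3 with h3 | ⟨h3, h4⟩
      · exact h3
      · exfalso
        rcases x with ⟨d, p⟩
        rcases y with ⟨d', q⟩
        simp only [] at hxi h1 h2 h3 h4
        subst hxi h1
        rw [D.mem_dominoes_iff] at hx hy
        rcases d.eq_vert_or_eq_horiz with ⟨r, c, rfl⟩ | ⟨r, c, rfl⟩ <;>
        rcases d'.eq_vert_or_eq_horiz with ⟨r', c', rfl⟩ | ⟨r', c', rfl⟩ <;>
        simp only [isTile_vert, isTile_horiz, Domino.row_vert, Domino.row_horiz,
          Domino.lastRow_vert, Domino.lastRow_horiz, Domino.lastCol_vert,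
          Domino.lastCol_horiz] at * <;> subst h2 <;> omega
    · rintro ⟨h1, h2, h3⟩
      exact ⟨h1, h2, Or.inl h3⟩
  -- the four numbers of the conditions `bound` and `strict`
  have hcount : ∀ x ∈ D.dominoes, x.2 = i + 1 →
      x.1.row = 0 ∧ (D.dominoes.filter fun y => y.2 = i ∧ y.1.lastRow + 1 = x.1.row ∧
        dominoBefore y x).card = 0 ∨ ∃ z j a b,
      (D.dominoes.filter fun y => y.2 = i ∧ y.1.lastRow + 1 = x.1.row ∧
        dominoBefore y x).card = z ∧
      (D.dominoes.filter fun y => y.2 = i + 1 ∧ y.1.row = x.1.row ∧ dominoBefore y x).card = j ∧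
      (D.dominoes.filter fun y => y.2 = i ∧ y.1.lastRow + 1 = x.1.row).card = a ∧
      (D.dominoes.filter fun y => y.2 = i + 1 ∧ y.1.row = x.1.row).card = b ∧
      (z ≤ j ∨ b + z ≤ a + j) ∧ (a < b → 0 < j → z ≠ j) := by
    intro x hx hxi
    rcases Nat.eq_zero_or_pos x.1.row with h0 | h0
    · left
      refine ⟨h0, ?_⟩
      rw [Finset.card_eq_zero, Finset.filter_eq_empty_iff]
      rintro y - ⟨-, h1, -⟩
      omega
    · right
      obtain ⟨q, hq⟩ := Nat.exists_eq_add_of_lt h0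
      rw [zero_add] at hq
      refine ⟨_, _, _, _, rfl, rfl, rfl, rfl, ?_⟩
      rw [Finset.filter_congr (fun y _ => hz x hx y), Finset.filter_congr (hj x hx hxi)]
      simp only [hq, Nat.add_right_cancel_iff]
      rw [D.card_filter_lastRow, D.card_filter_row, D.card_filter_row', D.card_filter_lastRow']
      exact D.row_comparison (x := x.1) (by rw [← hxi]; exact hx) hq rfl rfl rfl rfl
  refine ⟨D.isReadingOrder_dominoBefore, ?_, ?_, ?_, ?_, ?_⟩
  · intro x hx y hy hxi hyi hxy
    by_contra hlt
    have := D.lastCol_lt_of_row_lt hx hy (hxi.trans hyi.symm) (by simpa using hlt)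
    unfold dominoBefore at hxy
    omega
  · intro x hx y hy hxi hyi hle
    have h1 := (D.lastCol_lt hy).2
    have h2 := (D.col_bounds hx).1
    have h3 := x.1.lt_lastCol_add
    have h4 : D.rows (i + 1) y.1.lastRow ≤ D.rows (i + 1) x.1.row := D.rows_antitone (i + 1) hle
    rw [show y.2 = i from hyi] at h1
    rw [show x.2 = i + 1 from hxi] at h2
    left
    omega
  · rintro ⟨d, p⟩ hx ⟨d', q⟩ hy hxi hyi hlt
    simp only [] at hxi hyi hlt
    subst hxi hyi
    left
    rw [D.mem_dominoes_iff] at hx hy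
    have s1 := D.isDominoStrip q
    have s2 := D.isDominoStrip (q + 1)
    simp only []
    have h1 : d.lastCol < D.rows (q + 1) (d'.lastRow + 1) := by
      rcases d.eq_vert_or_eq_horiz with ⟨r, c, rfl⟩ | ⟨r, c, rfl⟩
      · rw [isTile_vert] at hx
        simp only [Domino.row_vert, Domino.lastCol_vert] at *
        have h2 : D.rows (q + 1 + 1) (r + 1) ≤ D.rows (q + 1 + 1) (d'.lastRow + 1 + 2) :=
          D.rows_antitone _ (by omega)
        have := s2.strip (d'.lastRow + 1)
        omega
      · rw [isTile_horiz] at hx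
        simp only [Domino.row_horiz, Domino.lastCol_horiz] at *
        have h2 : D.rows (q + 1) (r - 1) ≤ D.rows (q + 1) (d'.lastRow + 1) :=
          D.rows_antitone _ (by omega)
        omega
    rcases d'.eq_vert_or_eq_horiz with ⟨r, c, rfl⟩ | ⟨r, c, rfl⟩
    · rw [isTile_vert] at hy
      simp only [Domino.lastRow_vert, Domino.lastCol_vert] at *
      have := s1.strip r
      simp only [add_assoc, Nat.reduceAdd] at *
      omega
    · rw [isTile_horiz] at hy
      simp only [Domino.lastRow_horiz, Domino.lastCol_horiz] at *
      omega
  · intro x hx hxi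
    rcases hcount x hx hxi with ⟨h0, h1⟩ | ⟨z, j, a, b, h1, h2, h3, h4, h5, -⟩
    · left
      calc _ = 0 := h1
        _ ≤ _ := Nat.zero_le _
    · rw [← h1, ← h2, ← h3, ← h4] at h5
      exact h5
  · intro x hx hxi
    rcases hcount x hx hxi with ⟨h0, h1⟩ | ⟨z, j, a, b, h1, h2, h3, h4, -, h5⟩
    · intro _ h3
      refine ne_of_lt (lt_of_eq_of_lt h1 h3)
    · rw [← h1, ← h2, ← h3, ← h4] at h5
      exact h5

end DominoTableau

/-! ### The row excess of a domino tableau -/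

theorem Octa.two_mul {α β : ℕ → ℕ} {A B a : ℕ → ℤ} (h : Octa A a a B)
    (hA : ∀ r, A (r + 1) = A r + α r) (hB : ∀ r, B (r + 1) = B r + β r) (r : ℕ) :
    2 * a r = A r + B r + overlap α β r := by
  cases r with
  | zero =>
    have := h.1
    simp only [overlap, if_true]
    omega
  | succ r =>
    have h1 := h.2 r
    have h2 : B (r + 2) = _ := hB (r + 1)
    have h3 := hA r
    simp only [overlap, Nat.add_sub_cancel, Nat.add_eq_zero_iff, one_ne_zero, and_false, if_false]
    omega

/-- The parity of a row of a skew shape that can be halved. -/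
theorem Octa.exists_row_eq {α β : ℕ → ℕ} {A B a : ℕ → ℤ} (h : Octa A a a B)
    (hA : ∀ r, A (r + 1) = A r + α r) (hB : ∀ r, B (r + 1) = B r + β r) (r : ℕ) :
    (α r + β r + (β (r + 1) - α r) + overlap α β r) % 2 = 0 := by
  have h1 := h.two_mul hA hB r
  have h2 := h.two_mul hA hB (r + 1)
  have h3 : overlap α β (r + 1) = β (r + 1) - α r := by simp [overlap]
  rw [hA, hB, h3] at h2
  omega

theorem IsSymmFamily.octa_diag {g : ℕ → ℕ → ℕ → ℤ} (hg : IsSymmFamily g) (p : ℕ) :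
    Octa (g p p) (g p (p + 1)) (g p (p + 1)) (g (p + 1) (p + 1)) := by
  have h := hg.octa p p
  rwa [hg.symm (p + 1) p] at h

namespace DominoTableau

variable {lam mu : YoungDiagram} (D : DominoTableau lam mu)

theorem chain_succ (p r : ℕ) : D.chain p (r + 1) = D.chain p r + D.rows p r := psum_succ _ _

theorem chain_zero (p : ℕ) : D.chain p 0 = 0 := psum_zero _

open scoped Classical in
/-- Of the squares with entry `p` above row `r`, those that do not belong to dominoes above row `r`
are the upper squares of the vertical dominoes that cross into row `r`. -/
theorem card_filter_lt (p r : ℕ) :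
    2 * ((D.dominoes.filter fun x => x.2 = p ∧ x.1.lastRow < r).card : ℤ) +
        overlap (D.rows p) (D.rows (p + 1)) r = D.chain (p + 1) r - D.chain p r ∧
      (D.dominoes.filter fun x => x.2 = p ∧ x.1.row < r).card =
        (D.dominoes.filter fun x => x.2 = p ∧ x.1.lastRow < r).card +
          overlap (D.rows p) (D.rows (p + 1)) r := by
  induction r with
  | zero => simp [overlap, chain_zero]
  | succ r ih =>
    have h1 : (D.dominoes.filter fun x => x.2 = p ∧ x.1.lastRow < r + 1).card =
        (D.dominoes.filter fun x => x.2 = p ∧ x.1.lastRow < r).card +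
        (D.dominoes.filter fun x => x.2 = p ∧ x.1.lastRow = r).card := by
      rw [← Finset.card_union_of_disjoint]
      · congr 1
        ext x
        simp only [Finset.mem_filter, Finset.mem_union, Nat.lt_succ_iff_lt_or_eq]
        tauto
      · rw [Finset.disjoint_filter]; omega
    have h2 : (D.dominoes.filter fun x => x.2 = p ∧ x.1.row < r + 1).card =
        (D.dominoes.filter fun x => x.2 = p ∧ x.1.row < r).card +
        (D.dominoes.filter fun x => x.2 = p ∧ x.1.row = r).card := by
      rw [← Finset.card_union_of_disjoint]
      · congr 1
        ext x
        simp only [Finset.mem_filter, Finset.mem_union, Nat.lt_succ_iff_lt_or_eq]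
        tauto
      · rw [Finset.disjoint_filter]; omega
    rw [h1, h2, card_filter_row', card_filter_lastRow', chain_succ, chain_succ]
    have s := D.isDominoStrip p
    have e := s.even r
    have n1 := s.le r
    have n2 := s.anti_right r
    have n3 : r ≠ 0 → D.rows (p + 1) (r + 1) ≤ D.rows p (r - 1) ∧
        D.rows p r ≤ D.rows p (r - 1) := by
      intro h0
      obtain ⟨t, rfl⟩ := Nat.exists_eq_succ_of_ne_zero h0
      exact ⟨s.strip t, s.anti_left t⟩
    unfold horizEnd
    unfold overlap at *
    simp only [Nat.add_sub_cancel, Nat.add_eq_zero_iff, one_ne_zero, and_false, if_false] at *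
    clear h1 h2 s
    split_ifs at * with h0
    · omega
    · have n3 := n3 h0
      omega

open scoped Classical in
theorem two_mul_weight (p : ℕ) : ∃ R, ∀ r, R ≤ r →
    2 * (D.weight p : ℤ) = D.chain (p + 1) r - D.chain p r := by
  refine ⟨D.dominoes.sup (fun x => x.1.lastRow) + 1, fun r hr => ?_⟩
  have hlt : ∀ x ∈ D.dominoes, x.1.lastRow < r := fun x hx =>
    (Finset.le_sup (f := fun x : Domino × ℕ => x.1.lastRow) hx).trans_lt hr
  have h1 : (D.dominoes.filter fun x => x.2 = p ∧ x.1.lastRow < r).card = D.weight p := by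
    unfold weight
    congr 1
    refine Finset.filter_congr fun x hx => ?_
    simp [hlt x hx]
  have h2 : (D.dominoes.filter fun x => x.2 = p ∧ x.1.row < r).card = D.weight p := by
    unfold weight
    congr 1
    refine Finset.filter_congr fun x hx => ?_
    have h3 : x.1.row ≤ x.1.lastRow := by unfold Domino.lastRow; split <;> omega
    simp [h3.trans_lt (hlt x hx)]
  have h3 := D.card_filter_lt p r
  rw [h1, h2] at h3
  omega

/-- The corner between two consecutive partitions of the diagonal of a symmetric family. -/
theorem two_mul_octa {p : ℕ} {a : ℕ → ℤ} (h : Octa (D.chain p) a a (D.chain (p + 1))) (r : ℕ) :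
    2 * a r = D.chain p r + D.chain (p + 1) r + overlap (D.rows p) (D.rows (p + 1)) r :=
  h.two_mul (D.chain_succ p) (D.chain_succ (p + 1)) r

theorem octa_of_isSymmFamily {g : ℕ → ℕ → ℕ → ℤ} (hg : IsSymmFamily g)
    (hD : ∀ p, g p p = D.chain p) (p : ℕ) :
    Octa (D.chain p) (g p (p + 1)) (g p (p + 1)) (D.chain (p + 1)) := by
  have h := hg.octa_diag p
  rwa [hD, hD] at h

theorem rowExcess_eq {g : ℕ → ℕ → ℕ → ℤ} (hg : IsSymmFamily g)
    (hD : ∀ p, g p p = D.chain p) (i : ℕ) :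
    rowExcess D.dominoes Prod.snd i (fun x => x.1.row) (fun x => x.1.lastRow) =
      chainExcess (g (i + 1)) i := by
  classical
  funext r
  have h1 := D.two_mul_octa (D.octa_of_isSymmFamily hg hD i) r
  have h2 := D.two_mul_octa (D.octa_of_isSymmFamily hg hD (i + 1)) (r + 1)
  have h3 := D.card_filter_lt i r
  have h4 := D.card_filter_lt (i + 1) (r + 1)
  simp only [Nat.lt_succ_iff] at h4
  unfold rowExcess chainExcess excess
  rw [hD, hg.symm (i + 1) i]
  simp only [add_assoc, Nat.reduceAdd] at *
  omega

end DominoTableau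

/-! ### The column reading of a Young tableau -/

namespace SemistandardYoungTableau

variable {kap : YoungDiagram} (T : SemistandardYoungTableau kap)

theorem entry_le_entry {r c r' c' : ℕ} (hr : r ≤ r') (hc : c ≤ c') (h : (r', c') ∈ kap) :
    T r c ≤ T r' c' :=
  (T.row_weak_of_le hc (kap.up_left_mem hr le_rfl h)).trans (T.col_weak hr h)

theorem entry_lt_entry {r c r' c' : ℕ} (hr : r < r') (hc : c ≤ c') (h : (r', c') ∈ kap) :
    T r c < T r' c' :=
  (T.row_weak_of_le hc (kap.up_left_mem hr.le le_rfl h)).trans_lt (T.col_strict hr h)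

theorem row_le_entry {r c : ℕ} (h : (r, c) ∈ kap) : r ≤ T r c := by
  induction r with
  | zero => exact Nat.zero_le _
  | succ r ih =>
    exact (ih (kap.up_left_mem (Nat.le_succ r) le_rfl h)).trans_lt
      (T.col_strict (Nat.lt_add_one r) h)

/-- The row lengths of the partition formed by the entries less than `p`. -/
def rows (p : ℕ) : ℕ → ℕ := ((YoungTableau.toSkew ⟨kap, T⟩).below p).rowLen

/-- The chain of partial sums of a Young tableau. -/
def chain (p : ℕ) : ℕ → ℤ := (YoungTableau.toSkew ⟨kap, T⟩).chain p

theorem lt_rows_iff {p r c : ℕ} : c < T.rows p r ↔ (r, c) ∈ kap ∧ T r c < p := by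
  unfold rows
  rw [← YoungDiagram.mem_iff_lt_rowLen, SkewTableau.mem_below]
  simp [YoungTableau.toSkew]

theorem chain_succ (p r : ℕ) : T.chain p (r + 1) = T.chain p r + T.rows p r :=
  psum_succ ((YoungTableau.toSkew ⟨kap, T⟩).below p) r

theorem chain_zero (p : ℕ) : T.chain p 0 = 0 :=
  psum_zero ((YoungTableau.toSkew ⟨kap, T⟩).below p)

theorem rows_mono (p r : ℕ) : T.rows p r ≤ T.rows (p + 1) r := by
  by_contra h
  rw [not_le, lt_rows_iff] at h
  have := T.lt_rows_iff.2 ⟨h.1, h.2.trans (Nat.lt_add_one p)⟩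
  omega

theorem rows_strip (p r : ℕ) : T.rows (p + 1) (r + 1) ≤ T.rows p r := by
  by_contra h
  rw [not_le, lt_rows_iff] at h
  have h1 := T.col_strict (Nat.lt_add_one r) h.1
  have := T.lt_rows_iff.2 ⟨kap.up_left_mem (Nat.le_succ r) le_rfl h.1, (by omega : _ < p)⟩
  omega

theorem entry_eq_iff {p r c : ℕ} (h : (r, c) ∈ kap) :
    T r c = p ↔ T.rows p r ≤ c ∧ c < T.rows (p + 1) r := by
  rw [← not_lt, lt_rows_iff, lt_rows_iff]
  simp only [h, true_and]
  omega

/-- A Young tableau is determined by its chain. -/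
theorem eq_of_chain_eq {T T' : SemistandardYoungTableau kap} (h : ∀ p, T.chain p = T'.chain p) :
    T = T' := by
  have hrows : ∀ p r, T.rows p r = T'.rows p r := by
    intro p r
    have h1 := T.chain_succ p r
    have h2 := T'.chain_succ p r
    rw [h] at h1
    omega
  refine SemistandardYoungTableau.ext fun r c => ?_
  by_cases hm : (r, c) ∈ kap
  · rw [T.entry_eq_iff hm, hrows, hrows, ← T'.entry_eq_iff hm]
  · rw [T.zeros hm, T'.zeros hm]

theorem card_filter_row (p r C : ℕ) :
    (kap.cells.filter fun s => T s.1 s.2 = p ∧ s.1 = r ∧ s.2 < C).card =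
      min C (T.rows (p + 1) r) - T.rows p r := by
  rw [← Nat.card_Ico]
  symm
  refine Finset.card_bij (fun c _ => (r, c)) ?_ ?_ ?_
  · intro c hc
    rw [Finset.mem_Ico] at hc
    have h1 := T.lt_rows_iff.1 (by omega : c < T.rows (p + 1) r)
    rw [Finset.mem_filter, YoungDiagram.mem_cells]
    exact ⟨h1.1, (T.entry_eq_iff h1.1).2 ⟨hc.1, by omega⟩, rfl, by simp only []; omega⟩
  · intro c _ c' _ h
    exact congrArg Prod.snd h
  · rintro ⟨r', c⟩ hs
    rw [Finset.mem_filter, YoungDiagram.mem_cells] at hs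
    obtain ⟨h1, h2, h3, h4⟩ := hs
    simp only [] at h2 h3 h4
    subst h3
    rw [T.entry_eq_iff h1] at h2
    exact ⟨c, Finset.mem_Ico.2 ⟨h2.1, by omega⟩, rfl⟩

open scoped Classical in
theorem card_filter_row' (p r : ℕ) :
    (kap.cells.filter fun s => T s.1 s.2 = p ∧ s.1 = r).card =
      T.rows (p + 1) r - T.rows p r := by
  have h := T.card_filter_row p r (T.rows (p + 1) r)
  rw [min_self] at h
  rw [← h]
  congr 1
  refine Finset.filter_congr fun s hs => ?_
  constructor
  · rintro ⟨h1, h2⟩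
    rw [YoungDiagram.mem_cells] at hs
    have := ((T.entry_eq_iff hs).1 h1).2
    rw [← h2]
    exact ⟨h1, rfl, this⟩
  · rintro ⟨h1, h2, -⟩
    exact ⟨h1, h2⟩

open scoped Classical in
theorem card_filter_lt (p r : ℕ) :
    ((kap.cells.filter fun s => T s.1 s.2 = p ∧ s.1 < r).card : ℤ) =
      T.chain (p + 1) r - T.chain p r := by
  induction r with
  | zero => simp [chain_zero]
  | succ r ih =>
    have h1 : (kap.cells.filter fun s => T s.1 s.2 = p ∧ s.1 < r + 1).card =
        (kap.cells.filter fun s => T s.1 s.2 = p ∧ s.1 < r).card +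
        (kap.cells.filter fun s => T s.1 s.2 = p ∧ s.1 = r).card := by
      rw [← Finset.card_union_of_disjoint]
      · congr 1
        ext x
        simp only [Finset.mem_filter, Finset.mem_union, Nat.lt_succ_iff_lt_or_eq]
        tauto
      · rw [Finset.disjoint_filter]; omega
    have h2 := T.rows_mono p r
    rw [h1, card_filter_row', chain_succ, chain_succ]
    omega

theorem weight_eq (p : ℕ) : ∃ R, ∀ r, R ≤ r →
    ((YoungTableau.toSkew ⟨kap, T⟩).weight p : ℤ) = T.chain (p + 1) r - T.chain p r := by
  classical
  refine ⟨kap.cells.sup Prod.fst + 1, fun r hr => ?_⟩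
  rw [← card_filter_lt, SkewTableau.weight]
  norm_cast
  have h1 : (YoungTableau.toSkew ⟨kap, T⟩).outer.cells \
      (YoungTableau.toSkew ⟨kap, T⟩).inner.cells = kap.cells := by simp [YoungTableau.toSkew]
  rw [h1]
  congr 1
  refine Finset.filter_congr fun s hs => ?_
  have h2 : s.1 < r := (Finset.le_sup (f := Prod.fst) hs).trans_lt hr
  simp [YoungTableau.toSkew, h2]

theorem rowExcess_eq (i : ℕ) :
    rowExcess kap.cells (fun s => T s.1 s.2) i Prod.fst Prod.fst = chainExcess T.chain i := by
  classical
  funext r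
  have h3 := T.card_filter_lt i r
  have h4 := T.card_filter_lt (i + 1) (r + 1)
  simp only [Nat.lt_succ_iff] at h4
  unfold rowExcess chainExcess excess
  rw [h3, h4]
  ring

theorem isRowCompatible (i : ℕ) :
    IsRowCompatible kap.cells squareBefore (fun s => T s.1 s.2) i Prod.fst Prod.fst := by
  classical
  have hcount : ∀ x ∈ kap.cells, T x.1 x.2 = i + 1 →
      x.1 = 0 ∧ (kap.cells.filter fun y => T y.1 y.2 = i ∧ y.1 + 1 = x.1 ∧
        squareBefore y x).card = 0 ∨ ∃ z j a b,
      (kap.cells.filter fun y => T y.1 y.2 = i ∧ y.1 + 1 = x.1 ∧ squareBefore y x).card = z ∧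
      (kap.cells.filter fun y => T y.1 y.2 = i + 1 ∧ y.1 = x.1 ∧ squareBefore y x).card = j ∧
      (kap.cells.filter fun y => T y.1 y.2 = i ∧ y.1 + 1 = x.1).card = a ∧
      (kap.cells.filter fun y => T y.1 y.2 = i + 1 ∧ y.1 = x.1).card = b ∧
      z ≤ j ∧ (a < b → 0 < j → z ≠ j) := by
    rintro ⟨r, c⟩ hx hxi
    rcases Nat.eq_zero_or_pos r with h0 | h0
    · left
      refine ⟨h0, ?_⟩
      rw [Finset.card_eq_zero, Finset.filter_eq_empty_iff]
      rintro y - ⟨-, h1, -⟩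
      simp only [h0] at h1
      omega
    · right
      obtain ⟨q, rfl⟩ := Nat.exists_eq_add_of_lt h0
      simp only [zero_add] at *
      refine ⟨_, _, _, _, rfl, rfl, rfl, rfl, ?_⟩
      have hz : (kap.cells.filter fun y => T y.1 y.2 = i ∧ y.1 + 1 = q + 1 ∧
          squareBefore y (q + 1, c)) =
          kap.cells.filter fun y => T y.1 y.2 = i ∧ y.1 = q ∧ y.2 < c := by
        refine Finset.filter_congr fun y _ => ?_
        unfold squareBefore
        constructor <;> rintro ⟨h1, h2, h3⟩ <;> exact ⟨h1, by omega, by simp only [] at *; omega⟩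
      have hj : (kap.cells.filter fun y => T y.1 y.2 = i + 1 ∧ y.1 = q + 1 ∧
          squareBefore y (q + 1, c)) =
          kap.cells.filter fun y => T y.1 y.2 = i + 1 ∧ y.1 = q + 1 ∧ y.2 < c := by
        refine Finset.filter_congr fun y _ => ?_
        unfold squareBefore
        constructor <;> rintro ⟨h1, h2, h3⟩ <;> exact ⟨h1, by omega, by simp only [] at *; omega⟩
      have ha : (kap.cells.filter fun y => T y.1 y.2 = i ∧ y.1 + 1 = q + 1) =
          kap.cells.filter fun y => T y.1 y.2 = i ∧ y.1 = q := by
        refine Finset.filter_congr fun y _ => ?_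
        simp
      rw [hz, hj, ha, card_filter_row, card_filter_row, card_filter_row', card_filter_row']
      rw [YoungDiagram.mem_cells] at hx
      have h1 := (T.entry_eq_iff hx).1 hxi
      have h2 := T.rows_strip i q
      have h3 := T.rows_strip (i + 1) q
      simp only [add_assoc, Nat.reduceAdd] at *
      constructor <;> omega
  refine ⟨⟨fun x _ h => ?_, fun x _ y _ z _ h h' => ?_, fun x _ y _ => ?_⟩, ?_, ?_, ?_, ?_, ?_⟩
  · unfold squareBefore at h; omega
  · unfold squareBefore at *; omega
  · unfold squareBefore
    rcases x with ⟨r, c⟩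
    rcases y with ⟨r', c'⟩
    simp only [Prod.mk.injEq]
    omega
  · intro x hx y hy hxi hyi hxy
    by_contra hlt
    have := T.entry_lt_entry (r := x.1) (r' := y.1) (c := x.2) (c' := y.2) (by omega)
      (by unfold squareBefore at hxy; omega) hy
    simp only [hxi, hyi] at this
    omega
  · intro x hx y hy hxi hyi hle
    by_contra hlt
    have := T.entry_le_entry (r := x.1) (r' := y.1) (c := x.2) (c' := y.2) hle
      (by unfold squareBefore at hlt; omega) hy
    simp only [hxi, hyi] at this
    omega
  · intro x hx y hy hxi hyi hlt
    by_contra hno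
    have hyx : y.2 ≤ x.2 := by unfold squareBefore at hno; omega
    have h1 := T.entry_lt_entry (r := y.1) (r' := y.1 + 1) (c := y.2) (c' := x.2) (by omega) hyx
      (kap.up_left_mem hlt.le le_rfl hx)
    have h2 := T.entry_lt_entry (r := y.1 + 1) (r' := x.1) (c := x.2) (c' := x.2) hlt le_rfl hx
    have hxi : T x.1 x.2 = i + 1 := hxi
    have hyi : T y.1 y.2 = i := hyi
    omega
  · intro x hx hxi
    left
    rcases hcount x hx hxi with ⟨h0, h1⟩ | ⟨z, j, a, b, h1, h2, h3, h4, h5, -⟩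
    · calc _ = 0 := h1
        _ ≤ _ := Nat.zero_le _
    · rw [← h1, ← h2] at h5
      exact h5
  · intro x hx hxi
    rcases hcount x hx hxi with ⟨h0, h1⟩ | ⟨z, j, a, b, h1, h2, h3, h4, -, h5⟩
    · intro _ h3
      exact ne_of_lt (lt_of_eq_of_lt h1 h3)
    · rw [← h1, ← h2, ← h3, ← h4] at h5
      exact h5

/-- The leftmost entry `i + 1` of a row has column `T.rows (i + 1) s`. -/
theorem eq_of_leftmost {i : ℕ} {x : ℕ × ℕ} (hx : x ∈ kap) (hxi : T x.1 x.2 = i + 1)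
    (hleft : ∀ y ∈ kap.cells, T y.1 y.2 = i + 1 → y.1 = x.1 → ¬ squareBefore y x) :
    x = (x.1, T.rows (i + 1) x.1) ∧ T.rows (i + 1) x.1 < T.rows (i + 2) x.1 := by
  have h1 := (T.entry_eq_iff hx).1 hxi
  have h2 : T.rows (i + 1) x.1 < T.rows (i + 2) x.1 := lt_of_le_of_lt h1.1 h1.2
  refine ⟨?_, h2⟩
  by_contra hne
  have h3 : T.rows (i + 1) x.1 < x.2 :=
    lt_of_le_of_ne h1.1 fun h => hne (Prod.ext rfl h.symm)
  have h4 := (T.lt_rows_iff.1 h2).1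
  exact hleft (x.1, T.rows (i + 1) x.1) h4 ((T.entry_eq_iff h4).2 ⟨le_rfl, h2⟩) rfl (Or.inl h3)

theorem rows_of_change {T T' : SemistandardYoungTableau kap} {i s : ℕ}
    (h : T.rows (i + 1) s < T.rows (i + 2) s)
    (hT : ∀ r c, T' r c = if (r, c) = (s, T.rows (i + 1) s) then i else T r c) (p r : ℕ) :
    T'.rows p r = T.rows p r + if p = i + 1 ∧ r = s then 1 else 0 := by
  have hs := (T.lt_rows_iff.1 h).1
  have hi := (T.entry_eq_iff hs).2 ⟨le_rfl, h⟩
  have key : ∀ c, c < T'.rows p r ↔ c < T.rows p r + if p = i + 1 ∧ r = s then 1 else 0 := by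
    intro c
    have h1 := T.lt_rows_iff (p := p) (r := r) (c := c)
    rw [T'.lt_rows_iff, hT]
    by_cases hrc : (r, c) = (s, T.rows (i + 1) s)
    · rw [if_pos hrc]
      simp only [Prod.mk.injEq] at hrc
      obtain ⟨rfl, rfl⟩ := hrc
      simp only [hs, true_and, and_true] at *
      rw [hi] at h1
      by_cases hp : p = i + 1
      · subst hp
        simp
      · rw [if_neg hp, add_zero, h1]
        omega
    · rw [if_neg hrc, ← h1]
      split_ifs with hp
      · obtain ⟨rfl, rfl⟩ := hp
        have : c ≠ T.rows (i + 1) r := fun h => hrc (by rw [h])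
        omega
      · simp
  have h1 := key (T'.rows p r)
  have h2 := key (T.rows p r + if p = i + 1 ∧ r = s then 1 else 0)
  omega

theorem chain_of_change {T T' : SemistandardYoungTableau kap} {i s : ℕ}
    (h : T.rows (i + 1) s < T.rows (i + 2) s)
    (hT : ∀ r c, T' r c = if (r, c) = (s, T.rows (i + 1) s) then i else T r c) :
    T'.chain = chainBump T.chain i s := by
  funext p r
  induction r with
  | zero =>
    by_cases hp : p = i + 1
    · subst hp
      rw [chainBump_self, bump, chain_zero, chain_zero]
      simp
    · rw [chainBump_ne _ hp, chain_zero, chain_zero]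
  | succ r ih =>
    rw [chain_succ, ih, rows_of_change h hT]
    by_cases hp : p = i + 1
    · subst hp
      rw [chainBump_self, bump, bump, chain_succ]
      simp only [true_and]
      split_ifs <;> push_cast <;> omega
    · rw [chainBump_ne _ hp, chain_succ]
      simp [hp]

end SemistandardYoungTableau

open SemistandardYoungTableau

/-- The coplactic operation changes the chain of a Young tableau in the row where the excess has its
first maximum. -/
theorem YoungRaise.chain_eq {kap : YoungDiagram} {i : ℕ} {T T' : SemistandardYoungTableau kap}
    (h : YoungRaise i T T') : ∃ s, IsFirstMax (chainExcess T.chain i) s ∧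
      0 < chainExcess T.chain i s ∧ T'.chain = chainBump T.chain i s := by
  obtain ⟨x, hx, hT⟩ := h
  have hc := (T.isRowCompatible i).isFirstMax_of_isRaisingPlace hx
  rw [T.rowExcess_eq] at hc
  obtain ⟨h1, h2, h3, h4⟩ := hc
  have h5 := T.eq_of_leftmost hx.1.1 h1 h4
  refine ⟨x.1, h2, h3, chain_of_change h5.2 ?_⟩
  rw [← h5.1]
  exact hT

theorem exists_youngRaise {kap : YoungDiagram} {i s : ℕ} (T : SemistandardYoungTableau kap)
    (h : IsFirstMax (chainExcess T.chain i) s) (hpos : 0 < chainExcess T.chain i s) :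
    ∃ T', YoungRaise i T T' ∧ T'.chain = chainBump T.chain i s := by
  have hfm := h
  have hps := hpos
  rw [← T.rowExcess_eq] at h hpos
  obtain ⟨x, hx, h1, h2, h4⟩ := (T.isRowCompatible i).exists_isRaisingPlace h hpos
  subst h2
  have h5 := T.eq_of_leftmost hx.1.1 h1 h4
  set k := T.rows (i + 1) x.1 with hk
  have hxm : (x.1, k) ∈ kap := by rw [← h5.1]; exact hx.1.1
  have hxi : T x.1 k = i + 1 := by
    have := h1
    rw [h5.1] at this
    exact this
  -- the square above the changed one has an entry less than `i`
  have habove : ∀ q, q < x.1 → T q k < i := by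
    intro q hq
    obtain ⟨t, ht⟩ := Nat.exists_eq_add_of_lt hq
    have h6 := hfm.2 (q + t) (by omega)
    have h7 := T.rows_strip (i + 1) (q + t)
    have h8 := T.chain_succ i (q + t)
    have h9 := T.chain_succ (i + 1) (q + t)
    have h10 := T.chain_succ (i + 1) (q + t + 1)
    have h11 := T.chain_succ (i + 2) (q + t + 1)
    have h12 : T.rows (i + 1) (q + t + 1) = k := by rw [hk, ht]
    unfold chainExcess excess at h6
    rw [ht] at h6
    have h13 : k < T.rows i (q + t) := by
      simp only [add_assoc, Nat.reduceAdd] at *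
      omega
    have h14 := T.lt_rows_iff.1 h13
    exact (T.col_weak (by omega : q ≤ q + t) h14.1).trans_lt h14.2
  let T' : SemistandardYoungTableau kap :=
    { entry := fun r c => if (r, c) = (x.1, k) then i else T r c
      row_weak' := by
        intro r c1 c2 hc hm
        simp only [Prod.mk.injEq]
        have h6 := T.row_weak hc hm
        split_ifs with g1 g2 g2
        · exact le_rfl
        · rw [g1.1, g1.2, hxi, ← g1.1] at h6
          rw [← g1.1] at *
          omega
        · have h7 := T.lt_rows_iff (p := i + 1) (r := r) (c := c1)
          rw [g2.1] at h7
          have := (h7.1 (by rw [← hk]; omega)).2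
          rw [← g2.1] at this
          omega
        · exact h6
      col_strict' := by
        intro r1 r2 c hr hm
        simp only [Prod.mk.injEq]
        have h6 := T.col_strict hr hm
        split_ifs with g1 g2 g2
        · omega
        · rw [g1.1, g1.2, hxi] at h6
          rw [g1.2]
          omega
        · rw [g2.2]
          exact habove r1 (by omega)
        · exact h6
      zeros' := by
        intro r c hm
        have : (r, c) ≠ (x.1, k) := fun h => hm (h ▸ hxm)
        rw [if_neg this]
        exact T.zeros hm }
  have hT' : ∀ r c, T' r c = if (r, c) = (x.1, k) then i else T r c := fun _ _ => rfl
  refine ⟨T', ⟨x, hx, fun r c => ?_⟩, chain_of_change h5.2 hT'⟩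
  rw [hT', ← h5.1]

/-- The coplactic operations are injective. -/
theorem YoungRaise.source_unique {kap : YoungDiagram} {i : ℕ}
    {T₁ T₂ T' : SemistandardYoungTableau kap} (h₁ : YoungRaise i T₁ T') (h₂ : YoungRaise i T₂ T') :
    T₁ = T₂ := by
  obtain ⟨s, hs, -, e1⟩ := h₁.chain_eq
  obtain ⟨t, ht, -, e2⟩ := h₂.chain_eq
  have hne : ∀ p, p ≠ i + 1 → T₁.chain p = T₂.chain p := by
    intro p hp
    rw [← chainBump_ne T₁.chain (s := s) hp, ← chainBump_ne T₂.chain (s := t) hp, ← e1, ← e2]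
  have he : bump s (T₁.chain (i + 1)) = bump t (T₂.chain (i + 1)) := by
    rw [← chainBump_self, ← chainBump_self, ← e1, ← e2]
  -- the changed row is the last one in which the new excess is maximal
  have hlt : ∀ {T₁ T₂ : SemistandardYoungTableau kap} {s t : ℕ},
      IsFirstMax (chainExcess T₁.chain i) s → IsFirstMax (chainExcess T₂.chain i) t →
      (∀ p, p ≠ i + 1 → T₁.chain p = T₂.chain p) →
      bump s (T₁.chain (i + 1)) = bump t (T₂.chain (i + 1)) → ¬ s < t := by
    intro T₁ T₂ s t hs ht hne he hst
    have h1 := hs.1 t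
    have h2 := ht.2 s hst
    unfold chainExcess excess at h1 h2
    rw [hne i (by omega), hne (i + 2) (by omega)] at h1
    have a1 := congrFun he s
    have a2 := congrFun he (s + 1)
    have a3 := congrFun he t
    have a4 := congrFun he (t + 1)
    unfold bump at a1 a2 a3 a4
    split_ifs at a1 a2 a3 a4 <;> omega
  have hst : s = t := by
    have h1 := hlt hs ht hne he
    have h2 := hlt ht hs (fun p hp => (hne p hp).symm) he.symm
    omega
  subst hst
  refine eq_of_chain_eq fun p => ?_
  by_cases hp : p = i + 1
  · subst hp
    funext r
    have := congrFun he r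
    unfold bump at this
    omega
  · exact hne p hp

/-! ### Canonical tableaux -/

theorem canonicalTableau_of_excess_nonpos (T : YoungTableau)
    (h : ∀ i r, chainExcess T.2.chain i r ≤ 0) : T = canonicalTableau T.1 := by
  obtain ⟨kap, T⟩ := T
  -- by induction on `p`, the entries `p` are in row `p`
  have hrow : ∀ p r, r ≤ p → T.chain (p + 1) r = T.chain p r := by
    intro p
    induction p with
    | zero =>
      intro r hr
      obtain rfl : r = 0 := by omega
      rw [chain_zero, chain_zero]
    | succ p ih =>
      have h0 : ∀ r, T.chain (p + 1) r ≤ T.chain (p + 2) r := by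
        intro r
        induction r with
        | zero => rw [chain_zero, chain_zero]
        | succ r ih =>
          rw [chain_succ, chain_succ]
          have : T.rows (p + 1) r ≤ T.rows (p + 2) r := T.rows_mono (p + 1) r
          omega
      intro r hr
      cases r with
      | zero => rw [chain_zero, chain_zero]
      | succ r =>
        have h1 : chainExcess T.chain p r ≤ 0 := h p r
        unfold chainExcess excess at h1
        have h2 := h0 (r + 1)
        have h3 := ih r (by omega)
        simp only [add_assoc, Nat.reduceAdd] at *
        omega
  have : T = SemistandardYoungTableau.highestWeight kap := by
    refine SemistandardYoungTableau.ext fun r c => ?_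
    rw [SemistandardYoungTableau.highestWeight_apply]
    split_ifs with hm
    · refine le_antisymm ?_ (T.row_le_entry hm)
      by_contra hlt
      have h1 := (T.entry_eq_iff hm).1 rfl
      have h2 := hrow (T r c) r (by omega)
      have h3 := hrow (T r c) (r + 1) (by omega)
      rw [chain_succ, chain_succ] at h3
      omega
    · exact T.zeros hm
  rw [this]
  rfl

theorem not_youngRaise_highestWeight {kap : YoungDiagram} {i : ℕ}
    {T' : SemistandardYoungTableau kap} : ¬ YoungRaise i (.highestWeight kap) T' := by
  rintro ⟨x, hx, hT⟩
  have h1 := (isRowCompatible _ i).isFirstMax_of_isRaisingPlace hx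
  have h2 : (SemistandardYoungTableau.highestWeight kap) x.1 x.2 = i + 1 := h1.1
  have h3 := T'.row_le_entry (r := x.1) (c := x.2) hx.1.1
  rw [hT, if_pos rfl] at h3
  have h4 : x ∈ kap := hx.1.1
  rw [SemistandardYoungTableau.highestWeight_apply, if_pos h4] at h2
  omega

theorem canonicalTableau_weight (kap : YoungDiagram) (k : ℕ) :
    (canonicalTableau kap).toSkew.weight k = kap.rowLen k := by
  unfold SkewTableau.weight
  have h1 : (canonicalTableau kap).toSkew.outer.cells \
      (canonicalTableau kap).toSkew.inner.cells = kap.cells := by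
    simp [YoungTableau.toSkew, canonicalTableau]
  rw [h1, ← Finset.card_range (kap.rowLen k)]
  symm
  refine Finset.card_bij (fun c _ => (k, c)) ?_ ?_ ?_
  · intro c hc
    rw [Finset.mem_range, ← YoungDiagram.mem_iff_lt_rowLen] at hc
    rw [Finset.mem_filter]
    exact ⟨hc, by
      show (SemistandardYoungTableau.highestWeight kap) k c = k
      rw [SemistandardYoungTableau.highestWeight_apply, if_pos hc]⟩
  · intro c _ c' _ h
    exact congrArg Prod.snd h
  · rintro ⟨r, c⟩ hs
    rw [Finset.mem_filter] at hs
    obtain ⟨h2, h3⟩ := hs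
    have h3 : (SemistandardYoungTableau.highestWeight kap) r c = k := h3
    have h2 : (r, c) ∈ kap := h2
    rw [SemistandardYoungTableau.highestWeight_apply, if_pos h2] at h3
    subst h3
    exact ⟨c, Finset.mem_range.2 (YoungDiagram.mem_iff_lt_rowLen.1 h2), rfl⟩

/-! ### Repairing a filling -/

/-- A finite set of labelled dominoes that do not overlap. -/
def IsPacking (F : Finset (Domino × ℕ)) : Prop :=
  ∀ x ∈ F, ∀ y ∈ F, x ≠ y → Disjoint x.1.cells y.1.cells

/-- Dominoes of a packing may be replaced by dominoes that cover no other squares. -/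
theorem IsPacking.replace {F A B : Finset (Domino × ℕ)} (hF : IsPacking F) (hA : A ⊆ F)
    (hB : IsPacking B) (hAB : ∀ y ∈ B, ∀ s ∈ y.1.cells, ∃ z ∈ A, s ∈ z.1.cells) :
    IsPacking ((F \ A) ∪ B) ∧ ∀ φ : Domino × ℕ → ℤ,
      ∑ y ∈ (F \ A) ∪ B, φ y = ∑ y ∈ F, φ y - ∑ y ∈ A, φ y + ∑ y ∈ B, φ y := by
  have hdisj : ∀ x ∈ F \ A, ∀ y ∈ B, Disjoint x.1.cells y.1.cells := by
    intro x hx y hy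
    rw [Finset.mem_sdiff] at hx
    refine Finset.disjoint_left.2 fun s hs hs' => ?_
    obtain ⟨z, hz, hzs⟩ := hAB y hy s hs'
    exact Finset.disjoint_left.1 (hF x hx.1 z (hA hz) fun h => hx.2 (h ▸ hz)) hs hzs
  refine ⟨fun x hx y hy hne => ?_, fun φ => ?_⟩
  · rw [Finset.mem_union] at hx hy
    rcases hx with hx | hx <;> rcases hy with hy | hy
    · exact hF x (Finset.mem_sdiff.1 hx).1 y (Finset.mem_sdiff.1 hy).1 hne
    · exact hdisj x hx y hy
    · exact (hdisj y hy x hx).symm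
    · exact hB x hx y hy hne
  · rw [Finset.sum_union, ← Finset.sum_sdiff hA]
    · ring
    · refine Finset.disjoint_left.2 fun x hx hx' => ?_
      have h := hdisj x hx x hx'
      rw [disjoint_self, Finset.bot_eq_empty] at h
      have h1 : (x.1.row, x.1.col) ∈ x.1.cells := by simp [Domino.cells]
      rw [h] at h1
      exact absurd h1 (Finset.notMem_empty _)

theorem sum_triple {α : Type*} [DecidableEq α] {a b c : α} (hab : a ≠ b) (hac : a ≠ c) (hbc : b ≠ c)
    (φ : α → ℤ) : ∑ y ∈ ({a, b, c} : Finset α), φ y = φ a + φ b + φ c := by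
  rw [Finset.sum_insert (by simp [hab, hac]), Finset.sum_insert (by simp [hbc]),
    Finset.sum_singleton, add_assoc]

theorem mem_replace_iff {α : Type*} [DecidableEq α] {F A B : Finset α} {y : α} (hA : y ∉ A)
    (hB : y ∉ B) : y ∈ (F \ A) ∪ B ↔ y ∈ F := by
  simp [hA, hB]

/-- What a single repair does to the dominoes: the effect of each of the rearrangements on a sum
over the dominoes. -/
theorem Repair.spec {i : ℕ} {F F' : Finset (Domino × ℕ)} (h : Repair i F F') (hF : IsPacking F) :
    IsPacking F' ∧ (∀ d q, q ≠ i → q ≠ i + 1 → ((d, q) ∈ F' ↔ (d, q) ∈ F)) ∧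
    ((∃ r c, ∀ φ : Domino × ℕ → ℤ, ∑ y ∈ F', φ y = ∑ y ∈ F, φ y -
        (φ (.horiz r c, i) + φ (.horiz (r + 1) c, i + 1) + φ (.vert r (c + 2), i)) +
        (φ (.vert r c, i) + φ (.horiz r (c + 1), i) + φ (.horiz (r + 1) (c + 1), i + 1))) ∨
      (∃ r c c₁ c₂, ∀ φ : Domino × ℕ → ℤ, ∑ y ∈ F', φ y = ∑ y ∈ F, φ y -
        (φ (.horiz r c, i) + φ (.vert (r + 1) c₁, i) + φ (.vert (r + 1) c₂, i + 1)) +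
        (φ (.vert r c, i) + φ (.vert r (c + 1), i) + φ (.horiz (r + 2) c, i + 1)))) := by
  cases h with
  | shiftLeft r c h =>
    have hr := hF.replace h (B := {(Domino.vert r c, i), (Domino.horiz r (c + 1), i),
      (Domino.horiz (r + 1) (c + 1), i + 1)}) (by
        intro x hx y hy hne
        simp only [Finset.mem_insert, Finset.mem_singleton] at hx hy
        refine Finset.disjoint_left.2 ?_
        rintro ⟨u, v⟩ hu hv
        rcases hx with rfl | rfl | rfl <;> rcases hy with rfl | rfl | rfl <;>
          first
          | exact hne rfl
          | (simp only [Domino.mem_vert, Domino.mem_horiz, Prod.mk.injEq] at hu hv; omega)) (by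
        intro y hy s hs
        simp only [Finset.mem_insert, Finset.mem_singleton] at hy
        simp only [Finset.mem_insert, Finset.mem_singleton, exists_eq_or_imp, exists_eq_left,
          Domino.mem_vert, Domino.mem_horiz]
        rcases hy with rfl | rfl | rfl <;>
          simp only [Domino.mem_vert, Domino.mem_horiz] at hs <;> rcases hs with rfl | rfl <;> simp)
    refine ⟨hr.1, fun d q h1 h2 => mem_replace_iff (by simp [h1, h2]) (by simp [h1, h2]),
      Or.inl ⟨r, c, fun φ => ?_⟩⟩
    rw [hr.2, sum_triple, sum_triple] <;> simp [Domino.vert, Domino.horiz]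
  | shiftUp₁ r c h =>
    have hr := hF.replace h (B := {(Domino.vert r c, i), (Domino.vert r (c + 1), i),
      (Domino.horiz (r + 2) c, i + 1)}) (by
        intro x hx y hy hne
        simp only [Finset.mem_insert, Finset.mem_singleton] at hx hy
        refine Finset.disjoint_left.2 ?_
        rintro ⟨u, v⟩ hu hv
        rcases hx with rfl | rfl | rfl <;> rcases hy with rfl | rfl | rfl <;>
          first
          | exact hne rfl
          | (simp only [Domino.mem_vert, Domino.mem_horiz, Prod.mk.injEq] at hu hv; omega)) (by
        intro y hy s hs
        simp only [Finset.mem_insert, Finset.mem_singleton] at hy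
        simp only [Finset.mem_insert, Finset.mem_singleton, exists_eq_or_imp, exists_eq_left,
          Domino.mem_vert, Domino.mem_horiz]
        rcases hy with rfl | rfl | rfl <;>
          simp only [Domino.mem_vert, Domino.mem_horiz] at hs <;> rcases hs with rfl | rfl <;> simp)
    refine ⟨hr.1, fun d q h1 h2 => mem_replace_iff (by simp [h1, h2]) (by simp [h1, h2]),
      Or.inr ⟨r, c, c, c + 1, fun φ => ?_⟩⟩
    rw [hr.2, sum_triple, sum_triple] <;> simp [Domino.vert, Domino.horiz]
  | shiftUp₂ r c h =>
    have hr := hF.replace h (B := {(Domino.vert r c, i), (Domino.vert r (c + 1), i),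
      (Domino.horiz (r + 2) c, i + 1)}) (by
        intro x hx y hy hne
        simp only [Finset.mem_insert, Finset.mem_singleton] at hx hy
        refine Finset.disjoint_left.2 ?_
        rintro ⟨u, v⟩ hu hv
        rcases hx with rfl | rfl | rfl <;> rcases hy with rfl | rfl | rfl <;>
          first
          | exact hne rfl
          | (simp only [Domino.mem_vert, Domino.mem_horiz, Prod.mk.injEq] at hu hv; omega)) (by
        intro y hy s hs
        simp only [Finset.mem_insert, Finset.mem_singleton] at hy
        simp only [Finset.mem_insert, Finset.mem_singleton, exists_eq_or_imp, exists_eq_left,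
          Domino.mem_vert, Domino.mem_horiz]
        rcases hy with rfl | rfl | rfl <;>
          simp only [Domino.mem_vert, Domino.mem_horiz] at hs <;> rcases hs with rfl | rfl <;> simp)
    refine ⟨hr.1, fun d q h1 h2 => mem_replace_iff (by simp [h1, h2]) (by simp [h1, h2]),
      Or.inr ⟨r, c, c + 1, c, fun φ => ?_⟩⟩
    rw [hr.2, sum_triple, sum_triple]
    · ring
    all_goals simp [Domino.vert, Domino.horiz]

/-- The number of squares with entry `i` above row `t`. -/
def squaresAbove (i t : ℕ) (y : Domino × ℕ) : ℤ :=
  if y.2 = i then (if y.1.row < t then 1 else 0) + (if y.1.lastRow < t then 1 else 0) else 0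

/-- The number of vertical dominoes with entry `i` and upper row `t`. -/
def verticalsAt (i t : ℕ) (y : Domino × ℕ) : ℤ :=
  if y.2 = i ∧ y.1.vertical = true ∧ y.1.row = t then 1 else 0

/-- The net effect of a sequence of repairs, where `k (t + 1)` is the number of those in a rectangle
of `3` rows with upper row `t`. -/
structure IsRepaired (i : ℕ) (F F' : Finset (Domino × ℕ)) (k : ℕ → ℤ) : Prop where
  packing : IsPacking F'
  mem_iff : ∀ d q, q ≠ i → q ≠ i + 1 → ((d, q) ∈ F' ↔ (d, q) ∈ F)
  zero : k 0 = 0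
  nonneg : ∀ t, 0 ≤ k t
  squares : ∀ t, ∑ y ∈ F', squaresAbove i (t + 1) y = ∑ y ∈ F, squaresAbove i (t + 1) y + k t
  lower : ∀ t, ∑ y ∈ F', verticalsAt i t y + k t = ∑ y ∈ F, verticalsAt i t y + 2 * k (t + 1)
  upper : ∀ t, ∑ y ∈ F', verticalsAt (i + 1) t y + k t = ∑ y ∈ F, verticalsAt (i + 1) t y

theorem exists_isRepaired {i : ℕ} {F F' : Finset (Domino × ℕ)} (hF : IsPacking F)
    (h : Relation.ReflTransGen (Repair i) F F') : ∃ k, IsRepaired i F F' k := by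
  induction h with
  | refl => exact ⟨fun _ => 0, hF, fun _ _ _ _ => Iff.rfl, rfl, fun _ => le_rfl, by simp, by simp,
      by simp⟩
  | tail _ h ih =>
    obtain ⟨k, hk⟩ := ih
    obtain ⟨h1, h2, h3⟩ := h.spec hk.packing
    rcases h3 with ⟨r, c, h3⟩ | ⟨r, c, c₁, c₂, h3⟩
    · refine ⟨k, h1, fun d q hq hq' => (h2 d q hq hq').trans (hk.mem_iff d q hq hq'), hk.zero,
        hk.nonneg, fun t => ?_, fun t => ?_, fun t => ?_⟩
      · rw [h3, ← hk.squares]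
        simp [squaresAbove, Domino.row_vert, Domino.row_horiz, Domino.lastRow_vert,
          Domino.lastRow_horiz]
        ring
      · rw [h3, ← hk.lower]
        simp [verticalsAt, Domino.vert, Domino.horiz]
      · rw [h3, ← hk.upper]
        simp [verticalsAt, Domino.vert, Domino.horiz]
    · refine ⟨fun t => k t + if t = r + 1 then 1 else 0, h1,
        fun d q hq hq' => (h2 d q hq hq').trans (hk.mem_iff d q hq hq'), by simp [hk.zero],
        fun t => ?_, fun t => ?_, fun t => ?_, fun t => ?_⟩
      · have := hk.nonneg t
        split_ifs <;> omega
      · have := hk.squares t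
        rw [h3]
        simp [squaresAbove, Domino.row_vert, Domino.row_horiz, Domino.lastRow_vert,
          Domino.lastRow_horiz] at *
        split_ifs <;> omega
      · have := hk.lower t
        rw [h3]
        simp [verticalsAt, Domino.vert, Domino.horiz] at *
        split_ifs <;> omega
      · have := hk.upper t
        rw [h3]
        simp [verticalsAt, Domino.vert, Domino.horiz] at *
        split_ifs <;> omega

namespace DominoTableau

variable {lam mu : YoungDiagram} (D : DominoTableau lam mu)

theorem sum_squaresAbove (i t : ℕ) :
    ∑ y ∈ D.dominoes, squaresAbove i t y = D.chain (i + 1) t - D.chain i t := by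
  classical
  have h := D.card_filter_lt i t
  have h1 : ∑ y ∈ D.dominoes, squaresAbove i t y =
      ((D.dominoes.filter fun x => x.2 = i ∧ x.1.row < t).card : ℤ) +
        (D.dominoes.filter fun x => x.2 = i ∧ x.1.lastRow < t).card := by
    rw [Finset.card_filter, Finset.card_filter]
    push_cast
    rw [← Finset.sum_add_distrib]
    refine Finset.sum_congr rfl fun y _ => ?_
    unfold squaresAbove
    split_ifs <;> simp_all
  rw [h1]
  omega

theorem sum_verticalsAt (i t : ℕ) : ∑ y ∈ D.dominoes, verticalsAt i t y =
    ((D.rows (i + 1) (t + 1) - D.rows i t : ℕ) : ℤ) := by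
  have h := D.card_filter_vert i t (D.rows (i + 1) (t + 1))
  rw [min_self] at h
  rw [← h, Finset.card_filter]
  push_cast
  refine Finset.sum_congr rfl fun y hy => ?_
  unfold verticalsAt
  congr 1
  simp only [eq_iff_iff]
  constructor
  · rintro ⟨h1, h2, h3⟩
    refine ⟨h1, h2, h3, ?_⟩
    have h4 := (D.lastCol_lt hy).2
    have h5 : y.1.lastRow = t + 1 := by rw [Domino.lastRow, if_pos h2, h3]
    rwa [h1, h5] at h4
  · rintro ⟨h1, h2, h3, -⟩
    exact ⟨h1, h2, h3⟩

theorem below_eq_of_mem_iff {D D' : DominoTableau lam mu} {i : ℕ}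
    (h : ∀ d q, q ≠ i → q ≠ i + 1 → ((d, q) ∈ D'.dominoes ↔ (d, q) ∈ D.dominoes)) {p : ℕ}
    (hp : p ≠ i + 1) : D'.below p = D.below p := by
  have key : ∀ D D' : DominoTableau lam mu,
      (∀ d q, q ≠ i → q ≠ i + 1 → ((d, q) ∈ D'.dominoes ↔ (d, q) ∈ D.dominoes)) →
      ∀ s, s ∈ D.below p → s ∈ D'.below p := by
    intro D D' h s hs
    rw [mem_below] at hs ⊢
    rcases hs with hs | ⟨⟨d, q⟩, hx, hq, hs⟩
    · exact Or.inl hs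
    · right
      by_cases h1 : q = i ∨ q = i + 1
      · obtain ⟨⟨d', q'⟩, hy, hs'⟩ := (D'.mem_iff s).1 ((D.mem_iff s).2 ⟨_, hx, hs⟩)
        refine ⟨_, hy, ?_, hs'⟩
        by_contra hlt
        simp only [not_lt] at hlt hq
        have h2 := (h d' q' (by omega) (by omega)).1 hy
        have h3 := D.eq_of_mem hx h2 hs hs'
        rw [Prod.mk.injEq] at h3
        omega
      · exact ⟨_, (h d q (by omega) (by omega)).2 hx, hq, hs⟩
  refine YoungDiagram.ext ?_
  ext s
  exact ⟨key D' D (fun d q hq hq' => (h d q hq hq').symm) s, key D D' h s⟩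

end DominoTableau

/-! ### The effect of a raising step -/

open scoped Classical in
/-- The recursion that determines the numbers of repairs. -/
theorem repairs_unique {m k k' l : ℕ → ℕ} {n : ℕ → ℤ} {r : ℕ} (v : Prop)
    (h0 : n 0 = 0) (hn : ∀ t, 0 ≤ n t)
    (hk : ∀ t, (k' (t + 1) : ℤ) = k (t + 1) +
      (if v then (if t + 1 = r then 1 else 0) + (if t = r then 1 else 0)
        else if t + 1 = r then 2 else 0) + n (t + 1) - n t)
    (hlow : ∀ t, ((k' (t + 1) - m t : ℕ) : ℤ) + n t =
      ((k (t + 1) - m t : ℕ) : ℤ) + (if v ∧ t = r then 1 else 0) + 2 * n (t + 1))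
    (hup : ∀ t, ((l (t + 1) - k' t : ℕ) : ℤ) + n t =
      ((l (t + 1) - k t : ℕ) : ℤ) - (if v ∧ t = r then 1 else 0))
    (hv : ¬ v → l (r + 1) ≤ k r) (t : ℕ) :
    n t = if v ∧ t = r ∧ ∃ q, q + 1 = r ∧ m q ≤ k r then 1 else 0 := by
  have hex : ∀ t, t + 1 = r → ((∃ q, q + 1 = r ∧ m q ≤ k r) ↔ m t ≤ k r) := by
    rintro t rfl
    exact ⟨fun ⟨q, hq, h⟩ => by rwa [show q = t by omega] at h, fun h => ⟨t, rfl, h⟩⟩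
  induction t with
  | zero =>
    rw [h0, if_neg]
    rintro ⟨-, h, q, hq, -⟩
    omega
  | succ t ih =>
    have h1 := hk t
    have h2 := hlow t
    have h3 := hup t
    have h4 := hup (t + 1)
    have h5 := hn (t + 1)
    by_cases hvv : v
    · simp only [hvv, if_true, true_and] at *
      by_cases htr : t + 1 = r
      · rw [hex t htr]
        have htr' : ¬ t = r := by omega
        simp only [htr, htr', false_and, if_false, if_true, true_and] at *
        split_ifs <;> omega
      · by_cases htr' : t = r
        · simp only [htr', if_true, true_and] at *
          split_ifs at ih <;> simp only [htr, if_false, false_and] at * <;> omega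
        · simp only [htr, htr', if_false, false_and] at *
          omega
    · have hle := hv hvv
      simp only [hvv, if_false, false_and] at *
      by_cases htr : t + 1 = r
      · subst htr
        simp only [if_true] at *
        omega
      · simp only [htr, if_false] at *
        omega

namespace DominoTableau

variable {lam mu : YoungDiagram} (D : DominoTableau lam mu)

/-- The first domino of row `r` with a given entry. -/
theorem eq_of_leftmost {p : ℕ} {x : Domino} (hx : (x, p) ∈ D.dominoes)
    (hleft : ∀ y ∈ D.dominoes, y.2 = p → y.1.row = x.row → ¬ dominoBefore y (x, p)) :
    (D.rows p x.row < D.rows (p + 1) (x.row + 1) ∧ x = .vert x.row (D.rows p x.row)) ∨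
    (D.rows (p + 1) (x.row + 1) ≤ D.rows p x.row ∧ x = .horiz x.row (D.rows p x.row)) := by
  have htile := (D.mem_dominoes_iff _ _).1 hx
  rcases lt_or_ge (D.rows p x.row) (D.rows (p + 1) (x.row + 1)) with h | h
  · refine Or.inl ⟨h, ?_⟩
    by_contra hne
    refine hleft (.vert x.row (D.rows p x.row), p) (D.vert_mem le_rfl h) rfl rfl (Or.inl ?_)
    simp only [Domino.lastCol_vert]
    rcases x.eq_vert_or_eq_horiz with ⟨r, c, rfl⟩ | ⟨r, c, rfl⟩
    · rw [isTile_vert] at htile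
      simp only [Domino.row_vert, Domino.lastCol_vert] at *
      refine lt_of_le_of_ne htile.1 fun h => hne (by rw [h])
    · rw [isTile_horiz] at htile
      simp only [Domino.row_horiz, Domino.lastCol_horiz] at *
      omega
  · refine Or.inr ⟨h, ?_⟩
    rcases x.eq_vert_or_eq_horiz with ⟨r, c, rfl⟩ | ⟨r, c, rfl⟩
    · rw [isTile_vert] at htile
      simp only [Domino.row_vert] at *
      omega
    · rw [isTile_horiz] at htile
      simp only [Domino.row_horiz] at *
      by_contra hne
      have hc : c ≠ D.rows p r := fun h => hne (by rw [h])
      refine hleft (.horiz r (D.rows p r), p) ((D.mem_dominoes_iff _ _).2 ?_) rfl rfl (Or.inl ?_)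
      · rw [isTile_horiz]
        omega
      · simp only [Domino.lastCol_horiz]
        omega

theorem sum_change {x : Domino} {p q : ℕ} (hx : (x, p) ∈ D.dominoes) (hpq : p ≠ q)
    (φ : Domino × ℕ → ℤ) : ∑ y ∈ insert (x, q) (D.dominoes.erase (x, p)), φ y =
      ∑ y ∈ D.dominoes, φ y - φ (x, p) + φ (x, q) := by
  rw [Finset.sum_insert, ← Finset.add_sum_erase _ _ hx]
  · ring
  · intro h
    have h1 : (x.row, x.col) ∈ x.cells := by simp [Domino.cells]
    have := D.eq_of_mem hx (Finset.mem_of_mem_erase h) h1 h1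
    simp only [Prod.mk.injEq, true_and] at this
    exact hpq this

theorem isPacking_change {x : Domino} {p q : ℕ} (hx : (x, p) ∈ D.dominoes) :
    IsPacking (insert (x, q) (D.dominoes.erase (x, p))) := by
  have h : ∀ y ∈ D.dominoes.erase (x, p), Disjoint x.cells y.1.cells := by
    intro y hy
    rw [Finset.mem_erase] at hy
    exact D.disjoint _ hx y hy.2 fun h => hy.1 h.symm
  intro y hy z hz hne
  rw [Finset.mem_insert] at hy hz
  rcases hy with rfl | hy <;> rcases hz with rfl | hz
  · exact absurd rfl hne
  · exact h z hz
  · exact (h y hy).symm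
  · exact D.disjoint y (Finset.mem_of_mem_erase hy) z (Finset.mem_of_mem_erase hz) hne

open scoped Classical in
/-- The row `r` of the raising place, its first domino, and the repairs that are needed, determine
how the chain of a domino tableau changes. -/
theorem Raise.chain_eq {D D' : DominoTableau lam mu} {i : ℕ} (h : D.Raise i D') : ∃ r,
    IsFirstMax (rowExcess D.dominoes Prod.snd i (fun x => x.1.row) (fun x => x.1.lastRow)) r ∧
    0 < rowExcess D.dominoes Prod.snd i (fun x => x.1.row) (fun x => x.1.lastRow) r ∧
    (∀ p, p ≠ i + 1 → D'.below p = D.below p) ∧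
    D'.chain (i + 1) = bump (if D.rows (i + 1) r < D.rows (i + 2) (r + 1) ∧
      ¬ ∃ q, q + 1 = r ∧ D.rows i q ≤ D.rows (i + 1) r then r + 1 else r)
        (bump r (D.chain (i + 1))) := by
  obtain ⟨⟨x, p⟩, hx, hrep⟩ := h
  obtain ⟨hp, h1, h2, h3⟩ := (D.isRowCompatible i).isFirstMax_of_isRaisingPlace hx
  obtain rfl : p = i + 1 := hp
  have hxD : (x, i + 1) ∈ D.dominoes := hx.1.1
  have hshape := D.eq_of_leftmost hxD h3
  obtain ⟨n, hn⟩ := exists_isRepaired (D.isPacking_change hxD) hrep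
  have hmem : ∀ d q, q ≠ i → q ≠ i + 1 → ((d, q) ∈ D'.dominoes ↔ (d, q) ∈ D.dominoes) := by
    intro d q hq hq'
    rw [hn.mem_iff d q hq hq']
    simp [hq, hq']
  have hbelow : ∀ p, p ≠ i + 1 → D'.below p = D.below p := fun p hp => below_eq_of_mem_iff hmem hp
  refine ⟨x.row, h1, h2, hbelow, ?_⟩
  have hm : D'.rows i = D.rows i := by unfold rows; rw [hbelow i (by omega)]
  have hl : D'.rows (i + 2) = D.rows (i + 2) := by unfold rows; rw [hbelow (i + 2) (by omega)]
  have hcm : D'.chain i = D.chain i := by unfold chain; rw [hbelow i (by omega)]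
  set r := x.row with hr
  obtain ⟨v, hv⟩ : ∃ v : Prop, v = (D.rows (i + 1) r < D.rows (i + 2) (r + 1)) := ⟨_, rfl⟩
  have hlast : x.lastRow = if v then r + 1 else r := by
    rcases hshape with ⟨h, hxe⟩ | ⟨h, hxe⟩
    · rw [if_pos (hv ▸ h), hxe]; rfl
    · rw [if_neg (hv ▸ not_lt.2 h), hxe]; rfl
  have hvert : x.vertical = true ↔ v := by
    rcases hshape with ⟨h, hxe⟩ | ⟨h, hxe⟩
    · rw [hv, hxe]; exact iff_of_true rfl h
    · rw [hv, hxe]; exact iff_of_false (by simp [Domino.horiz]) (not_lt.2 h)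
  have hsq : ∀ t, D'.chain (i + 1) (t + 1) = D.chain (i + 1) (t + 1) +
      ((if r < t + 1 then 1 else 0) + if (if v then r + 1 else r) < t + 1 then 1 else 0) + n t := by
    intro t
    have h4 := hn.squares t
    rw [D'.sum_squaresAbove, D.sum_change hxD (by omega), D.sum_squaresAbove, hcm] at h4
    simp only [squaresAbove, Nat.succ_ne_self, if_false, if_true, ← hr, hlast] at h4
    omega
  have hlow : ∀ t, ((D'.rows (i + 1) (t + 1) - D.rows i t : ℕ) : ℤ) + n t =
      ((D.rows (i + 1) (t + 1) - D.rows i t : ℕ) : ℤ) + (if v ∧ t = r then 1 else 0) +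
        2 * n (t + 1) := by
    intro t
    have h4 := hn.lower t
    rw [D'.sum_verticalsAt, D.sum_change hxD (by omega), D.sum_verticalsAt, hm] at h4
    simp only [verticalsAt, Nat.succ_ne_self, false_and, if_false, true_and, ← hr, hvert] at h4
    have h5 : (v ∧ r = t) ↔ (v ∧ t = r) := by rw [eq_comm]
    simp only [h5] at h4
    rw [h4]
    ring
  have hup : ∀ t, ((D.rows (i + 2) (t + 1) - D'.rows (i + 1) t : ℕ) : ℤ) + n t =
      ((D.rows (i + 2) (t + 1) - D.rows (i + 1) t : ℕ) : ℤ) - (if v ∧ t = r then 1 else 0) := by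
    intro t
    have h4 := hn.upper t
    rw [D'.sum_verticalsAt, D.sum_change hxD (by omega), D.sum_verticalsAt,
      show D'.rows (i + 1 + 1) = _ from hl] at h4
    simp only [verticalsAt, (Nat.succ_ne_self i).symm, false_and, if_false, true_and, ← hr,
      hvert] at h4
    simp only [add_assoc, Nat.reduceAdd] at h4
    have h5 : (v ∧ r = t) ↔ (v ∧ t = r) := by rw [eq_comm]
    simp only [h5] at h4
    rw [h4]
    ring
  have hk : ∀ t, (D'.rows (i + 1) (t + 1) : ℤ) = D.rows (i + 1) (t + 1) +
      (if v then (if t + 1 = r then 1 else 0) + (if t = r then 1 else 0)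
        else if t + 1 = r then 2 else 0) + n (t + 1) - n t := by
    intro t
    have h4 := hsq t
    have h5 := hsq (t + 1)
    rw [D'.chain_succ _ (t + 1), D.chain_succ _ (t + 1)] at h5
    by_cases hvv : v <;> simp only [hvv, if_true, if_false] at h4 h5 ⊢ <;>
      split_ifs at h4 h5 ⊢ <;> omega
  have hn' := repairs_unique (n := n) v hn.zero hn.nonneg hk hlow hup (fun h => not_lt.1 (hv ▸ h))
  funext t
  simp only [← hv]
  cases t with
  | zero => rw [chain_zero, bump, bump, chain_zero]; split_ifs <;> simp_all
  | succ t =>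
    rw [hsq, hn', bump, bump]
    by_cases hvv : v
    · by_cases hq : ∃ q, q + 1 = r ∧ D.rows i q ≤ D.rows (i + 1) r
      · simp only [hvv, hq, if_true, true_and, and_true, not_true, if_false]
        split_ifs <;> omega
      · simp only [hvv, hq, if_true, true_and, and_false, not_false_iff, if_false]
        split_ifs <;> omega
    · simp only [hvv, if_false, false_and]
      split_ifs <;> omega

end DominoTableau

namespace DominoTableau

variable {lam mu : YoungDiagram} (D : DominoTableau lam mu)

open scoped Classical in
/-- Raising a symmetric family, in terms of the domino tableau on its diagonal. -/
theorem exists_bump_rows {g : ℕ → ℕ → ℕ → ℤ} (hg : IsSymmFamily g)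
    (hD : ∀ p, g p p = D.chain p) {i r : ℕ}
    (hr : IsFirstMax
      (rowExcess D.dominoes Prod.snd i (fun x => x.1.row) (fun x => x.1.lastRow)) r) :
    ∃ f v, IsSymmFamily f ∧ (∀ p, p ≠ i + 1 → f p p = D.chain p) ∧
      f (i + 1) (i + 1) = bump (if D.rows (i + 1) r < D.rows (i + 2) (r + 1) ∧
        ¬ ∃ q, q + 1 = r ∧ D.rows i q ≤ D.rows (i + 1) r then r + 1 else r)
          (bump r (D.chain (i + 1))) ∧
      IsFirstMax (chainExcess (g 0) i) v ∧
      chainExcess (g 0) i v =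
        rowExcess D.dominoes Prod.snd i (fun x => x.1.row) (fun x => x.1.lastRow) r ∧
      f 0 = chainBump (g 0) i v ∧
      (D.rows (i + 2) (r + 1) ≤ D.rows (i + 1) r → ∀ q, q + 1 = r →
        D.rows (i + 1) r < D.rows i q) := by
  rw [D.rowExcess_eq hg hD] at hr ⊢
  obtain ⟨f, u, v, hf, hfp, hfi, hv, hve, hf0, hcases⟩ :=
    hg.exists_bump_cases hr (hD i) (hD (i + 1)) (hD (i + 2))
  have hl := D.chain_succ (i + 2) (r + 1)
  have hk := D.chain_succ (i + 1) r
  have hq1 : ∀ q, D.chain i (q + 1) = _ := D.chain_succ i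
  have hq2 : ∀ q, D.chain (i + 1) (q + 2) = _ := fun q => D.chain_succ (i + 1) (q + 1)
  simp only [add_assoc, Nat.reduceAdd] at hl
  have hlt : (∀ q, q + 1 = r → D.chain i q + D.chain (i + 1) (q + 2) <
      D.chain i (q + 1) + D.chain (i + 1) (q + 1)) →
      ∀ q, q + 1 = r → D.rows (i + 1) r < D.rows i q := by
    rintro h q rfl
    have := h q rfl
    rw [hq1, hq2] at this
    omega
  refine ⟨f, v, hf, fun p hp => (hfp p hp).trans (hD p), ?_, hv, hve, hf0, fun hle => ?_⟩
  · rw [hfi, hD]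
    congr 1
    rcases hcases with ⟨hu, h1, h2⟩ | ⟨hu, h1, h2⟩ | ⟨hu, h1, q, hq, h2⟩
    · rw [hu, if_neg]
      rintro ⟨h3, -⟩
      clear h2 hlt
      omega
    · rw [hu, if_pos]
      refine ⟨by clear h2 hlt; omega, ?_⟩
      rintro ⟨q, hq, h3⟩
      exact absurd (hlt h2 q hq) (not_lt.2 h3)
    · rw [hu, if_neg]
      rintro ⟨-, h3⟩
      refine h3 ⟨q, hq, ?_⟩
      subst hq
      rw [hq1, hq2] at h2
      omega
  · rcases hcases with ⟨-, -, h2⟩ | ⟨-, h1, -⟩ | ⟨-, h1, -⟩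
    · exact hlt h2
    · omega
    · omega

/-- A raising step commutes with the projection. -/
theorem Raise.exists_youngRaise {D D' : DominoTableau lam mu} {i : ℕ} (h : D.Raise i D')
    {T : YoungTableau} (hT : IsOctaProjection D T) :
    ∃ T' : SemistandardYoungTableau T.1,
      YoungRaise i T.2 T' ∧ IsOctaProjection D' ⟨T.1, T'⟩ := by
  classical
  obtain ⟨g, hg, hD, hgT, hw⟩ := hT
  obtain ⟨r, hr, hpos, hbelow, hchain⟩ := h.chain_eq
  obtain ⟨f, v, hf, hfp, hfi, hv, hve, hf0, -⟩ := D.exists_bump_rows hg hD hr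
  obtain ⟨s, hs, hse, hsT⟩ := (eqvGen_bump hgT i).2 v hv
  obtain ⟨T', hT', hT'c⟩ := _root_.exists_youngRaise T.2 (i := i) (s := s) hs (by
    show 0 < chainExcess T.toSkew.chain i s
    rw [hse, hve]
    exact hpos)
  have hDc : ∀ p, p ≠ i + 1 → D'.chain p = D.chain p := by
    intro p hp
    unfold chain
    rw [hbelow p hp]
  refine ⟨T', hT', f, hf, fun p => ?_, ?_, fun k => ?_⟩
  · by_cases hp : p = i + 1
    · subst hp
      rw [hfi, hchain]
    · rw [hfp p hp, hDc p hp]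
  · rw [hf0]
    rw [show (YoungTableau.toSkew ⟨T.1, T'⟩).chain = _ from hT'c]
    exact hsT
  · obtain ⟨R1, h1⟩ := D.two_mul_weight k
    obtain ⟨R2, h2⟩ := D'.two_mul_weight k
    obtain ⟨R3, h3⟩ := T.2.weight_eq k
    obtain ⟨R4, h4⟩ := T'.weight_eq k
    have hwk := hw k
    obtain ⟨R, hR⟩ : ∃ R, R = R1 + R2 + R3 + R4 + r + s + 2 := ⟨_, rfl⟩
    have h5 : ∀ p, D'.chain p R = D.chain p R + if p = i + 1 then 2 else 0 := by
      intro p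
      by_cases hp : p = i + 1
      · subst hp
        rw [hchain, bump, bump, if_pos rfl, if_pos (show r < R by omega),
          if_pos (by split_ifs <;> omega)]
        ring
      · rw [hDc p hp, if_neg hp, add_zero]
    have h6 : ∀ p, T'.chain p R = T.2.chain p R + if p = i + 1 then 1 else 0 := by
      intro p
      rw [hT'c]
      by_cases hp : p = i + 1
      · subst hp
        rw [chainBump_self, bump, if_pos (show s < R by omega), if_pos rfl]
      · rw [chainBump_ne _ hp, if_neg hp, add_zero]
    have h1 := h1 R (by omega)
    have h2 := h2 R (by omega)
    have h3 := h3 R (by omega)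
    have h4 := h4 R (by omega)
    rw [h5, h5] at h2
    rw [h6, h6] at h4
    have h7 : (T.toSkew.weight k : ℤ) = (YoungTableau.toSkew ⟨T.1, T.2⟩).weight k := rfl
    split_ifs at h2 h4 <;> omega

end DominoTableau

/-! ### Every domino tableau that is not Yamanouchi can be raised -/

theorem overlap_succ (a b : ℕ → ℕ) (q : ℕ) : overlap a b (q + 1) = b (q + 1) - a q := by
  simp [overlap]

theorem IsDominoStrip.parity {a b : ℕ → ℕ} (h : IsDominoStrip a b) (r : ℕ) :
    (a r + b r + (b (r + 1) - a r) + overlap a b r) % 2 = 0 := by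
  have h1 := h.even r
  have h2 := h.le r
  have h3 := h.anti_right r
  cases r with
  | zero =>
    simp only [overlap, if_true] at *
    omega
  | succ q =>
    rw [overlap_succ] at *
    have h4 := h.strip q
    have h5 := h.anti_left q
    simp only [add_assoc, Nat.reduceAdd] at *
    omega

theorem IsDominoStrip.of_parity {a b : ℕ → ℕ} (h1 : ∀ r, a (r + 1) ≤ a r)
    (h2 : ∀ r, b (r + 1) ≤ b r) (h3 : ∀ r, a r ≤ b r) (h4 : ∀ r, b (r + 2) ≤ a r)
    (h : ∀ r, (a r + b r + (b (r + 1) - a r) + overlap a b r) % 2 = 0) : IsDominoStrip a b := by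
  refine ⟨h1, h2, h3, h4, fun r => ?_⟩
  have h5 := h r
  have h6 := h2 r
  have h7 := h3 r
  cases r with
  | zero =>
    simp only [overlap, if_true] at *
    omega
  | succ q =>
    rw [overlap_succ] at *
    have h4 := h4 q
    have h5 := h1 q
    simp only [add_assoc, Nat.reduceAdd] at *
    omega

/-- A sequence of repairs `shiftLeft` that moves a vertical domino past `n` pairs of horizontal
dominoes. -/
theorem exists_shiftLeft {i r b : ℕ} {G : Finset (Domino × ℕ)} (hG : (Domino.vert r b, i) ∈ G) :
    ∀ (n : ℕ) (F : Finset (Domino × ℕ)),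
    (∀ t < n, (Domino.horiz r (b + 2 * t + 1), i) ∈ G ∧
      (Domino.horiz (r + 1) (b + 2 * t + 1), i + 1) ∈ G) →
    (Domino.vert r (b + 2 * n), i) ∈ F →
    (∀ t < n, (Domino.horiz r (b + 2 * t), i) ∈ F ∧
      (Domino.horiz (r + 1) (b + 2 * t), i + 1) ∈ F) →
    (∀ y ∈ F, y ∈ G ∨ y = (Domino.vert r (b + 2 * n), i) ∨ ∃ t < n,
      y = (Domino.horiz r (b + 2 * t), i) ∨ y = (Domino.horiz (r + 1) (b + 2 * t), i + 1)) →
    ∃ F', Relation.ReflTransGen (Repair i) F F' ∧ F' ⊆ G := by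
  intro n
  induction n with
  | zero =>
    intro F _ _ _ hF
    refine ⟨F, .refl, fun y hy => ?_⟩
    rcases hF y hy with h | rfl | ⟨t, ht, -⟩
    · exact h
    · exact hG
    · omega
  | succ n ih =>
    intro F hGt hv ht hF
    have hstep := Repair.shiftLeft (i := i) F r (b + 2 * n) (by
      intro y hy
      simp only [Finset.mem_insert, Finset.mem_singleton] at hy
      rcases hy with rfl | rfl | rfl
      · exact (ht n (by omega)).1
      · exact (ht n (by omega)).2
      · exact hv)
    suffices h : ∃ F', Relation.ReflTransGen (Repair i) ((F \ {(Domino.horiz r (b + 2 * n), i),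
        (Domino.horiz (r + 1) (b + 2 * n), i + 1), (Domino.vert r (b + 2 * n + 2), i)}) ∪
        {(Domino.vert r (b + 2 * n), i), (Domino.horiz r (b + 2 * n + 1), i),
        (Domino.horiz (r + 1) (b + 2 * n + 1), i + 1)}) F' ∧ F' ⊆ G by
      obtain ⟨F', h1, h2⟩ := h
      exact ⟨F', .head hstep h1, h2⟩
    refine ih _ (fun t h => hGt t (by omega)) (by simp) ?_ ?_
    · intro t htn
      obtain ⟨h1, h2⟩ := ht t (by omega)
      constructor
      · refine Finset.mem_union_left _ (Finset.mem_sdiff.2 ⟨h1, ?_⟩)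
        simp only [Finset.mem_insert, Finset.mem_singleton, Prod.mk.injEq, Domino.horiz_inj,
          Domino.horiz_ne_vert, true_and, and_true, or_false]
        omega
      · refine Finset.mem_union_left _ (Finset.mem_sdiff.2 ⟨h2, ?_⟩)
        simp only [Finset.mem_insert, Finset.mem_singleton, Prod.mk.injEq, Domino.horiz_inj,
          Domino.horiz_ne_vert, true_and, and_true, false_and, or_false]
        omega
    · intro y hy
      simp only [Finset.mem_union, Finset.mem_sdiff, Finset.mem_insert, Finset.mem_singleton,
        not_or] at hy
      rcases hy with ⟨hy, hy1, hy2, hy3⟩ | rfl | rfl | rfl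
      · rcases hF y hy with h | h | ⟨t, htn, h⟩
        · exact Or.inl h
        · exact absurd h hy3
        · refine Or.inr (Or.inr ⟨t, ?_, h⟩)
          by_contra hlt
          obtain rfl : t = n := by omega
          exact h.elim hy1 hy2
      · exact Or.inr (Or.inl rfl)
      · exact Or.inl (hGt n (by omega)).1
      · exact Or.inl (hGt n (by omega)).2

theorem card_eq_of_repairs {i : ℕ} {F F' : Finset (Domino × ℕ)} (hF : IsPacking F)
    (h : Relation.ReflTransGen (Repair i) F F') : F'.card = F.card := by
  have h1 : IsPacking F' ∧ F'.card = F.card := by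
    induction h with
    | refl => exact ⟨hF, rfl⟩
    | tail _ h ih =>
      obtain ⟨h1, -, h3⟩ := h.spec ih.1
      refine ⟨h1, ?_⟩
      rcases h3 with ⟨r, c, h3⟩ | ⟨r, c, c₁, c₂, h3⟩ <;>
      · have h4 := h3 fun _ => 1
        simp only [Finset.sum_const, nsmul_eq_mul, mul_one] at h4
        omega
  exact h1.2

namespace DominoTableau

variable {lam mu : YoungDiagram} (D : DominoTableau lam mu)

theorem two_mul_card : 2 * D.dominoes.card = (lam.cells \ mu.cells).card := by
  rw [← D.cover, Finset.card_biUnion, Finset.sum_const_nat (m := 2), mul_comm]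
  · intro x _
    rcases x.1.eq_vert_or_eq_horiz with ⟨r, c, h⟩ | ⟨r, c, h⟩ <;>
      rw [h, Domino.cells, Finset.card_pair] <;>
      simp [Domino.vert, Domino.horiz, Domino.lastRow, Domino.lastCol]
  · exact D.disjoint

/-- A sequence of repairs that arrives at dominoes of `D'` arrives at all of them. -/
theorem raise_of_subset {D D' : DominoTableau lam mu} {i : ℕ} {x : Domino}
    {F : Finset (Domino × ℕ)}
    (hx : IsRaisingPlace D.dominoes dominoBefore Prod.snd i (x, i + 1))
    (h : Relation.ReflTransGen (Repair i) (insert (x, i) (D.dominoes.erase (x, i + 1))) F)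
    (hF : F ⊆ D'.dominoes) : D.Raise i D' := by
  refine ⟨(x, i + 1), hx, ?_⟩
  have hxD : (x, i + 1) ∈ D.dominoes := hx.1.1
  have h1 := card_eq_of_repairs (D.isPacking_change hxD) h
  have h2 := D.sum_change hxD (q := i) (by omega) fun _ => 1
  have h3 := D.two_mul_card
  have h4 := D'.two_mul_card
  simp only [Finset.sum_const, nsmul_eq_mul, mul_one] at h2
  rwa [Finset.eq_of_subset_of_card_le hF (by omega)] at h

/-- One of the partitions of the chain of a domino tableau may be exchanged. -/
theorem exists_of_isDominoStrip {i : ℕ} {k : ℕ → ℕ} (h1 : IsDominoStrip (D.rows i) k)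
    (h2 : IsDominoStrip k (D.rows (i + 2))) : ∃ D' : DominoTableau lam mu,
    D'.rows (i + 1) = k ∧ ∀ p, p ≠ i + 1 → D'.rows p = D.rows p := by
  obtain ⟨N, -, hN⟩ := D.exists_bound
  obtain ⟨D', hD'⟩ := exists_dominoTableau (lam := lam) (mu := mu) (N := N + i + 2)
    (g := fun p => if p = i + 1 then k else D.rows p)
    (by
      show (if 0 = i + 1 then k else D.rows 0) = _
      rw [if_neg (by omega : ¬ 0 = i + 1)]
      unfold rows
      rw [D.rows_zero])
    (fun p hp => by
      show (if p = i + 1 then k else D.rows p) = _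
      rw [if_neg (by omega : ¬ p = i + 1)]
      unfold rows
      rw [hN p (by omega)])
    (fun p => by
      show IsDominoStrip (if p = i + 1 then k else D.rows p)
        (if p + 1 = i + 1 then k else D.rows (p + 1))
      by_cases hp : p = i + 1
      · rw [if_pos hp, if_neg (by omega : ¬ p + 1 = i + 1), hp]
        exact h2
      · rw [if_neg hp]
        by_cases hp' : p = i
        · rw [if_pos (by omega), hp']
          exact h1
        · rw [if_neg (by omega)]
          exact D.isDominoStrip p)
  exact ⟨D', by rw [hD', if_pos rfl], fun p hp => by rw [hD', if_neg hp]⟩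

/-- The dominoes of two tableaux whose chains differ in one partition. -/
theorem mem_of_isTile {D D' : DominoTableau lam mu} {i : ℕ} {m k l k' : ℕ → ℕ}
    (hm : D.rows i = m) (hk : D.rows (i + 1) = k) (hl : D.rows (i + 2) = l)
    (hk' : D'.rows (i + 1) = k') (hD' : ∀ p, p ≠ i + 1 → D'.rows p = D.rows p)
    {E : Set (Domino × ℕ)} (h1 : ∀ d, IsTile m k d → (d, i) ∉ E → IsTile m k' d)
    (h2 : ∀ d, IsTile k l d → (d, i + 1) ∉ E → IsTile k' l d) {y : Domino × ℕ}
    (hy : y ∈ D.dominoes) (hyE : y ∉ E) : y ∈ D'.dominoes := by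
  subst hm hk hl
  obtain ⟨d, p⟩ := y
  rw [mem_dominoes_iff] at hy ⊢
  by_cases hp : p = i
  · subst hp
    rw [hk', hD' p (by omega)]
    exact h1 d hy hyE
  · by_cases hp' : p = i + 1
    · subst hp'
      rw [hk', hD' (i + 1 + 1) (by omega)]
      exact h2 d hy hyE
    · rw [hD' p hp', hD' (p + 1) (by omega)]
      exact hy

end DominoTableau

theorem isDominoStrip_of_add_two {m k l k' : ℕ → ℕ} {r : ℕ} (hm : IsDominoStrip m k)
    (hl : IsDominoStrip k l) (hk' : ∀ q, q ≠ r → k' q = k q) (hkr : k' r = k r + 2)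
    (p1 : ∀ t, (m t + k' t + (k' (t + 1) - m t) + overlap m k' t) % 2 = 0)
    (p2 : ∀ t, (k' t + l t + (l (t + 1) - k' t) + overlap k' l t) % 2 = 0)
    (h1 : k r + 2 ≤ l r) (h2 : ∀ q, q + 1 = r → k r + 2 ≤ k q)
    (h3 : ∀ q, q + 2 = r → k r + 2 ≤ m q) : IsDominoStrip m k' ∧ IsDominoStrip k' l := by
  have hle : ∀ t, k t ≤ k' t := by
    intro t
    by_cases h : t = r
    · subst h; omega
    · rw [hk' t h]
  have hanti : ∀ t, k' (t + 1) ≤ k' t := by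
    intro t
    by_cases h : t + 1 = r
    · rw [h, hkr]
      exact (h2 t h).trans (hle t)
    · rw [hk' _ h]
      exact (hm.anti_right t).trans (hle t)
  refine ⟨.of_parity hm.anti_left hanti (fun t => (hm.le t).trans (hle t)) (fun t => ?_) p1,
    .of_parity hanti hl.anti_right (fun t => ?_) (fun t => (hl.strip t).trans (hle t)) p2⟩
  · by_cases h : t + 2 = r
    · rw [h, hkr]
      exact h3 t h
    · rw [hk' _ h]
      exact hm.strip t
  · by_cases h : t = r
    · subst h; omega
    · rw [hk' t h]
      exact hl.le t

theorem isDominoStrip_of_add_one {m k l k' : ℕ → ℕ} {r : ℕ} (hm : IsDominoStrip m k)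
    (hl : IsDominoStrip k l) (hk' : ∀ q, q ≠ r → q ≠ r + 1 → k' q = k q) (hkr : k' r = k r + 1)
    (hkr' : k' (r + 1) = k (r + 1) + 1)
    (p1 : ∀ t, (m t + k' t + (k' (t + 1) - m t) + overlap m k' t) % 2 = 0)
    (p2 : ∀ t, (k' t + l t + (l (t + 1) - k' t) + overlap k' l t) % 2 = 0)
    (h1 : k r < l (r + 1)) (h2 : ∀ q, q + 1 = r → k r < m q) :
    IsDominoStrip m k' ∧ IsDominoStrip k' l := by
  have hle : ∀ t, k t ≤ k' t := by
    intro t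
    by_cases h : t = r
    · subst h; omega
    · by_cases h' : t = r + 1
      · subst h'; omega
      · rw [hk' t h h']
  have hkk := hm.anti_right r
  have hll := hl.anti_right r
  have hanti : ∀ t, k' (t + 1) ≤ k' t := by
    intro t
    by_cases h : t + 1 = r
    · rw [h, hkr]
      have := h2 t h
      have := hm.le t
      have := hle t
      omega
    · by_cases h' : t = r
      · subst h'; omega
      · rw [hk' _ h (by omega)]
        exact (hm.anti_right t).trans (hle t)
  refine ⟨.of_parity hm.anti_left hanti (fun t => (hm.le t).trans (hle t)) (fun t => ?_) p1,
    .of_parity hanti hl.anti_right (fun t => ?_) (fun t => (hl.strip t).trans (hle t)) p2⟩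
  · by_cases h : t + 2 = r
    · rw [h, hkr]
      have := h2 (t + 1) h
      have := hm.anti_left t
      omega
    · by_cases h' : t + 2 = r + 1
      · rw [h', hkr']
        have := h2 t (by omega)
        omega
      · rw [hk' _ h h']
        exact hm.strip t
  · by_cases h : t = r
    · subst h; omega
    · by_cases h' : t = r + 1
      · subst h'; omega
      · rw [hk' t h h']
        exact hl.le t

/-- If one square can be added to each of the rows `r` and `r + 1` of the middle partition, then the
horizontal dominoes of row `r` below it and those of row `r + 1` above it start in the same
column. -/
theorem start_le_of_add_one {m k l k' : ℕ → ℕ} {r : ℕ} (hm : IsDominoStrip m k)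
    (hl : IsDominoStrip k l) (hkr : k' r = k r + 1) (hkr' : k' (r + 1) = k (r + 1) + 1)
    (p1 : ∀ t, (m t + k' t + (k' (t + 1) - m t) + overlap m k' t) % 2 = 0)
    (p2 : ∀ t, (k' t + l t + (l (t + 1) - k' t) + overlap k' l t) % 2 = 0)
    (hle : k r < l (r + 1)) (hlt : ∀ q, q + 1 = r → k r < m q) :
    m r ≤ k (r + 1) ∧ l (r + 2) ≤ k (r + 1) ∧ ∃ n, k r = k (r + 1) + 2 * n := by
  have hk0 := hm.anti_right r
  have hmr := hm.le r
  -- adding one square to each of two rows preserves the parities only if the horizontal dominoes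
  -- of both rows start in the same column
  have e1 := hm.parity r
  have e1' := p1 r
  have e2 := hl.parity (r + 1)
  have e2' := p2 (r + 1)
  rw [hkr, hkr'] at e1'
  rw [overlap_succ] at e2
  rw [overlap_succ, hkr, hkr'] at e2'
  have hlr := hl.le (r + 1)
  have hll := hl.anti_right (r + 1)
  have o1 : overlap m k r = 0 ∧ overlap m k' r = 0 := by
    unfold overlap
    by_cases h : r = 0
    · simp [h]
    · have := hlt (r - 1) (by omega)
      rw [if_neg h, if_neg h, hkr]
      omega
  rw [o1.1] at e1
  rw [o1.2] at e1'
  simp only [add_assoc, Nat.reduceAdd] at e2 e2' hll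
  have hm0 : m r ≤ k (r + 1) := by omega
  have hl0 : l (r + 2) ≤ k (r + 1) := by omega
  exact ⟨hm0, hl0, (k r - k (r + 1)) / 2, by omega⟩

theorem isTile_of_add_one_left {m k k' : ℕ → ℕ} {r : ℕ}
    (hk' : ∀ q, q ≠ r → q ≠ r + 1 → k' q = k q) (hkr : k' r = k r + 1)
    (hkr' : k' (r + 1) = k (r + 1) + 1) (hm0 : m r ≤ k (r + 1))
    (hlt : ∀ q, q + 1 = r → k r < m q) {d : Domino} (hd : IsTile m k d)
    (hne : ∀ c, d ≠ .horiz r c) : IsTile m k' d := by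
  rcases d.eq_vert_or_eq_horiz with ⟨q, c, rfl⟩ | ⟨q, c, rfl⟩
  · rw [isTile_vert] at hd ⊢
    by_cases h : q + 1 = r
    · rw [h, hkr]; rw [h] at hd; omega
    · by_cases h' : q = r
      · subst h'; rw [hkr']; omega
      · rw [hk' _ h (by omega)]; exact hd
  · rw [isTile_horiz] at hd ⊢
    by_cases h : q = r
    · subst h
      exact absurd rfl (hne c)
    · by_cases h' : q + 1 = r
      · have := hlt q h'
        rw [hk' q (by omega) (by omega), h', hkr]
        rw [h'] at hd
        omega
      · rw [hk' _ h' (by omega)]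
        by_cases h2 : q = r + 1
        · subst h2
          rw [hkr']
          omega
        · rw [hk' _ h h2]
          exact hd

theorem isTile_of_add_one_right {k l k' : ℕ → ℕ} {r : ℕ}
    (hk' : ∀ q, q ≠ r → q ≠ r + 1 → k' q = k q) (hkr : k' r = k r + 1)
    (hkr' : k' (r + 1) = k (r + 1) + 1) (hl0 : l (r + 2) ≤ k (r + 1)) (hle : k r < l (r + 1))
    {d : Domino} (hd : IsTile k l d) (hne' : d ≠ .vert r (k r))
    (hne : ∀ c, d ≠ .horiz (r + 1) c) : IsTile k' l d := by
  rcases d.eq_vert_or_eq_horiz with ⟨q, c, rfl⟩ | ⟨q, c, rfl⟩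
  · rw [isTile_vert] at hd ⊢
    by_cases h : q = r
    · subst h
      have hc : c ≠ k q := fun h => hne' (by rw [h])
      rw [hkr]
      omega
    · by_cases h' : q = r + 1
      · subst h'
        simp only [add_assoc, Nat.reduceAdd] at hd
        omega
      · rw [hk' _ h h']; exact hd
  · rw [isTile_horiz] at hd ⊢
    by_cases h : q = r + 1
    · subst h
      exact absurd rfl (hne c)
    · by_cases h' : q = r
      · subst h'
        have hq : q = 0 ∨ k' (q - 1) = k (q - 1) := by
          by_cases h0 : q = 0
          · exact Or.inl h0
          · exact Or.inr (hk' _ (by omega) (by omega))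
        rw [hkr]
        omega
      · rw [hk' _ h' h]
        by_cases h2 : q - 1 = r
        · omega
        · by_cases h3 : q - 1 = r + 1
          · rw [h3, hkr']
            rw [h3] at hd
            omega
          · rw [hk' _ h2 h3]
            exact hd

namespace DominoTableau

variable {lam mu : YoungDiagram} {D : DominoTableau lam mu}

/-- The changed domino is horizontal, and no repair is needed. -/
theorem exists_raise_of_horiz {i r : ℕ} {k' : ℕ → ℕ}
    (hx : IsRaisingPlace D.dominoes dominoBefore Prod.snd i
      (Domino.horiz r (D.rows (i + 1) r), i + 1))
    (hk' : ∀ q, q ≠ r → k' q = D.rows (i + 1) q) (hkr : k' r = D.rows (i + 1) r + 2)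
    (p1 : ∀ t, (D.rows i t + k' t + (k' (t + 1) - D.rows i t) + overlap (D.rows i) k' t) % 2 = 0)
    (p2 : ∀ t, (k' t + D.rows (i + 2) t + (D.rows (i + 2) (t + 1) - k' t) +
      overlap k' (D.rows (i + 2)) t) % 2 = 0)
    (hle : D.rows (i + 2) (r + 1) ≤ D.rows (i + 1) r)
    (hlt : ∀ q, q + 1 = r → D.rows (i + 1) r < D.rows i q) : ∃ D', D.Raise i D' := by
  have hxD := (D.mem_dominoes_iff _ _).1 hx.1.1
  have hm := D.isDominoStrip i
  have hl := D.isDominoStrip (i + 1)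
  rw [isTile_horiz] at hxD
  simp only [add_assoc, Nat.reduceAdd] at hxD hl
  obtain ⟨m, hmd⟩ : ∃ m, D.rows i = m := ⟨_, rfl⟩
  obtain ⟨k, hkd⟩ : ∃ k, D.rows (i + 1) = k := ⟨_, rfl⟩
  obtain ⟨l, hld⟩ : ∃ l, D.rows (i + 2) = l := ⟨_, rfl⟩
  simp only [hmd, hkd, hld] at hm hl hxD hle hlt hk' hkr p1 p2 hx
  have hlt' : ∀ q, q + 1 = r → k r + 2 ≤ m q := by
    rintro q rfl
    have h1 := hlt q rfl
    have h2 := p1 (q + 1)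
    have h3 := hm.parity (q + 1)
    rw [overlap_succ, hkr, hk' _ (by omega)] at h2
    rw [overlap_succ] at h3
    omega
  obtain ⟨hmk, hkl⟩ := isDominoStrip_of_add_two hm hl hk' hkr p1 p2 (by omega)
    (fun q hq => (hlt' q hq).trans (hm.le q)) (by
      rintro q rfl
      exact (hlt' (q + 1) rfl).trans (hm.anti_left q))
  obtain ⟨D', hD', hDp⟩ := D.exists_of_isDominoStrip (i := i) (hmd ▸ hmk) (hld ▸ hkl)
  refine ⟨D', raise_of_subset hx .refl fun y hy => ?_⟩
  rw [Finset.mem_insert, Finset.mem_erase] at hy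
  rcases hy with rfl | ⟨hne, hy⟩
  · rw [mem_dominoes_iff, hD', hDp i (by omega), hmd, isTile_horiz, hkr, hk' _ (by omega)]
    have h1 := hm.le r
    have h2 := hm.anti_right r
    have h3 := hm.parity r
    cases r with
    | zero =>
      simp only [overlap, if_true] at h3
      refine ⟨h1, h2, by omega, Or.inl rfl, by omega⟩
    | succ q =>
      have h4 := hlt' q rfl
      rw [overlap_succ] at h3
      refine ⟨h1, h2, by omega, Or.inr h4, by omega⟩
  · refine mem_of_isTile (E := {(Domino.horiz r (k r), i + 1)}) hmd hkd hld hD' hDp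
      (fun d hd hE => ?_)
      (fun d hd hE => ?_) hy hne
    · rcases d.eq_vert_or_eq_horiz with ⟨q, c, rfl⟩ | ⟨q, c, rfl⟩
      · rw [isTile_vert] at hd ⊢
        by_cases h : q + 1 = r
        · rw [h, hkr]; rw [h] at hd; omega
        · rw [hk' _ h]; exact hd
      · rw [isTile_horiz] at hd ⊢
        by_cases h : q + 1 = r
        · have := hlt' q h
          rw [hk' q (by omega), h, hkr]
          rw [h] at hd
          omega
        · rw [hk' _ h]
          by_cases h' : q = r
          · subst h'
            rw [hkr]
            omega
          · rw [hk' _ h']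
            exact hd
    · rcases d.eq_vert_or_eq_horiz with ⟨q, c, rfl⟩ | ⟨q, c, rfl⟩
      · rw [isTile_vert] at hd ⊢
        by_cases h : q = r
        · subst h; omega
        · rw [hk' _ h]; exact hd
      · rw [isTile_horiz] at hd ⊢
        by_cases h : q = r
        · subst h
          have hc : c ≠ k q := by
            rintro rfl
            exact hE rfl
          have hq : q = 0 ∨ k' (q - 1) = k (q - 1) := by
            by_cases h0 : q = 0
            · exact Or.inl h0
            · exact Or.inr (hk' _ (by omega))
          rw [hkr]
          omega
        · rw [hk' _ h]
          by_cases h' : q - 1 = r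
          · rw [h', hkr]
            rw [h'] at hd
            omega
          · rw [hk' _ h']
            exact hd

/-- The changed domino is vertical, and it becomes the left domino of the rectangle of a repair
`shiftUp₁`. -/
theorem exists_raise_of_shiftUp {i r : ℕ} {k' : ℕ → ℕ}
    (hx : IsRaisingPlace D.dominoes dominoBefore Prod.snd i
      (Domino.vert (r + 1) (D.rows (i + 1) (r + 1)), i + 1))
    (hk' : ∀ q, q ≠ r + 1 → k' q = D.rows (i + 1) q)
    (hkr : k' (r + 1) = D.rows (i + 1) (r + 1) + 2)
    (p1 : ∀ t, (D.rows i t + k' t + (k' (t + 1) - D.rows i t) + overlap (D.rows i) k' t) % 2 = 0)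
    (p2 : ∀ t, (k' t + D.rows (i + 2) t + (D.rows (i + 2) (t + 1) - k' t) +
      overlap k' (D.rows (i + 2)) t) % 2 = 0)
    (hle : D.rows (i + 1) (r + 1) < D.rows (i + 2) (r + 2))
    (hlt : D.rows i r ≤ D.rows (i + 1) (r + 1))
    (hup : ∀ q, q + 1 = r → D.rows (i + 1) (r + 1) + 2 ≤ D.rows i q) : ∃ D', D.Raise i D' := by
  have hm := D.isDominoStrip i
  have hl := D.isDominoStrip (i + 1)
  simp only [add_assoc, Nat.reduceAdd] at hl
  have hxD : (Domino.vert (r + 1) (D.rows (i + 1) (r + 1)), i + 1) ∈ D.dominoes := hx.1.1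
  have hvert : D.rows (i + 1) (r + 1) + 1 < D.rows (i + 2) (r + 2) →
      (Domino.vert (r + 1) (D.rows (i + 1) (r + 1) + 1), i + 1) ∈ D.dominoes := fun h =>
    D.vert_mem (by omega) h
  have hhoriz := (D.mem_dominoes_iff (.horiz r (D.rows (i + 1) (r + 1))) i).2
  rw [isTile_horiz] at hhoriz
  obtain ⟨m, hmd⟩ : ∃ m, D.rows i = m := ⟨_, rfl⟩
  obtain ⟨k, hkd⟩ : ∃ k, D.rows (i + 1) = k := ⟨_, rfl⟩
  obtain ⟨l, hld⟩ : ∃ l, D.rows (i + 2) = l := ⟨_, rfl⟩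
  simp only [hmd, hkd, hld] at hm hl hxD hvert hhoriz hup hle hlt hk' hkr p1 p2 hx
  have hl2 : k (r + 1) + 2 ≤ l (r + 2) := by
    have h1 := hl.parity (r + 1)
    have h2 := p2 (r + 1)
    rw [overlap_succ, hkr, hk' r (by omega)] at h2
    rw [overlap_succ] at h1
    simp only [add_assoc, Nat.reduceAdd] at *
    omega
  have hk2 : k (r + 1) + 2 ≤ k r := hl2.trans (hl.strip r)
  obtain ⟨hmk, hkl⟩ := isDominoStrip_of_add_two hm hl hk' hkr p1 p2
    (hl2.trans (hl.anti_right (r + 1))) (by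
      intro q hq
      obtain rfl : q = r := by omega
      exact hk2) (by
      intro q hq
      exact hup q (by omega))
  obtain ⟨D', hD', hDp⟩ := D.exists_of_isDominoStrip (i := i) (hmd ▸ hmk) (hld ▸ hkl)
  have hh : (Domino.horiz r (k (r + 1)), i) ∈ D.dominoes := by
    refine hhoriz ⟨hlt, le_rfl, by omega, ?_, by omega⟩
    rcases r with _ | q
    · exact Or.inl rfl
    · exact Or.inr (hup q rfl)
  have hv := hvert hl2
  refine ⟨D', raise_of_subset hx (.single (.shiftUp₁ _ r (k (r + 1)) fun y hy => ?_))
    fun y hy => ?_⟩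
  · simp only [Finset.mem_insert, Finset.mem_singleton] at hy
    rw [Finset.mem_insert, Finset.mem_erase]
    rcases hy with rfl | rfl | rfl
    · exact Or.inr ⟨by simp, hh⟩
    · exact Or.inl rfl
    · exact Or.inr ⟨by simp [Domino.vert_inj], hv⟩
  simp only [Finset.mem_union, Finset.mem_sdiff, Finset.mem_insert, Finset.mem_singleton,
    Finset.mem_erase, not_or] at hy
  rcases hy with ⟨rfl | ⟨hne, hy⟩, hy1, hy2, hy3⟩ | rfl | rfl | rfl
  · exact absurd rfl hy2
  · refine mem_of_isTile (E := {(Domino.vert (r + 1) (k (r + 1)), i + 1),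
      (Domino.horiz r (k (r + 1)), i), (Domino.vert (r + 1) (k (r + 1) + 1), i + 1)})
      hmd hkd hld hD' hDp
      (fun d hd hE => ?_) (fun d hd hE => ?_) hy (by
        simp only [Set.mem_insert_iff, Set.mem_singleton_iff, not_or]
        exact ⟨hne, hy1, hy3⟩)
    · simp only [Set.mem_insert_iff, Set.mem_singleton_iff, not_or, Prod.mk.injEq, not_and] at hE
      rcases d.eq_vert_or_eq_horiz with ⟨q, c, rfl⟩ | ⟨q, c, rfl⟩
      · rw [isTile_vert] at hd ⊢
        by_cases h : q = r
        · subst h; rw [hkr]; omega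
        · rw [hk' _ (by omega)]; exact hd
      · rw [isTile_horiz] at hd ⊢
        by_cases h : q = r
        · subst h
          rw [hk' q (by omega), hkr]
          have hc : c ≠ k (q + 1) := fun h => hE.2.1 (by rw [h]) trivial
          omega
        · rw [hk' (q + 1) (by omega)]
          by_cases h' : q = r + 1
          · subst h'
            rw [hkr]
            simp only [Nat.add_sub_cancel] at *
            omega
          · rw [hk' _ h']
            exact hd
    · simp only [Set.mem_insert_iff, Set.mem_singleton_iff, not_or, Prod.mk.injEq, not_and] at hE
      rcases d.eq_vert_or_eq_horiz with ⟨q, c, rfl⟩ | ⟨q, c, rfl⟩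
      · rw [isTile_vert] at hd ⊢
        by_cases h : q = r + 1
        · subst h
          have hc : c ≠ k (r + 1) := fun h => hE.1 (by rw [h]) trivial
          have hc' : c ≠ k (r + 1) + 1 := fun h => hE.2.2 (by rw [h]) trivial
          rw [hkr]
          omega
        · rw [hk' _ h]; exact hd
      · rw [isTile_horiz] at hd ⊢
        by_cases h : q = r + 1
        · subst h
          rw [hkr, Nat.add_sub_cancel, hk' r (by omega)]
          simp only [add_assoc, Nat.reduceAdd, Nat.add_sub_cancel] at *
          omega
        · rw [hk' _ h]
          by_cases h' : q - 1 = r + 1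
          · rw [h', hkr]
            rw [h'] at hd
            omega
          · rw [hk' _ h']
            exact hd
  · exact (D'.mem_dominoes_iff _ _).2 (by
      rw [hD', hDp i (by omega), hmd, isTile_vert, hkr]
      omega)
  · exact (D'.mem_dominoes_iff _ _).2 (by
      rw [hD', hDp i (by omega), hmd, isTile_vert, hkr]
      omega)
  · refine (D'.mem_dominoes_iff _ _).2 ?_
    have h1 := hkl.parity (r + 2)
    have h2 := hl.strip (r + 1)
    have h3 := hm.anti_right (r + 1)
    rw [overlap_succ, hkr] at h1
    rw [hD', hDp (i + 1 + 1) (by omega), show D.rows (i + 1 + 1) = l from hld,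
      isTile_horiz, hk' (r + 2) (by omega),
      show r + 2 - 1 = r + 1 by omega, hkr]
    rw [hk' (r + 1 + 1) (by omega)] at h1
    simp only [add_assoc, Nat.reduceAdd] at *
    omega

/-- The changed domino is vertical, and it is moved to the left of all pairs of horizontal dominoes
with entries `i` and `i + 1` in its rows. -/
theorem exists_raise_of_shiftLeft {i r : ℕ} {k' : ℕ → ℕ}
    (hx : IsRaisingPlace D.dominoes dominoBefore Prod.snd i
      (Domino.vert r (D.rows (i + 1) r), i + 1))
    (hk' : ∀ q, q ≠ r → q ≠ r + 1 → k' q = D.rows (i + 1) q)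
    (hkr : k' r = D.rows (i + 1) r + 1) (hkr' : k' (r + 1) = D.rows (i + 1) (r + 1) + 1)
    (p1 : ∀ t, (D.rows i t + k' t + (k' (t + 1) - D.rows i t) + overlap (D.rows i) k' t) % 2 = 0)
    (p2 : ∀ t, (k' t + D.rows (i + 2) t + (D.rows (i + 2) (t + 1) - k' t) +
      overlap k' (D.rows (i + 2)) t) % 2 = 0)
    (hle : D.rows (i + 1) r < D.rows (i + 2) (r + 1))
    (hlt : ∀ q, q + 1 = r → D.rows (i + 1) r < D.rows i q) : ∃ D', D.Raise i D' := by
  have hm := D.isDominoStrip i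
  have hl := D.isDominoStrip (i + 1)
  simp only [add_assoc, Nat.reduceAdd] at hl
  have hxD : (Domino.vert r (D.rows (i + 1) r), i + 1) ∈ D.dominoes := hx.1.1
  have hhoriz := fun c => (D.mem_dominoes_iff (.horiz r c) i).2
  have hhoriz' := fun c => (D.mem_dominoes_iff (.horiz (r + 1) c) (i + 1)).2
  simp only [isTile_horiz, add_assoc, Nat.reduceAdd] at hhoriz hhoriz'
  obtain ⟨m, hmd⟩ : ∃ m, D.rows i = m := ⟨_, rfl⟩
  obtain ⟨k, hkd⟩ : ∃ k, D.rows (i + 1) = k := ⟨_, rfl⟩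
  obtain ⟨l, hld⟩ : ∃ l, D.rows (i + 2) = l := ⟨_, rfl⟩
  simp only [hmd, hkd, hld] at hm hl hxD hhoriz hhoriz' hle hlt hk' hkr hkr' p1 p2 hx
  obtain ⟨hmk, hkl⟩ := isDominoStrip_of_add_one hm hl hk' hkr hkr' p1 p2 hle hlt
  obtain ⟨D', hD', hDp⟩ := D.exists_of_isDominoStrip (i := i) (hmd ▸ hmk) (hld ▸ hkl)
  have hk0 := hm.anti_right r
  have hll := hl.anti_right (r + 1)
  simp only [add_assoc, Nat.reduceAdd] at hll
  obtain ⟨hm0, hl0, n, hn⟩ := start_le_of_add_one hm hl hkr hkr' p1 p2 hle hlt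
  have hr : ∀ c, c < k r → r = 0 ∨ c + 1 < m (r - 1) := by
    intro c hc
    by_cases h : r = 0
    · exact Or.inl h
    · have := hlt (r - 1) (by omega)
      omega
  suffices h : ∃ F, Relation.ReflTransGen (Repair i)
      (insert (Domino.vert r (k r), i) (D.dominoes.erase (Domino.vert r (k r), i + 1))) F ∧
      F ⊆ D'.dominoes by
    obtain ⟨F, h1, h2⟩ := h
    exact ⟨D', raise_of_subset hx h1 h2⟩
  refine exists_shiftLeft (r := r) (b := k (r + 1)) ?_ n _ (fun t ht => ⟨?_, ?_⟩) ?_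
    (fun t ht => ⟨?_, ?_⟩) (fun y hy => ?_)
  · rw [mem_dominoes_iff, hD', hDp i (by omega), hmd, isTile_vert, hkr']
    omega
  · rw [mem_dominoes_iff, hD', hDp i (by omega), hmd, isTile_horiz, hkr, hkr']
    have := hr (k (r + 1) + 2 * t + 1) (by omega)
    omega
  · rw [mem_dominoes_iff, hD', hDp (i + 1 + 1) (by omega), show D.rows (i + 1 + 1) = l from hld,
      isTile_horiz, hkr', Nat.add_sub_cancel, hkr]
    simp only [add_assoc, Nat.reduceAdd]
    omega
  · rw [← hn]
    exact Finset.mem_insert_self _ _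
  · refine Finset.mem_insert_of_mem (Finset.mem_erase.2 ⟨by simp [Domino.horiz_ne_vert], ?_⟩)
    have := hr (k (r + 1) + 2 * t) (by omega)
    exact hhoriz _ (by omega)
  · refine Finset.mem_insert_of_mem (Finset.mem_erase.2 ⟨by simp [Domino.horiz_ne_vert], ?_⟩)
    refine hhoriz' _ ?_
    rw [Nat.add_sub_cancel]
    omega
  · by_cases hex : ∃ t < n, y = (Domino.horiz r (k (r + 1) + 2 * t), i) ∨
      y = (Domino.horiz (r + 1) (k (r + 1) + 2 * t), i + 1)
    · exact Or.inr (Or.inr hex)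
    rw [Finset.mem_insert, Finset.mem_erase] at hy
    rcases hy with rfl | ⟨hne, hy⟩
    · exact Or.inr (Or.inl (by rw [hn]))
    refine Or.inl (mem_of_isTile (E := {y | y = (Domino.vert r (k r), i + 1) ∨
      ∃ t < n, y = (Domino.horiz r (k (r + 1) + 2 * t), i) ∨
        y = (Domino.horiz (r + 1) (k (r + 1) + 2 * t), i + 1)}) hmd hkd hld hD' hDp
      (fun d hd hE => ?_) (fun d hd hE => ?_) hy (fun h => h.elim hne hex))
    · refine isTile_of_add_one_left hk' hkr hkr' hm0 hlt hd ?_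
      rintro c rfl
      rw [isTile_horiz] at hd
      exact hE (Or.inr ⟨(c - k (r + 1)) / 2, by omega,
        Or.inl (by rw [show k (r + 1) + 2 * ((c - k (r + 1)) / 2) = c by omega])⟩)
    · refine isTile_of_add_one_right hk' hkr hkr' hl0 hle hd (fun h => hE (Or.inl (by rw [h]))) ?_
      rintro c rfl
      rw [isTile_horiz] at hd
      simp only [add_assoc, Nat.reduceAdd, Nat.add_sub_cancel] at hd
      exact hE (Or.inr ⟨(c - k (r + 1)) / 2, by omega,
        Or.inr (by rw [show k (r + 1) + 2 * ((c - k (r + 1)) / 2) = c by omega])⟩)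

end DominoTableau

theorem bump_succ {A : ℕ → ℤ} {k : ℕ → ℕ} (h : ∀ q, A (q + 1) = A q + k q) (s q : ℕ) :
    bump s A (q + 1) = bump s A q + ((k q + if q = s then 1 else 0 : ℕ) : ℤ) := by
  simp only [bump, h q]
  split_ifs <;> push_cast <;> omega

namespace DominoTableau

variable {lam mu : YoungDiagram} {D : DominoTableau lam mu}

/-- When the raising step needs a repair `shiftUp₁`, there is room for it: otherwise the dominoes
with entry `i` whose lower row is `r` would not be fewer than those with entry `i + 1` whose upper
row is `r + 1`. -/
theorem add_two_le_of_isFirstMax {i r : ℕ} (hr : IsFirstMax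
      (rowExcess D.dominoes Prod.snd i (fun x => x.1.row) (fun x => x.1.lastRow)) (r + 1))
    (hpos : 0 < rowExcess D.dominoes Prod.snd i (fun x => x.1.row) (fun x => x.1.lastRow) (r + 1))
    (hlt : D.rows i r ≤ D.rows (i + 1) (r + 1)) (q : ℕ) (hq : q + 1 = r) :
    D.rows (i + 1) (r + 1) + 2 ≤ D.rows i q := by
  subst hq
  have hlt' := card_lt_of_isFirstMax_rowExcess hr hpos
  have h1 : ((D.dominoes.filter fun y => y.2 = i ∧ y.1.lastRow + 1 = q + 1 + 1).card) = _ :=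
    (congrArg Finset.card (Finset.filter_congr fun y _ => by simp)).trans
      (D.card_filter_lastRow' i (q + 1))
  have h2 := D.card_filter_row' (i + 1) (q + 1 + 1)
  have h3 := (D.isDominoStrip i).parity (q + 1)
  have h4 := (D.isDominoStrip i).strip q
  have h5 := (D.isDominoStrip (i + 1)).strip (q + 1)
  have h6 := (D.isDominoStrip i).le (q + 1)
  have h7 := (D.isDominoStrip i).anti_right (q + 1)
  have h8 := (D.isDominoStrip i).anti_right q
  have h9 := (D.isDominoStrip (i + 1)).anti_right (q + 2)
  have h10 := (D.isDominoStrip (i + 1)).le (q + 2)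
  unfold horizEnd at h1 h2
  rw [overlap_succ] at h3
  simp only [Nat.add_eq_zero_iff, one_ne_zero,
    OfNat.ofNat_ne_zero, and_false, if_false, Nat.add_sub_cancel, show q + 2 - 1 = q + 1 from rfl,
    add_assoc, Nat.reduceAdd] at *
  rw [h1, h2] at hlt'
  omega

theorem exists_raise (hD : ¬ D.IsYamanouchi) : ∃ i D', D.Raise i D' := by
  classical
  obtain ⟨T, hT⟩ := D.exists_isProjection
  obtain ⟨g, hg, hgD, -, -⟩ := hT.isOctaProjection
  obtain ⟨i, x, hx⟩ := exists_isRaisingPlace_of_not_isYamanouchiWord D.isRowCompatible hD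
  refine ⟨i, ?_⟩
  obtain ⟨x, p⟩ := x
  obtain ⟨hp, hr, hpos, hleft⟩ := (D.isRowCompatible i).isFirstMax_of_isRaisingPlace hx
  obtain rfl : p = i + 1 := hp
  have hshape := D.eq_of_leftmost hx.1.1 hleft
  obtain ⟨f, -, hf, hfp, hfi, -, -, -, hlt⟩ := D.exists_bump_rows hg hgD hr
  obtain ⟨r, hxr⟩ : ∃ r, x.row = r := ⟨_, rfl⟩
  simp only [hxr] at hr hpos hshape hfi hlt
  obtain ⟨u, hu⟩ : ∃ u, u = if D.rows (i + 1) r < D.rows (i + 2) (r + 1) ∧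
    ¬ ∃ q, q + 1 = r ∧ D.rows i q ≤ D.rows (i + 1) r then r + 1 else r := ⟨_, rfl⟩
  rw [← hu] at hfi
  -- the partition that the middle one is replaced by
  obtain ⟨k', hk'⟩ : ∃ k' : ℕ → ℕ, ∀ q, k' q =
    (D.rows (i + 1) q + if q = r then 1 else 0) + if q = u then 1 else 0 := ⟨_, fun _ => rfl⟩
  have hA : ∀ q, f (i + 1) (i + 1) (q + 1) = f (i + 1) (i + 1) q + k' q := by
    intro q
    rw [hfi, hk']
    exact bump_succ (bump_succ (D.chain_succ (i + 1)) r) u q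
  have hm : ∀ q, f i i (q + 1) = f i i q + D.rows i q := by
    rw [hfp i (by omega)]
    exact D.chain_succ i
  have hl : ∀ q, f (i + 2) (i + 2) (q + 1) = f (i + 2) (i + 2) q + D.rows (i + 2) q := by
    rw [hfp (i + 2) (by omega)]
    exact D.chain_succ (i + 2)
  have p1 := (hf.octa_diag i).exists_row_eq hm hA
  have p2 := (hf.octa_diag (i + 1)).exists_row_eq hA hl
  rcases hshape with ⟨hle, rfl⟩ | ⟨hle, rfl⟩
  · by_cases hex : ∃ q, q + 1 = r ∧ D.rows i q ≤ D.rows (i + 1) r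
    · obtain rfl : u = r := by rw [hu, if_neg fun h => h.2 hex]
      obtain ⟨q, rfl, hq⟩ := hex
      refine exists_raise_of_shiftUp (k' := k') hx (fun t ht => ?_) ?_ p1 p2 hle hq
        (add_two_le_of_isFirstMax hr hpos hq)
      · rw [hk', if_neg ht]
        rfl
      · rw [hk', if_pos rfl]
    · obtain rfl : u = r + 1 := by rw [hu, if_pos ⟨hle, hex⟩]
      refine exists_raise_of_shiftLeft (k' := k') hx (fun t ht ht' => ?_) ?_ ?_ p1 p2 hle
        fun q hq => ?_
      · rw [hk', if_neg ht, if_neg ht']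
        rfl
      · rw [hk', if_pos rfl, if_neg (by omega : ¬ r = r + 1)]
      · rw [hk', if_pos rfl, if_neg (by omega : ¬ r + 1 = r)]
      · by_contra h
        exact hex ⟨q, hq, not_lt.1 h⟩
  · obtain rfl : u = r := by rw [hu, if_neg fun h => absurd h.1 (not_lt.2 hle)]
    refine exists_raise_of_horiz (k' := k') hx (fun t ht => ?_) ?_ p1 p2 hle (hlt hle)
    · rw [hk', if_neg ht]
      rfl
    · rw [hk', if_pos rfl]

end DominoTableau

/-! ### The projection and the Carré-Leclerc correspondence -/

namespace DominoTableau

variable {lam mu : YoungDiagram} {D : DominoTableau lam mu}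

/-- Raising decreases the sum of the entries, so that it can be used for induction. -/
theorem Raise.sum_entries_lt {D' : DominoTableau lam mu} {i : ℕ} (h : D.Raise i D') :
    ∑ y ∈ D'.dominoes, y.2 < ∑ y ∈ D.dominoes, y.2 := by
  obtain ⟨⟨x, p⟩, hx, hrep⟩ := h
  obtain rfl : p = i + 1 := ((D.isRowCompatible i).isFirstMax_of_isRaisingPlace hx).1
  have hxD : (x, i + 1) ∈ D.dominoes := hx.1.1
  have key : ∀ F, Relation.ReflTransGen (Repair i)
      (insert (x, i) (D.dominoes.erase (x, i + 1))) F →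
      IsPacking F ∧ ∑ y ∈ F, (y.2 : ℤ) + 1 = ∑ y ∈ D.dominoes, (y.2 : ℤ) := by
    intro F hF
    induction hF with
    | refl =>
      refine ⟨D.isPacking_change hxD, ?_⟩
      rw [D.sum_change hxD (by omega) fun y => (y.2 : ℤ)]
      push_cast
      ring
    | tail _ h ih =>
      obtain ⟨h1, -, h3⟩ := h.spec ih.1
      refine ⟨h1, ?_⟩
      rw [← ih.2]
      rcases h3 with ⟨r, c, h3⟩ | ⟨r, c, c₁, c₂, h3⟩ <;>
      · rw [h3 fun y => (y.2 : ℤ)]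
        push_cast
        ring
  have h1 := (key _ hrep).2
  have h2 : (∑ y ∈ D'.dominoes, (y.2 : ℤ)) < ∑ y ∈ D.dominoes, (y.2 : ℤ) := by omega
  exact_mod_cast h2

/-- The induction principle behind the Carré-Leclerc algorithm. -/
theorem raise_induction {P : DominoTableau lam mu → Prop} (hY : ∀ D, D.IsYamanouchi → P D)
    (hR : ∀ i D D', D.Raise i D' → P D' → P D) (D : DominoTableau lam mu) : P D := by
  induction hn : ∑ y ∈ D.dominoes, y.2 using Nat.strong_induction_on generalizing D with
  | _ n ih =>
    by_cases h : D.IsYamanouchi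
    · exact hY D h
    · obtain ⟨i, D', hD'⟩ := exists_raise h
      exact hR i D D' hD' (ih _ (hn ▸ hD'.sum_entries_lt) D' rfl)

theorem IsYamanouchi.projection_eq (hY : D.IsYamanouchi) {T : YoungTableau}
    (hT : IsOctaProjection D T) :
    T = canonicalTableau T.1 ∧ ∀ k, D.weight k = T.1.rowLen k := by
  obtain ⟨g, hg, hD, hgT, hw⟩ := hT
  have hT : T = canonicalTableau T.1 := by
    refine canonicalTableau_of_excess_nonpos T fun i t => ?_
    have hle := (D.isRowCompatible i).rowExcess_nonpos hY
    obtain ⟨r, hr⟩ := exists_isFirstMax hle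
    obtain ⟨-, v, -, -, -, hv, hve, -⟩ := D.exists_bump_rows hg hD hr
    obtain ⟨s, hs, hse, -⟩ := (eqvGen_bump hgT i).2 v hv
    have h1 := hs.1 t
    have h2 := hle r
    rw [hse, hve] at h1
    exact h1.trans h2
  refine ⟨hT, fun k => ?_⟩
  rw [hw, ← canonicalTableau_weight T.1 k, ← hT]

theorem exists_isOctaProjection (D : DominoTableau lam mu) : ∃ T, IsOctaProjection D T :=
  D.exists_isProjection.imp fun _ h => h.isOctaProjection

theorem IsYamanouchi.isOctaProjection (hY : D.IsYamanouchi) {kap : YoungDiagram}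
    (hw : ∀ k, D.weight k = kap.rowLen k) : IsOctaProjection D (canonicalTableau kap) := by
  obtain ⟨T, hT⟩ := D.exists_isOctaProjection
  obtain ⟨h1, h2⟩ := hY.projection_eq hT
  obtain rfl : T.1 = kap := YoungDiagram.ext_rowLen fun k => by rw [← h2, hw]
  rwa [← h1]

/-- For a Yamanouchi tableau the weight determines the projection. Otherwise the projection of a
raised tableau determines it, because the operation on Young tableaux is injective. -/
theorem isOctaProjection_unique (D : DominoTableau lam mu) : ∀ {T₁ T₂ : YoungTableau},
    IsOctaProjection D T₁ → IsOctaProjection D T₂ → T₁ = T₂ := by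
  refine raise_induction (P := fun D => ∀ {T₁ T₂ : YoungTableau},
    IsOctaProjection D T₁ → IsOctaProjection D T₂ → T₁ = T₂) (fun D hY T₁ T₂ h₁ h₂ => ?_)
    (fun i D D' hD ih T₁ T₂ h₁ h₂ => ?_) D
  · obtain ⟨e₁, w₁⟩ := hY.projection_eq h₁
    obtain ⟨e₂, w₂⟩ := hY.projection_eq h₂
    rw [e₁, e₂, YoungDiagram.ext_rowLen fun k => (w₁ k).symm.trans (w₂ k)]
  · obtain ⟨T₁', r₁, p₁⟩ := hD.exists_youngRaise h₁
    obtain ⟨T₂', r₂, p₂⟩ := hD.exists_youngRaise h₂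
    have h := ih p₁ p₂
    obtain ⟨k₁, t₁⟩ := T₁
    obtain ⟨k₂, t₂⟩ := T₂
    cases h
    exact congrArg (Sigma.mk k₁) (r₁.source_unique r₂)

theorem isProjection_iff {T : YoungTableau} : IsProjection D T ↔ IsOctaProjection D T := by
  refine ⟨fun h => h.isOctaProjection, fun h => ?_⟩
  obtain ⟨T', hT'⟩ := D.exists_isProjection
  rwa [D.isOctaProjection_unique h hT'.isOctaProjection]

theorem exists_carreLeclerc (D : DominoTableau lam mu) : ∀ {T : YoungTableau},
    IsOctaProjection D T → ∃ Y, CarreLeclerc D Y T := by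
  refine raise_induction (P := fun D => ∀ {T : YoungTableau},
    IsOctaProjection D T → ∃ Y, CarreLeclerc D Y T) (fun D hY T hT => ?_)
    (fun i D D' hD ih T hT => ?_) D
  · obtain ⟨e, w⟩ := hY.projection_eq hT
    rw [e]
    exact ⟨D, .yamanouchi D T.1 hY w⟩
  · obtain ⟨T', r, p⟩ := hD.exists_youngRaise hT
    obtain ⟨Y, hY⟩ := ih p
    exact ⟨Y, .step i D D' Y T.1 T.2 T' hD r hY⟩

end DominoTableau

open DominoTableau

theorem CarreLeclerc.isOctaProjection {lam mu : YoungDiagram} {D Y : DominoTableau lam mu}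
    {T : YoungTableau} (h : CarreLeclerc D Y T) : IsOctaProjection D T := by
  induction h with
  | yamanouchi Y kap hY hw => exact hY.isOctaProjection hw
  | step i D D' Y kap T T' hD hT _ ih =>
    obtain ⟨⟨kap', S⟩, hS⟩ := D.exists_isOctaProjection
    obtain ⟨S', r, p⟩ := hD.exists_youngRaise hS
    have h := D'.isOctaProjection_unique p ih
    cases h
    rwa [hT.source_unique r]

theorem mainTheorem1 (lam mu : YoungDiagram) (D : DominoTableau lam mu) :
    (∃ T : YoungTableau,
      (∀ T' : YoungTableau, IsProjection D T' ↔ T' = T) ∧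
      (∀ T' : YoungTableau, (∃ Y : DominoTableau lam mu, CarreLeclerc D Y T') ↔ T' = T)) ∧
    ∀ kap : YoungDiagram, (∀ k, D.weight k = kap.rowLen k) →
      (D.IsYamanouchi ↔ IsProjection D (canonicalTableau kap)) := by
  obtain ⟨T, hT⟩ := D.exists_isOctaProjection
  refine ⟨⟨T, fun T' => ?_, fun T' => ⟨fun ⟨Y, hY⟩ => ?_, ?_⟩⟩, fun kap hw => ?_⟩
  · rw [isProjection_iff]
    exact ⟨fun h => D.isOctaProjection_unique h hT, fun h => h ▸ hT⟩
  · exact D.isOctaProjection_unique hY.isOctaProjection hT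
  · rintro rfl
    exact D.exists_carreLeclerc hT
  · rw [isProjection_iff]
    refine ⟨fun hY => hY.isOctaProjection hw, fun h => ?_⟩
    by_contra hY
    obtain ⟨i, D', hD'⟩ := exists_raise hY
    obtain ⟨T', r, -⟩ := hD'.exists_youngRaise h
    exact not_youngRaise_highestWeight r
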